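/- Conventions. An FA-presentation of a structure $\mathcal A=(D;R_1,\dots,R_\ell,f_1,\dots)$ is a surjection $\psi:L\to D$ from a regular language $L$ over a finite alphabet such that the $\psi$-preimages of equality, of each $R_i$ and of the graph of each $f_j$ are regular (as languages of padded convolutions of strings). A Cayley automatic representation of a group $G$ with respect to a finite generating set $S$ is an FA-presentation $\psi:L\to G$ of the labelled Cayley graph $\Gamma(G,S)$ (edges $g\to gs$ labelled $s\in S$). The compressibility rate of $\psi:L\to D$ relative to $\psi_0:L_0\to D$ is $s(n)=\max\{\xi(w): w\in L,\ |w|\le n\}$ (and $0$ if there is no such $w$), where $\xi(w)=\min\{|v|: v\in L_0,\ \psi_0(v)=\psi(w)\}$. Let $T(0)=1$, $T(n+1)=2^{T(n)}$. We write $s\ge T$ if $s(n)\ge T(n)$ for all sufficiently large $n$. The strings $u_k$. Let $V$ be the set of tuples $(a,b,c,d)$ of non-negative integers with $c$ a power of $2$, $d\in\{0,1\}$, such that $c>1$ if $a>0$ and $b=0$, and $c=1$ if $a=0$. Define $f:V\to V$ by $(a,b,c,0)\mapsto(a,b-1,2c,0)$ if $a,b>0$; $(a,0,c,0)\mapsto(a-1,c,1,0)$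 if $a>0$; $(0,b,1,0)\mapsto(0,b+1,1,1)$; $(a,b,c,1)\mapsto(a,b+1,c/2,1)$ if $c>1$; $(a,b,1,1)\mapsto(a+1,0,b,1)$ if $b=2^j$ with $j>0$; $(a,b,1,1)\mapsto(a,b,1,0)$ otherwise. For $k\ge0$ let $u_k$ be the convolution of the four reversed binary representations ($0$ being represented by the string $0$) of the components of $f^k(0,0,1,1)$. The symbols of the strings $u_k$ are taken disjoint from all other alphabets below. Theorem. In each of the following cases $\psi_0$ and $\psi$ are well defined bijective Cayley automatic representations of $G$ with respect to the indicated generators, and the compressibility rate $s$ of $\psi$ relative to $\psi_0$ satisfies $s\ge T$. 1. $G=\mathbb Z^m$, $m\ge1$, with the standard generators $a_1,\dots,a_m$. The map $\psi_0$ sends the string $a_1^{k_1}\cdots a_m^{k_m}$ ($k_i\in\mathbb Z$) to the same element of $G$. The map $\psi$ sends $a_1^{k_1}a_2^{k_2}\cdots a_m^{k_m}$ for $k_1<0$, and $u_{k_1}a_2^{k_2}\cdots a_m^{k_m}$ for $k_1\ge0$, to $a_1^{k_1}\cdots a_m^{k_m}$. 2. $G=F_m$, the free group on $a_1,\dots,a_m$,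 $m\ge1$. The map $\psi_0$ sends each reduced word to the element it represents. Writing a reduced word as $a_1^kw'$ with $k\in\mathbb Z$, where $w'$ does not begin with $a_1^{\pm1}$, $\psi$ sends $a_1^kw'$ for $k<0$, and $u_kw'$ for $k\ge0$, to $a_1^kw'\in G$. 3. $G=BS(p,q)=\langle a,t\mid ta^pt^{-1}=a^q\rangle$, $1\le p<q$, with generators $a,t$. Consider the normal forms $\widetilde w a^m$ with $\widetilde w=w_\ell t^{\varepsilon_\ell}\cdots w_1t^{\varepsilon_1}$, $\varepsilon_i=\pm1$, $m\in\mathbb Z$, $w_i\in\{1,a,\dots,a^{q-1}\}$ if $\varepsilon_i=1$, $w_i\in\{1,a,\dots,a^{p-1}\}$ if $\varepsilon_i=-1$, with no subword $t^{\varepsilon}t^{-\varepsilon}$ in $\widetilde w$. The map $\psi_0$ sends the string $\widetilde w z$ to $\widetilde wa^m\in G$, where $z$ is the $q$-ary representation of $m$ (a minus sign if $m<0$, then the digits of $|m|$, least significant first; the empty string if $m=0$). Writing $\widetilde wz=t^k\omega$ with $k\ge 0$ maximal, $\psi$ sends $u_k\omega$ to the same element. 4. $G=\mathbb Z^2\rtimes_A\mathbb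 Z$, $A\in GL(2,\mathbb Z)$, with generators $a,e_1,e_2$, where $a$ generates $\mathbb Z$ and acts on $\mathbb Z^2$ by $z\mapsto Az$. Let $\psi':L'\to\mathbb Z^2$ be any bijective FA-presentation of $\mathbb Z^2$ with the translations $z\mapsto z+e_1$, $z\mapsto z+e_2$ and the map $f_A:z\mapsto Az$, over an alphabet not containing $a^{\pm1}$. The map $\psi_0$ sends $a^kv$ ($k\in\mathbb Z$, $v\in L'$) to the element $a^k\psi'(v)$ of $G$; $\psi$ sends $a^kv$ for $k<0$, and $u_kv$ for $k\ge0$, to $a^k\psi'(v)$. Here $s\ge T$ is claimed under the additional assumption that the empty string is in $L'$. For every $A$ there is such a $\psi'$ with the empty string in $L'$. -/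

import Mathlib

open Matrix

namespace CompressFA

universe u v

/-! ### Automatic relations and FA-presentations -/

/-- The convolution of a tuple of strings; `none` is the padding symbol. -/
def convolution {k : ℕ} {α : Type u} (w : Fin k → List α) : List (Fin k → Option α) :=
  (List.range (Finset.univ.sup fun i => (w i).length)).map fun j i => (w i)[j]?

/-- A relation on strings is FA-recognizable if the language of its convolutions is regular. -/
def FARecognizable {k : ℕ} {α : Type u} (R : Set (Fin k → List α)) : Prop :=
  Language.IsRegular (convolution '' R : Set (List (Fin k → Option α)))

/-- A relational structure on `D` (a function is given by its graph). -/
structure RelStr (D : Type u) where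
  Idx : Type u
  arity : Idx → ℕ
  rel : ∀ i, Set (Fin (arity i) → D)

/-- The preimage of a relation on `D` under `ψ : L → D`, as a relation on strings. -/
def preimageRel {α : Type u} {D : Type v} {L : Language α} (ψ : {w // w ∈ L} → D) {k : ℕ}
    (R : Set (Fin k → D)) : Set (Fin k → List α) :=
  {w | ∃ x : Fin k → {w // w ∈ L}, (∀ i, (x i).1 = w i) ∧ (fun i => ψ (x i)) ∈ R}

/-- `ψ : L → D` is an FA-presentation of the structure `A`. -/
structure IsFAPresentation {α : Type u} [Finite α] {D : Type v} (A : RelStr D)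
    (L : Language α) (ψ : {w // w ∈ L} → D) : Prop where
  surjective : Function.Surjective ψ
  regular : L.IsRegular
  rel : ∀ i, FARecognizable (preimageRel ψ (A.rel i))
  eq : FARecognizable (preimageRel ψ {x : Fin 2 → D | x 0 = x 1})

/-- The labelled directed Cayley graph `Γ(G, S)`: one binary relation `g → g s` for each `s ∈ S`. -/
def cayleyGraph {G : Type u} [Group G] (S : Set G) : RelStr G where
  Idx := S
  arity := fun _ => 2
  rel := fun s => {x | x 1 = x 0 * s.1}

/-- `ψ : L → G` is a Cayley automatic representation of `G`, with respect to the finite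
generating set `S`. -/
structure IsCayleyAutomaticRep {α : Type u} [Finite α] {G : Type v} [Group G] (S : Set G)
    (L : Language α) (ψ : {w // w ∈ L} → G) : Prop where
  finite : S.Finite
  generates : Subgroup.closure S = ⊤
  presentation : IsFAPresentation (cayleyGraph S) L ψ

/-! ### Compressibility rate -/

/-- The least length of a representative, with respect to `ψ₀`, of the element `ψ w`. -/
noncomputable def xi {α₀ α : Type u} {D : Type v} {L₀ : Language α₀} {L : Language α}
    (ψ₀ : {w // w ∈ L₀} → D) (ψ : {w // w ∈ L} → D) (w : {w // w ∈ L}) : ℕ :=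
  sInf {l | ∃ x : {w // w ∈ L₀}, ψ₀ x = ψ w ∧ x.1.length = l}

/-- The compressibility rate of `ψ` relative to `ψ₀`: the maximum of `xi` over the strings of `L`
of length at most `n`, and `0` if there are none. (Over a finite alphabet the set is finite.) -/
noncomputable def compRate {α₀ α : Type u} {D : Type v} {L₀ : Language α₀} {L : Language α}
    (ψ₀ : {w // w ∈ L₀} → D) (ψ : {w // w ∈ L} → D) (n : ℕ) : ℕ :=
  sSup {y | ∃ w : {w // w ∈ L}, w.1.length ≤ n ∧ xi ψ₀ ψ w = y}

/-- The tower function. -/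
def T : ℕ → ℕ
  | 0 => 1
  | n + 1 => 2 ^ T n

/-- `s ≥ r` for functions: `s n ≥ r n` for all sufficiently large `n`. -/
def EventuallyGE (s r : ℕ → ℕ) : Prop := ∃ N, ∀ n, N ≤ n → r n ≤ s n

/-! ### The strings `u k` -/

/-- The set of admissible tuples `(a, b, c, d)`. -/
def V : Set (ℕ × ℕ × ℕ × ℕ) :=
  {(a, b, c, d) : ℕ × ℕ × ℕ × ℕ |
    ((∃ k, c = 2 ^ k) ∧ (d = 0 ∨ d = 1)) ∧ (0 < a → b = 0 → 1 < c) ∧ (a = 0 → c = 1)}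

open Classical in
/-- The six rules defining `f`. -/
noncomputable def step : ℕ × ℕ × ℕ × ℕ → ℕ × ℕ × ℕ × ℕ
  | (a, b, c, d) =>
    if d = 0 then
      if 0 < a then
        if 0 < b then (a, b - 1, 2 * c, 0) else (a - 1, c, 1, 0)
      else (0, b + 1, 1, 1)
    else
      if 1 < c then (a, b + 1, c / 2, 1)
      else if ∃ k, 0 < k ∧ b = 2 ^ k then (a + 1, 0, b, 1)
      else (a, b, 1, 0)

theorem step_mem (v : ℕ × ℕ × ℕ × ℕ) (hv : v ∈ V) : step v ∈ V := by
  obtain ⟨a, b, c, d⟩ := v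
  obtain ⟨⟨⟨k, rfl⟩, hd⟩, h2, h3⟩ := hv
  have hk : 0 < 2 ^ k := by positivity
  unfold step
  dsimp only
  split_ifs with h h' h'' h' h''
  · exact ⟨⟨⟨k + 1, by ring⟩, by simp⟩, fun _ _ => by omega, fun _ => by omega⟩
  · have := h2 h' (by omega)
    exact ⟨⟨⟨0, rfl⟩, by simp⟩, fun _ _ => by omega, fun _ => rfl⟩
  · exact ⟨⟨⟨0, rfl⟩, by simp⟩, fun _ _ => by omega, fun _ => rfl⟩
  · rcases k with _ | k
    · simp at h'
    · refine ⟨⟨⟨k, by rw [pow_succ]; omega⟩, by simp⟩, fun _ _ => by omega, fun ha => ?_⟩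
      have := h3 ha
      omega
  · obtain ⟨j, hj, rfl⟩ := h''
    exact ⟨⟨⟨j, rfl⟩, by simp⟩, fun _ _ => Nat.one_lt_two_pow (by omega), fun _ => by omega⟩
  · refine ⟨⟨⟨0, rfl⟩, by simp⟩, fun ha hb => ?_, fun _ => rfl⟩
    have := h2 ha hb
    omega

/-- The function `f : V → V`. -/
noncomputable def f (v : V) : V := ⟨step v.1, step_mem v.1 v.2⟩

/-- The tuple that corresponds to the number `0`. -/
def v₀ : V := ⟨(0, 0, 1, 1), ⟨⟨0, rfl⟩, Or.inr rfl⟩, fun h => absurd h (lt_irrefl 0), fun _ => rfl⟩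

/-- The reversed binary representation; the number `0` is represented by the string `0`. -/
def revBin (n : ℕ) : List Bool := if n = 0 then [false] else Nat.bits n

/-- The alphabet of the strings `u k`: columns of the convolution of four binary strings. -/
abbrev Col : Type := Fin 4 → Option Bool

/-- The string that represents a tuple `(a, b, c, d)`. -/
def encodeTuple : ℕ × ℕ × ℕ × ℕ → List Col
  | (a, b, c, d) => convolution ![revBin a, revBin b, revBin c, revBin d]

/-- The string that represents `k` with respect to the FA-presentation of `(ℕ; S)`: the
isomorphism of `(V; f)` with `(ℕ; S)` that maps `v₀` to `0` maps `f^k v₀` to `k`. -/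
noncomputable def u (k : ℕ) : List Col := encodeTuple (f^[k] v₀).1

/-! ### Presentations given by normal forms -/

/-- The language of all normal forms `enc x`. -/
def langOf {N : Type v} {α : Type u} (enc : N → List α) : Language α := (Set.range enc : Set (List α))

/-- The map that sends the string `enc x` to `val x`. -/
noncomputable def mapOf {N : Type v} {α : Type u} {G : Type v} (enc : N → List α) (val : N → G) :
    {w // w ∈ langOf enc} → G :=
  fun w => val (Classical.choose (show ∃ x, enc x = w.1 from w.2))

/-- The assignment `enc x ↦ val x` is well defined, and it is a bijective Cayley automatic
representation of `G` with respect to the generators `S`. -/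
structure IsBijectiveCayleyRep {N : Type v} {α : Type u} [Finite α] {G : Type v} [Group G]
    (S : Set G) (enc : N → List α) (val : N → G) : Prop where
  map_enc : ∀ x : N, mapOf enc val ⟨enc x, x, rfl⟩ = val x
  bijective : Function.Bijective (mapOf enc val)
  cayley : IsCayleyAutomaticRep S (langOf enc) (mapOf enc val)

/-- In a new alphabet `α ⊕ Col`, the old symbols are `Sum.inl x` and the symbols of the strings
`u k` are `Sum.inr c`. -/
def old {α : Type u} (w : List α) : List (α ⊕ Col) := w.map Sum.inl

/-- The string `u k`, over the new alphabet. -/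
noncomputable def uNew (α : Type u) (k : ℕ) : List (α ⊕ Col) := (u k).map Sum.inr

/-- Write `w = x^k ω` with `k` maximal and replace it by `u_k ω`. -/
noncomputable def replacePrefix {α : Type u} [DecidableEq α] (x : α) (w : List α) :
    List (α ⊕ Col) :=
  uNew α (w.takeWhile (fun y => decide (y = x))).length ++
    old (w.dropWhile (fun y => decide (y = x)))

/-- The string `x^k`, for an integer `k` and symbols `x`, `xinv` that stand for `x` and `x⁻¹`. -/
def powString {α : Type u} (x xinv : α) (k : ℤ) : List α :=
  if 0 ≤ k then List.replicate k.natAbs x else List.replicate k.natAbs xinv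

/-- The string `x^k` for `k < 0` and the string `u_k` for `k ≥ 0`. -/
noncomputable def powStringNew {α : Type u} (x xinv : α) (k : ℤ) : List (α ⊕ Col) :=
  if 0 ≤ k then uNew α k.natAbs else old (powString x xinv k)

/-! ### Free abelian groups -/

/-- The free abelian group of rank `m`, written multiplicatively. -/
abbrev FreeAb (m : ℕ) : Type := Multiplicative (Fin m → ℤ)

/-- The standard generator `a_i`. -/
def freeAbGen {m : ℕ} (i : Fin m) : FreeAb m := Multiplicative.ofAdd (Pi.single i 1)

/-- The string `a_1^{k_1} ⋯ a_m^{k_m}`; `(i, true)` is `a_i` and `(i, false)` is its inverse. -/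
def freeAbEnc₀ (m : ℕ) (k : Fin m → ℤ) : List (Fin m × Bool) :=
  (List.ofFn fun i => powString (i, true) (i, false) (k i)).flatten

/-- The same string with the first power `a_1^{k_1}` replaced by `u_{k_1}` if `k_1 ≥ 0`. -/
noncomputable def freeAbEnc (m : ℕ) [NeZero m] (k : Fin m → ℤ) : List ((Fin m × Bool) ⊕ Col) :=
  (List.ofFn fun i =>
    if i = 0 then powStringNew (i, true) (i, false) (k i)
    else old (powString (i, true) (i, false) (k i))).flatten

/-- The group element `a_1^{k_1} ⋯ a_m^{k_m}`. -/
def freeAbVal (m : ℕ) (k : Fin m → ℤ) : FreeAb m := ∏ i, freeAbGen i ^ k i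

/-! ### Free groups -/

/-- Reduced words over `a_1^{±1}, …, a_m^{±1}`. -/
abbrev ReducedWord (m : ℕ) : Type := {w : List (Fin m × Bool) // FreeGroup.IsReduced w}

/-- A reduced word `a_1^k ω`, where `ω` does not begin with `a_1^{±1}`, is replaced by `u_k ω` if
`k ≥ 0` and kept if `k < 0`. -/
noncomputable def freeEnc (m : ℕ) [NeZero m] (w : ReducedWord m) : List ((Fin m × Bool) ⊕ Col) :=
  if w.1.head? = some (0, false) then old w.1 else replacePrefix (0, true) w.1

/-- The element of the free group given by a reduced word. -/
def freeVal (m : ℕ) (w : ReducedWord m) : FreeGroup (Fin m) := FreeGroup.mk w.1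

/-! ### Baumslag-Solitar groups -/

/-- The relator of `t a^p t⁻¹ = a^q`, where `a` is the generator `0` and `t` is the generator `1`. -/
def bsRels (p q : ℕ) : Set (FreeGroup (Fin 2)) :=
  {FreeGroup.of 1 * FreeGroup.of 0 ^ p * (FreeGroup.of 1)⁻¹ * (FreeGroup.of 0 ^ q)⁻¹}

/-- `BS(p, q) = ⟨a, t | t a^p t⁻¹ = a^q⟩`. -/
abbrev BS (p q : ℕ) : Type := PresentedGroup (bsRels p q)

def bsA (p q : ℕ) : BS p q := PresentedGroup.of 0

def bsT (p q : ℕ) : BS p q := PresentedGroup.of 1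

/-- The symbols `a`, `t`, `t⁻¹`, a minus sign, and the digits `0, …, q - 1`. -/
inductive BSLetter (q : ℕ) : Type
  | a
  | t
  | tInv
  | minus
  | digit (d : Fin q)
  deriving DecidableEq, Fintype

/-- A block `(w, ε)` stands for `a^w t^ε`, with `ε = 1` for `true` and `ε = -1` for `false`.
A list of blocks is admissible if `w < q` for `ε = 1`, `w < p` for `ε = -1`, and it
contains no `t^ε t^{-ε}`. -/
def bsAdmissible (p q : ℕ) (l : List (ℕ × Bool)) : Prop :=
  (∀ b ∈ l, b.1 < if b.2 then q else p) ∧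
    l.IsChain fun b b' => ¬ (b'.1 = 0 ∧ b'.2 = !b.2)

/-- A normal form `w_ℓ t^{ε_ℓ} ⋯ w_1 t^{ε_1} a^m`. -/
structure BSNormalForm (p q : ℕ) : Type where
  blocks : List (ℕ × Bool)
  admissible : bsAdmissible p q blocks
  m : ℤ

/-- The string of a block. -/
def bsBlockString (q : ℕ) (b : ℕ × Bool) : List (BSLetter q) :=
  List.replicate b.1 .a ++ [if b.2 then .t else .tInv]

/-- The signed `q`-ary representation of an integer, least significant digit first; the number `0`
is represented by the empty string. -/
def qary (q : ℕ) (hq : 1 < q) (m : ℤ) : List (BSLetter q) :=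
  (if m < 0 then [.minus] else []) ++
    (Nat.digits q m.natAbs).pmap (fun d h => .digit ⟨d, h⟩)
      (fun _ hd => Nat.digits_lt_base hq hd)

/-- The string of a normal form: the word `w_ℓ t^{ε_ℓ} ⋯ w_1 t^{ε_1}` followed by the `q`-ary
representation of `m`. -/
def bsEnc₀ (p q : ℕ) (hq : 1 < q) (x : BSNormalForm p q) : List (BSLetter q) :=
  (x.blocks.map (bsBlockString q)).flatten ++ qary q hq x.m

/-- The same string with its maximal prefix of the form `t^k` replaced by `u_k`. -/
noncomputable def bsEnc (p q : ℕ) (hq : 1 < q) (x : BSNormalForm p q) :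
    List (BSLetter q ⊕ Col) :=
  replacePrefix .t (bsEnc₀ p q hq x)

/-- The group element of a normal form. -/
def bsVal (p q : ℕ) (x : BSNormalForm p q) : BS p q :=
  (x.blocks.map fun b => bsA p q ^ b.1 * (if b.2 then bsT p q else (bsT p q)⁻¹)).prod *
    bsA p q ^ x.m

/-! ### Semidirect products -/

/-- The automorphism `z ↦ A z` of `ℤ²`. -/
def glAddEquiv (A : GL (Fin 2) ℤ) : (Fin 2 → ℤ) ≃+ (Fin 2 → ℤ) where
  toFun z := A.1 *ᵥ z
  invFun z := A⁻¹.1 *ᵥ z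
  left_inv z := by
    change A⁻¹.1 *ᵥ (A.1 *ᵥ z) = z
    rw [Matrix.mulVec_mulVec, Units.inv_mul, Matrix.one_mulVec]
  right_inv z := by
    change A.1 *ᵥ (A⁻¹.1 *ᵥ z) = z
    rw [Matrix.mulVec_mulVec, Units.mul_inv, Matrix.one_mulVec]
  map_add' z z' := Matrix.mulVec_add _ z z'

/-- The same automorphism, for `ℤ²` written multiplicatively. -/
def glAut (A : GL (Fin 2) ℤ) : MulAut (Multiplicative (Fin 2 → ℤ)) :=
  AddEquiv.toMultiplicative (glAddEquiv A)

/-- `ℤ² ⋊_A ℤ`: the generator of `ℤ` acts on `ℤ²` by `z ↦ A z`. -/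
abbrev Semi (A : GL (Fin 2) ℤ) : Type :=
  Multiplicative (Fin 2 → ℤ) ⋊[zpowersHom (MulAut (Multiplicative (Fin 2 → ℤ))) (glAut A)]
    Multiplicative ℤ

/-- The generator `a` of the subgroup `ℤ`. -/
def semiA (A : GL (Fin 2) ℤ) : Semi A := SemidirectProduct.inr (Multiplicative.ofAdd 1)

/-- An element of the subgroup `ℤ²`. -/
def semiZ (A : GL (Fin 2) ℤ) (z : Fin 2 → ℤ) : Semi A :=
  SemidirectProduct.inl (Multiplicative.ofAdd z)

/-- The generators `a`, `e_1`, `e_2` of `ℤ² ⋊_A ℤ`. -/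
def semiGens (A : GL (Fin 2) ℤ) : Set (Semi A) :=
  insert (semiA A) (Set.range fun i : Fin 2 => semiZ A (Pi.single i 1))

/-- `ℤ²` with the unary functions `z ↦ z + e_1`, `z ↦ z + e_2` (the Cayley graph of the group
`ℤ²`) and `f_A : z ↦ A z`, each given by its graph. -/
def z2Str (A : GL (Fin 2) ℤ) : RelStr (Fin 2 → ℤ) where
  Idx := Option (Fin 2)
  arity := fun _ => 2
  rel := fun
    | none => {x | x 1 = glAddEquiv A (x 0)}
    | some i => {x | x 1 = x 0 + Pi.single i 1}

/-- The string `a^k v`; the symbols `a` and `a⁻¹` are `Sum.inl true` and `Sum.inl false`. -/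
def semiEnc₀ {β : Type} (L' : Language β) (x : ℤ × {v // v ∈ L'}) : List (Bool ⊕ β) :=
  powString (Sum.inl true) (Sum.inl false) x.1 ++ x.2.1.map Sum.inr

/-- The string `a^k v` for `k < 0` and `u_k v` for `k ≥ 0`. -/
noncomputable def semiEnc {β : Type} (L' : Language β) (x : ℤ × {v // v ∈ L'}) :
    List ((Bool ⊕ β) ⊕ Col) :=
  powStringNew (Sum.inl true) (Sum.inl false) x.1 ++ old (x.2.1.map Sum.inr)

/-- The group element `a^k z`, where `z = ψ' v`. -/
def semiVal (A : GL (Fin 2) ℤ) {β : Type} {L' : Language β}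
    (ψ' : {v // v ∈ L'} → (Fin 2 → ℤ)) (x : ℤ × {v // v ∈ L'}) : Semi A :=
  semiA A ^ x.1 * semiZ A (ψ' x.2)

end CompressFA

/-! Growth. A tuple `(a, b, c, d)` describes the number `N = expTower a (b + log₂ c)`. From `(0, N,
1, 1)` the map `f` first rewrites `N` as a tower of twos, as high as possible (`d = 1`), then
unfolds it to `(0, N, 1, 0)` (`d = 0`) and passes on to `N + 1`. Hence the orbit of `v₀` visits
every tuple of `V` exactly once (`orbit_injective`, `orbit_surjective`), while `N` grows by at most
one in each step (`level_orbit_le`). The tuple `(n, 1, 1, 1)` describes `T n`, so it is `f^k v₀` for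
some `k ≥ T n`; but its string is no longer than `n` (`exists_u_short`). In each of the groups the
string `u k`, followed by nothing, is a normal form for `ψ`, and the only `ψ₀`-string of the same
element has length `k`. This gives the bound on the rate (`eventuallyGE_compRate`).

Automaticity. Linear equations and the property of being a power of two can be checked by finite
automata on binary representations, so the language of the strings `u k` and the graph of `f` on
them are recognizable (`reg_u`, `fa_u_succ`). The strings `u k` are prefixes of longer strings, and
replacing `u k` by `u (k + 1)` may displace everything that follows. As one application of `f`
changes the length by at most one (`length_encodeTuple_step`), the displacement is harmless: the
successor relation may be multiplied on the right by any recognizable relation (`Synch`,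
`FA.synch`). A normal form in each group is an encoded power followed by a tail, and right
multiplication by a generator keeps the exponent or raises it by one, and acts on the tail by a
recognizable relation. The arguments are carried out for an arbitrary encoding of the exponent
(`IsCoder`), so that `ψ₀` and `ψ` are treated together.

Group theory. The bijection between normal forms and elements is immediate for free abelian, free
and semidirect products. For `BS(p, q)` it follows from an action of the group on the normal forms
(`bsHom`, `revVal_bijective`). A suitable presentation of `ℤ²` for every `A` is given by balanced
ternary expansions. -/

namespace CompressFA

/-! ### Regular predicates on strings -/

section Regular

variable {α β : Type*}

/-- The strings that satisfy `P` form a regular language. -/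
def Reg (P : List α → Prop) : Prop :=
  Language.IsRegular (show Language α from ({z | P z} : Set (List α)))

/-- The type of residuals of a predicate on strings. -/
def Res (P : List α → Prop) : Type _ := Set.range fun (x y : List α) => P (x ++ y)

/-- The residual after reading `x`. -/
def resid (P : List α → Prop) (x : List α) : Res P := ⟨fun y => P (x ++ y), x, rfl⟩

theorem resid_eq {P : List α → Prop} {x y : List α} (h : resid P x = resid P y) (z : List α) :
    P (x ++ z) ↔ P (y ++ z) := by
  have := congrFun (congrArg Subtype.val h) z
  exact iff_of_eq this

theorem reg_iff {P : List α → Prop} : Reg P ↔ Finite (Res P) := by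
  exact Language.isRegular_iff_finite_range_leftQuotient (L := {z | P z})

/-- The Myhill–Nerode criterion in working form: regularity follows from an invariant of prefixes
that takes finitely many values and determines the accepted continuations. By symmetry in `x` and
`y` one implication is enough. -/
theorem Reg.of_state {σ : Type*} [Finite σ] {P : List α → Prop} (st : List α → σ)
    (h : ∀ x y, st x = st y → ∀ z, P (x ++ z) → P (y ++ z)) : Reg P := by
  rw [reg_iff]
  have : Finite (Set.range st) := inferInstance
  refine Finite.of_surjective (fun s : Set.range st => resid P (Classical.choose s.2)) ?_
  rintro ⟨_, x, rfl⟩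
  refine ⟨⟨st x, x, rfl⟩, Subtype.ext (funext fun z => propext ?_)⟩
  have hx := Classical.choose_spec (⟨x, rfl⟩ : st x ∈ Set.range st)
  exact ⟨h _ _ hx z, h _ _ hx.symm z⟩

theorem Reg.congr {P Q : List α → Prop} (hP : Reg P) (h : ∀ z, Q z ↔ P z) : Reg Q := by
  have : Q = P := funext fun z => propext (h z)
  rwa [this]

theorem Reg.not {P : List α → Prop} (hP : Reg P) : Reg fun z => ¬ P z := by
  have := reg_iff.1 hP
  exact Reg.of_state (resid P) fun x y h z => by rw [resid_eq h]; exact id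

theorem Reg.and {P Q : List α → Prop} (hP : Reg P) (hQ : Reg Q) : Reg fun z => P z ∧ Q z := by
  have := reg_iff.1 hP
  have := reg_iff.1 hQ
  refine Reg.of_state (fun x => (resid P x, resid Q x)) fun x y h z => ?_
  rw [resid_eq (congrArg Prod.fst h), resid_eq (congrArg Prod.snd h)]
  exact id

theorem Reg.or {P Q : List α → Prop} (hP : Reg P) (hQ : Reg Q) : Reg fun z => P z ∨ Q z :=
  (hP.not.and hQ.not).not.congr fun z => by tauto

theorem Reg.forall {ι : Type*} [Finite ι] {P : ι → List α → Prop} (hP : ∀ i, Reg (P i)) :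
    Reg fun z => ∀ i, P i z := by
  have := fun i => reg_iff.1 (hP i)
  refine Reg.of_state (fun x i => resid (P i) x) fun x y h z hx i => ?_
  exact (resid_eq (congrFun h i) z).1 (hx i)

theorem Reg.exists {ι : Type*} [Finite ι] {P : ι → List α → Prop} (hP : ∀ i, Reg (P i)) :
    Reg fun z => ∃ i, P i z :=
  (Reg.forall fun i => (hP i).not).not.congr fun z => by push Not; rfl

theorem Reg.flatMap {P : List β → Prop} (hP : Reg P) (h : α → List β) :
    Reg fun z => P (z.flatMap h) := by
  have := reg_iff.1 hP
  refine Reg.of_state (fun x => resid P (x.flatMap h)) fun x y e z => ?_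
  rw [List.flatMap_append, List.flatMap_append, resid_eq e]
  exact id

theorem Reg.comap {P : List β → Prop} (hP : Reg P) (h : α → β) : Reg fun z => P (z.map h) := by
  have := reg_iff.1 hP
  refine Reg.of_state (fun x => resid P (x.map h)) fun x y e z => ?_
  rw [List.map_append, List.map_append, resid_eq e]
  exact id

theorem Reg.filter {P : List α → Prop} (hP : Reg P) (p : α → Bool) :
    Reg fun z => P (z.filter p) := by
  have := reg_iff.1 hP
  refine Reg.of_state (fun x => resid P (x.filter p)) fun x y e z => ?_
  rw [List.filter_append, List.filter_append, resid_eq e]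
  exact id

theorem Reg.right_quotient {P : List α → Prop} (hP : Reg P) (w : List α) :
    Reg fun z => P (z ++ w) := by
  have := reg_iff.1 hP
  refine Reg.of_state (resid P) fun x y e z => ?_
  rw [List.append_assoc, List.append_assoc, resid_eq e]
  exact id

theorem Reg.left_quotient {P : List α → Prop} (hP : Reg P) (w : List α) :
    Reg fun z => P (w ++ z) := by
  have := reg_iff.1 hP
  refine Reg.of_state (fun x => resid P (w ++ x)) fun x y e z => ?_
  rw [← List.append_assoc, ← List.append_assoc, resid_eq e]
  exact id

/-- The powerset construction: the state of a string is the set of residuals of all its preimages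
under `h`. -/
theorem Reg.map {P : List α → Prop} (hP : Reg P) (h : α → β) :
    Reg fun z => ∃ y, P y ∧ y.map h = z := by
  have := reg_iff.1 hP
  refine Reg.of_state (fun x => {r | ∃ y, resid P y = r ∧ y.map h = x}) fun x x' e z => ?_
  rintro ⟨y, hy, hyz⟩
  obtain ⟨y₁, y₂, rfl, rfl, rfl⟩ := List.map_eq_append_iff.1 hyz
  have h1 : resid P y₁ ∈ {r | ∃ y, resid P y = r ∧ y.map h = y₁.map h} := ⟨y₁, rfl, rfl⟩
  rw [e] at h1
  obtain ⟨y', hr, rfl⟩ := h1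
  exact ⟨y' ++ y₂, (resid_eq hr y₂).2 hy, by simp⟩

/-- The end of the first factor is guessed: the state keeps the residual for `P` and the residuals
for `Q` that arise from all splittings in which the first factor has already been read. -/
theorem Reg.append {P Q : List α → Prop} (hP : Reg P) (hQ : Reg Q) :
    Reg fun z => ∃ x y, P x ∧ Q y ∧ x ++ y = z := by
  have := reg_iff.1 hP
  have := reg_iff.1 hQ
  refine Reg.of_state (fun x => (resid P x,
    {r | ∃ x₁ x₂, P x₁ ∧ resid Q x₂ = r ∧ x₁ ++ x₂ = x})) fun x x' e z => ?_
  obtain ⟨e₁, e₂⟩ := Prod.ext_iff.1 e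
  dsimp only at e₁ e₂
  rintro ⟨y, y', hy, hy', h⟩
  rcases List.append_eq_append_iff.1 h with ⟨t, rfl, rfl⟩ | ⟨t, rfl, rfl⟩
  · have h1 : resid Q t ∈ {r | ∃ x₁ x₂, P x₁ ∧ resid Q x₂ = r ∧ x₁ ++ x₂ = y ++ t} :=
      ⟨y, t, hy, rfl, rfl⟩
    rw [e₂] at h1
    obtain ⟨x₁, x₂, hx₁, hr, rfl⟩ := h1
    exact ⟨x₁, x₂ ++ z, hx₁, (resid_eq hr z).2 hy', by simp⟩
  · exact ⟨x' ++ t, y', (resid_eq e₁ t).1 hy, hy', by simp⟩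

theorem reg_const (p : Prop) : Reg fun _ : List α => p :=
  Reg.of_state (fun _ => ()) fun _ _ _ _ => id

/-- A finite family of predicates that is closed under left quotients by letters consists of
regular predicates. -/
theorem Reg.of_family {ι : Type*} [Finite ι] (F : ι → List α → Prop)
    (h : ∀ i a, ∃ j, ∀ z, F i (a :: z) ↔ F j z) (i : ι) : Reg (F i) := by
  choose d hd using h
  have key : ∀ x i z, F i (x ++ z) ↔ F (x.foldl d i) z := by
    intro x
    induction x with
    | nil => intro i z; rfl
    | cons a x ih => intro i z; rw [List.cons_append, hd, ih]; rfl
  refine Reg.of_state (fun x => x.foldl d i) fun x y e z => ?_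
  rw [key, key]
  rw [e]
  exact id

theorem reg_eq (w : List α) : Reg fun z => z = w := by
  have : Finite {v // v ∈ w.inits} := List.finite_toSet w.inits
  classical
  refine Reg.of_state (fun x => if h : x ∈ w.inits then some (⟨x, h⟩ : {v // v ∈ w.inits}) else none)
    fun x y e z hz => ?_
  have hx : x ∈ w.inits := by rw [List.mem_inits]; exact ⟨z, hz⟩
  rw [dif_pos hx] at e
  split_ifs at e with hy
  · have : x = y := Subtype.ext_iff.1 (Option.some.inj e)
    rw [← hz, this]

theorem reg_mem_list (p : α → Prop) : Reg fun z => ∀ a ∈ z, p a := by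
  refine Reg.of_state (fun x => ∀ a ∈ x, p a) fun x y e z => ?_
  exact fun h => List.forall_mem_append.2
    ⟨(iff_of_eq e).1 (List.forall_mem_append.1 h).1, (List.forall_mem_append.1 h).2⟩

theorem reg_isChain [Finite α] (r : α → α → Prop) : Reg (List.IsChain r) := by
  refine Reg.of_state (fun x => (x.IsChain r, x.getLast?)) fun x y e z => ?_
  obtain ⟨e₁, e₂⟩ := Prod.ext_iff.1 e
  dsimp only at e₁ e₂
  rw [List.isChain_append, List.isChain_append, e₁, e₂]
  exact id

theorem reg_head? [Finite α] (p : Option α → Prop) : Reg fun z : List α => p z.head? := by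
  refine Reg.of_state (fun x => x.head?) fun x y e z => ?_
  rw [List.head?_append, List.head?_append, e]
  exact id

theorem reg_getLast? [Finite α] (p : Option α → Prop) : Reg fun z : List α => p z.getLast? := by
  refine Reg.of_state (fun x => x.getLast?) fun x y e z => ?_
  rw [List.getLast?_append, List.getLast?_append, e]
  exact id

end Regular

/-! ### Recognizable relations -/

section Convolution

variable {α β : Type*} {k : ℕ}

/-- The convolution of a tuple of strings, padded to the length `N`. -/
def padConv (N : ℕ) (w : Fin k → List α) : List (Fin k → Option α) :=
  (List.range N).map fun j i => (w i)[j]?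

theorem padConv_map_track {N : ℕ} {w : Fin k → List α} {i : Fin k} (h : (w i).length ≤ N) :
    (padConv N w).map (fun l => l i) =
      (w i).map some ++ List.replicate (N - (w i).length) none := by
  refine List.ext_getElem? fun j => ?_
  simp only [padConv, List.map_map, List.getElem?_map, List.getElem?_append,
    List.getElem?_replicate, List.length_map]
  by_cases hj : j < N
  · rw [List.getElem?_range hj]
    by_cases h' : j < (w i).length
    · simp [h']
    · simp [h']; omega
  · rw [List.getElem?_eq_none (by simpa using hj)]
    rw [if_neg (by omega), if_neg (by omega)]; rfl

theorem length_le_sup (w : Fin k → List α) (i : Fin k) :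
    (w i).length ≤ Finset.univ.sup fun i => (w i).length :=
  Finset.le_sup (f := fun i => (w i).length) (Finset.mem_univ i)

theorem convolution_map_track (w : Fin k → List α) (i : Fin k) :
    (convolution w).map (fun l => l i) =
      (w i).map some ++ List.replicate ((convolution w).length - (w i).length) none := by
  have := padConv_map_track (length_le_sup w i)
  simpa [convolution, padConv] using this

theorem length_padConv (N : ℕ) (w : Fin k → List α) : (padConv N w).length = N := by
  simp [padConv]

theorem convolution_eq_padConv (w : Fin k → List α) :
    convolution w = padConv (Finset.univ.sup fun i => (w i).length) w := rfl

theorem convolution_injective :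
    Function.Injective (convolution : (Fin k → List α) → List (Fin k → Option α)) := by
  intro w w' h
  funext i
  have h1 := convolution_map_track w i
  rw [h, convolution_map_track w' i] at h1
  have := congrArg (List.filterMap id) h1
  simpa using this.symm

theorem padConv_eq_nil {N : ℕ} {w : Fin k → List α} :
    padConv N w = [] ↔ N = 0 := by
  rw [← List.length_eq_zero_iff, length_padConv]

/-- Removing the columns that consist of padding symbols only turns a padded convolution into the
convolution. -/
theorem filter_padConv {N : ℕ} {w : Fin k → List α} (h : ∀ i, (w i).length ≤ N) :
    (padConv N w).filter (fun l => decide (∃ i, (l i).isSome = true)) = convolution w := by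
  have hs : (Finset.univ.sup fun i => (w i).length) ≤ N := Finset.sup_le fun i _ => h i
  obtain ⟨m, rfl⟩ := Nat.exists_eq_add_of_le hs
  rw [convolution_eq_padConv]
  unfold padConv
  rw [List.range_add, List.map_append, List.filter_append]
  rw [List.filter_eq_self.2, List.filter_eq_nil_iff.2, List.append_nil]
  · intro l hl
    simp only [List.map_map, List.mem_map, List.mem_range, Function.comp] at hl
    obtain ⟨j, -, rfl⟩ := hl
    simp only [decide_eq_true_eq, not_exists]
    intro i
    rw [List.getElem?_eq_none (by have := length_le_sup w i; omega)]
    simp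
  · intro l hl
    simp only [List.mem_map, List.mem_range] at hl
    obtain ⟨j, hj, rfl⟩ := hl
    rw [Finset.lt_sup_iff] at hj
    obtain ⟨i, -, hi⟩ := hj
    simp only [decide_eq_true_eq]
    exact ⟨i, by simpa using hi⟩

/-- A string of columns is a convolution iff it contains no column that consists of padding
symbols only, and each track is padded at the end only. -/
theorem exists_convolution_iff (z : List (Fin k → Option α)) :
    (∃ w, convolution w = z) ↔
      (∀ l ∈ z, ∃ i, (l i).isSome) ∧ z.IsChain fun l l' => ∀ i, l i = none → l' i = none := by
  constructor
  · rintro ⟨w, rfl⟩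
    constructor
    · intro l hl
      rw [← filter_padConv (fun i => length_le_sup w i)] at hl
      simpa using (List.mem_filter.1 hl).2
    · rw [convolution_eq_padConv, padConv, List.isChain_iff_getElem]
      intro j hj i h
      simp only [List.getElem_map, List.getElem_range] at h ⊢
      rw [List.getElem?_eq_none_iff] at h ⊢
      omega
  · rintro ⟨h1, h2⟩
    induction z with
    | nil =>
      refine ⟨fun _ => [], ?_⟩
      rw [convolution_eq_padConv, padConv_eq_nil]
      exact Nat.le_zero.1 (Finset.sup_le fun _ _ => le_rfl)
    | cons l z ih =>
      obtain ⟨w, hw⟩ := ih (fun l hl => h1 l (List.mem_cons_of_mem _ hl)) h2.tail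
      -- A track that is padded in the first column is padded in all later ones, so its string is
      -- empty and prepending nothing to it is correct.
      have hnil : ∀ i, l i = none → w i = [] := by
        intro i hi
        rw [← List.length_eq_zero_iff]
        by_contra hne
        cases z with
        | nil =>
          rw [convolution_eq_padConv, padConv_eq_nil] at hw
          have := length_le_sup w i
          omega
        | cons l' z =>
          have := (List.isChain_cons_cons.1 h2).1 i hi
          have h3 := convolution_map_track w i
          rw [hw] at h3
          cases hwi : w i with
          | nil => simp [hwi] at hne
          | cons a t => rw [hwi] at h3; simp [this] at h3
      refine ⟨fun i => (l i).toList ++ w i, ?_⟩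
      have hlen : ∀ i, ((l i).toList ++ w i).length ≤ (convolution w).length + 1 := by
        intro i
        have := length_le_sup w i
        rw [convolution_eq_padConv, length_padConv, List.length_append]
        have : (l i).toList.length ≤ 1 := by cases l i <;> simp
        omega
      rw [← filter_padConv hlen]
      have : padConv ((convolution w).length + 1) (fun i => (l i).toList ++ w i) = l :: z := by
        rw [← hw, convolution_eq_padConv, length_padConv]
        unfold padConv
        rw [List.range_succ_eq_map, List.map_cons, List.map_map]
        congr 1
        · funext i
          cases h : l i with
          | none => simp [h, hnil i h]
          | some a => simp [h]
        · refine List.map_congr_left fun j _ => ?_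
          funext i
          cases h : l i with
          | none => simp [h, hnil i h]
          | some a => simp [h]
      rw [this, List.filter_eq_self]
      intro l hl
      simpa using h1 l hl

theorem reg_convolution [Finite α] :
    Reg fun z : List (Fin k → Option α) => ∃ w, convolution w = z :=
  ((reg_mem_list _).and (reg_isChain _)).congr exists_convolution_iff

theorem faRecognizable_iff {R : Set (Fin k → List α)} :
    FARecognizable R ↔ Reg fun z => ∃ w ∈ R, convolution w = z := Iff.rfl

/-- Since the convolutions themselves form a regular language, `K` only has to give the right answer
on convolutions. -/
theorem FARecognizable.of_reg [Finite α] {R : Set (Fin k → List α)}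
    {K : List (Fin k → Option α) → Prop} (hK : Reg K) (h : ∀ w, K (convolution w) ↔ w ∈ R) :
    FARecognizable R := by
  rw [faRecognizable_iff]
  refine (hK.and reg_convolution).congr fun z => ?_
  constructor
  · rintro ⟨w, hw, rfl⟩
    exact ⟨(h w).2 hw, w, rfl⟩
  · rintro ⟨hz, w, rfl⟩
    exact ⟨w, (h w).1 hz, rfl⟩

/-- Deleting the blank columns first makes the predicate insensitive to the amount of padding, so
that tracks can be exchanged or shifted without keeping track of the length. -/
theorem FARecognizable.exists_reg {R : Set (Fin k → List α)} (hR : FARecognizable R) :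
    ∃ K : List (Fin k → Option α) → Prop, Reg K ∧
      ∀ N w, (∀ i, (w i).length ≤ N) → (K (padConv N w) ↔ w ∈ R) := by
  rw [faRecognizable_iff] at hR
  refine ⟨_, hR.filter fun l => decide (∃ i, (l i).isSome = true), fun N w h => ?_⟩
  rw [filter_padConv h]
  constructor
  · rintro ⟨w', hw', he⟩
    rwa [← convolution_injective he]
  · exact fun hw => ⟨w, hw, rfl⟩

end Convolution

section BinaryRelations

variable {α β : Type*}

/-- A binary relation on strings is recognizable. -/
def FA (R : List α → List α → Prop) : Prop :=
  FARecognizable {w : Fin 2 → List α | R (w 0) (w 1)}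

theorem FA.congr {R S : List α → List α → Prop} (hR : FA R) (h : ∀ x y, S x y ↔ R x y) : FA S := by
  have : S = R := funext fun x => funext fun y => propext (h x y)
  rwa [this]

theorem fa_iff {R : List α → List α → Prop} :
    FA R ↔ Reg fun z => ∃ x y, R x y ∧ convolution ![x, y] = z := by
  refine ⟨fun h => (faRecognizable_iff.1 h).congr fun z => ?_,
    fun h => faRecognizable_iff.2 (h.congr fun z => ?_)⟩
  · constructor
    · rintro ⟨x, y, h, rfl⟩; exact ⟨![x, y], h, rfl⟩
    · rintro ⟨w, h, rfl⟩
      refine ⟨w 0, w 1, h, congrArg _ ?_⟩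
      funext i; fin_cases i <;> rfl
  · constructor
    · rintro ⟨w, h, rfl⟩
      refine ⟨w 0, w 1, h, congrArg _ ?_⟩
      funext i; fin_cases i <;> rfl
    · rintro ⟨x, y, h, rfl⟩; exact ⟨![x, y], h, rfl⟩

theorem FA.of_reg [Finite α] {R : List α → List α → Prop} {K : List (Fin 2 → Option α) → Prop}
    (hK : Reg K) (h : ∀ x y, K (convolution ![x, y]) ↔ R x y) : FA R := by
  refine FARecognizable.of_reg hK fun w => ?_
  have : w = ![w 0, w 1] := by funext i; fin_cases i <;> rfl
  rw [this]
  exact h _ _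

theorem FA.exists_reg {R : List α → List α → Prop} (hR : FA R) :
    ∃ K : List (Fin 2 → Option α) → Prop, Reg K ∧
      ∀ N x y, x.length ≤ N → y.length ≤ N → (K (padConv N ![x, y]) ↔ R x y) := by
  obtain ⟨K, hK, h⟩ := FARecognizable.exists_reg hR
  refine ⟨K, hK, fun N x y hx hy => h N ![x, y] fun i => ?_⟩
  fin_cases i
  · exact hx
  · exact hy

theorem length_convolution_pair (x y : List α) :
    (convolution ![x, y]).length = max x.length y.length := by
  rw [convolution_eq_padConv, length_padConv]
  simp [Fin.univ_succ]

theorem convolution_pair (x y : List α) :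
    convolution ![x, y] = padConv (max x.length y.length) ![x, y] := by
  rw [← length_convolution_pair, convolution_eq_padConv, length_padConv]

theorem FA.exists_reg' {R : List α → List α → Prop} (hR : FA R) :
    ∃ K : List (Fin 2 → Option α) → Prop, Reg K ∧ ∀ x y, K (convolution ![x, y]) ↔ R x y := by
  obtain ⟨K, hK, h⟩ := hR.exists_reg
  refine ⟨K, hK, fun x y => ?_⟩
  rw [convolution_pair]
  exact h _ _ _ (le_max_left _ _) (le_max_right _ _)

theorem FA.and [Finite α] {R S : List α → List α → Prop} (hR : FA R) (hS : FA S) :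
    FA fun x y => R x y ∧ S x y := by
  obtain ⟨K, hK, h⟩ := hR.exists_reg'
  obtain ⟨K', hK', h'⟩ := hS.exists_reg'
  exact FA.of_reg (hK.and hK') fun x y => by rw [h, h']

theorem FA.or [Finite α] {R S : List α → List α → Prop} (hR : FA R) (hS : FA S) :
    FA fun x y => R x y ∨ S x y := by
  obtain ⟨K, hK, h⟩ := hR.exists_reg'
  obtain ⟨K', hK', h'⟩ := hS.exists_reg'
  exact FA.of_reg (hK.or hK') fun x y => by rw [h, h']

theorem FA.exists [Finite α] {ι : Type*} [Finite ι] {R : ι → List α → List α → Prop}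
    (hR : ∀ i, FA (R i)) : FA fun x y => ∃ i, R i x y := by
  choose K hK h using fun i => (hR i).exists_reg'
  exact FA.of_reg (Reg.exists hK) fun x y => by simp only [h]

theorem padConv_swap (N : ℕ) (x y : List α) :
    (padConv N ![x, y]).map (fun l => ![l 1, l 0]) = padConv N ![y, x] := by
  unfold padConv
  rw [List.map_map]
  refine List.map_congr_left fun j _ => ?_
  funext i; fin_cases i <;> rfl

theorem FA.swap [Finite α] {R : List α → List α → Prop} (hR : FA R) : FA fun x y => R y x := by
  obtain ⟨K, hK, h⟩ := hR.exists_reg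
  refine FA.of_reg (hK.comap fun l => ![l 1, l 0]) fun x y => ?_
  rw [convolution_pair, padConv_swap]
  exact h _ _ _ (le_max_right _ _) (le_max_left _ _)

theorem convolution_pair_map_fst (x y : List α) :
    (convolution ![x, y]).map (fun l => l 0) =
      x.map some ++ List.replicate ((convolution ![x, y]).length - x.length) none :=
  convolution_map_track ![x, y] 0

theorem convolution_pair_map_snd (x y : List α) :
    (convolution ![x, y]).map (fun l => l 1) =
      y.map some ++ List.replicate ((convolution ![x, y]).length - y.length) none :=
  convolution_map_track ![x, y] 1

theorem reduceOption_map_some_append (x : List α) (n : ℕ) :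
    (x.map some ++ List.replicate n none).reduceOption = x := by
  rw [List.reduceOption_append, List.reduceOption_replicate_none, List.append_nil]
  simp [List.reduceOption]

theorem Reg.reduceOption {P : List α → Prop} (hP : Reg P) :
    Reg fun z : List (Option α) => P z.reduceOption := by
  refine (hP.flatMap Option.toList).congr fun z => ?_
  have : z.reduceOption = z.flatMap Option.toList := by
    induction z with
    | nil => rfl
    | cons o z ih => cases o <;> simp [ih]
  rw [this]

theorem FA.prod [Finite α] {P Q : List α → Prop} (hP : Reg P) (hQ : Reg Q) :
    FA fun x y => P x ∧ Q y := by
  refine FA.of_reg ((hP.reduceOption.comap fun l : Fin 2 → Option α => l 0).and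
    (hQ.reduceOption.comap fun l => l 1)) fun x y => ?_
  rw [convolution_pair_map_fst, convolution_pair_map_snd, reduceOption_map_some_append,
    reduceOption_map_some_append]

theorem fa_length_eq [Finite α] : FA fun x y : List α => x.length = y.length := by
  refine FA.of_reg (reg_mem_list fun l : Fin 2 → Option α => l 0 ≠ none ∧ l 1 ≠ none) fun x y => ?_
  have h0 := convolution_pair_map_fst x y
  have h1 := convolution_pair_map_snd x y
  have : (∀ l ∈ convolution ![x, y], l 0 ≠ none ∧ l 1 ≠ none) ↔
      none ∉ (convolution ![x, y]).map (fun l => l 0) ∧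
      none ∉ (convolution ![x, y]).map (fun l => l 1) := by
    simp only [List.mem_map, not_exists, not_and]
    exact ⟨fun h => ⟨fun l hl => (h l hl).1, fun l hl => (h l hl).2⟩,
      fun h l hl => ⟨h.1 l hl, h.2 l hl⟩⟩
  rw [this, h0, h1, length_convolution_pair]
  simp
  omega

theorem fa_eq [Finite α] : FA fun x y : List α => x = y := by
  refine FA.of_reg (reg_mem_list fun l : Fin 2 → Option α => l 0 = l 1) fun x y => ?_
  have h0 := convolution_pair_map_fst x y
  have h1 := convolution_pair_map_snd x y
  constructor
  · intro h
    rw [List.map_congr_left h, h1] at h0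
    have := congrArg List.reduceOption h0
    rw [reduceOption_map_some_append, reduceOption_map_some_append] at this
    exact this.symm
  · rintro rfl
    rw [← h1] at h0
    exact List.map_inj_left.1 h0

theorem FA.diag [Finite α] {P : List α → Prop} (hP : Reg P) : FA fun x y => x = y ∧ P x :=
  (fa_eq.and (FA.prod hP hP)).congr fun x y => by
    constructor
    · rintro ⟨rfl, h⟩; exact ⟨rfl, h, h⟩
    · rintro ⟨rfl, h, -⟩; exact ⟨rfl, h⟩

theorem padConv_map (h : α → β) (N : ℕ) (x y : List α) :
    (padConv N ![x, y]).map (fun l i => (l i).map h) = padConv N ![x.map h, y.map h] := by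
  unfold padConv
  rw [List.map_map]
  refine List.map_congr_left fun j _ => ?_
  funext i; fin_cases i <;> simp

theorem FA.map {R : List α → List α → Prop} (hR : FA R) (h : α → β) :
    FA fun x y => ∃ x' y', R x' y' ∧ x'.map h = x ∧ y'.map h = y := by
  rw [fa_iff] at hR ⊢
  refine (hR.map fun l i => (l i).map h).congr fun z => ?_
  have key : ∀ x y : List α, (convolution ![x, y]).map (fun l i => (l i).map h) =
      convolution ![x.map h, y.map h] := by
    intro x y
    rw [convolution_pair, convolution_pair, padConv_map, List.length_map, List.length_map]
  constructor
  · rintro ⟨_, _, ⟨x, y, hxy, rfl, rfl⟩, rfl⟩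
    exact ⟨_, ⟨x, y, hxy, rfl⟩, key x y⟩
  · rintro ⟨_, ⟨x, y, hxy, rfl⟩, rfl⟩
    exact ⟨_, _, ⟨x, y, hxy, rfl, rfl⟩, (key x y).symm⟩

theorem fa_singleton (u v : List α) [Finite α] : FA fun x y => x = u ∧ y = v :=
  FA.prod (reg_eq u) (reg_eq v)

/-! #### Products of relations -/

/-- The product `R · S` of two relations. -/
def catRel (R S : List α → List α → Prop) (x y : List α) : Prop :=
  ∃ x₁ y₁ x₂ y₂, R x₁ y₁ ∧ S x₂ y₂ ∧ x = x₁ ++ x₂ ∧ y = y₁ ++ y₂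

theorem catRel_assoc (R S U : List α → List α → Prop) :
    catRel (catRel R S) U = catRel R (catRel S U) := by
  funext x y
  refine propext ⟨?_, ?_⟩
  · rintro ⟨_, _, x₃, y₃, ⟨x₁, y₁, x₂, y₂, h1, h2, rfl, rfl⟩, h3, rfl, rfl⟩
    exact ⟨x₁, y₁, _, _, h1, ⟨x₂, y₂, x₃, y₃, h2, h3, rfl, rfl⟩, by simp, by simp⟩
  · rintro ⟨x₁, y₁, _, _, h1, ⟨x₂, y₂, x₃, y₃, h2, h3, rfl, rfl⟩, rfl, rfl⟩
    exact ⟨_, _, x₃, y₃, ⟨x₁, y₁, x₂, y₂, h1, h2, rfl, rfl⟩, h3, by simp, by simp⟩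

/-- Products with `R` on the left preserve recognizability. -/
def Synch (R : List α → List α → Prop) : Prop := ∀ S, FA S → FA (catRel R S)

theorem Synch.congr {R S : List α → List α → Prop} (hR : Synch R) (h : ∀ x y, S x y ↔ R x y) :
    Synch S := by
  have : S = R := funext fun x => funext fun y => propext (h x y)
  rwa [this]

theorem Synch.cat {R S : List α → List α → Prop} (hR : Synch R) (hS : Synch S) :
    Synch (catRel R S) := fun U hU => by
  rw [catRel_assoc]
  exact hR _ (hS _ hU)

theorem Synch.fa [Finite α] {R : List α → List α → Prop} (hR : Synch R) : FA R := by
  refine (hR _ (fa_singleton [] [])).congr fun x y => ?_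
  constructor
  · exact fun h => ⟨x, y, [], [], h, ⟨rfl, rfl⟩, by simp, by simp⟩
  · rintro ⟨x, y, _, _, h, ⟨rfl, rfl⟩, rfl, rfl⟩
    simpa using h

theorem Synch.or [Finite α] {R S : List α → List α → Prop} (hR : Synch R) (hS : Synch S) :
    Synch fun x y => R x y ∨ S x y := fun U hU => by
  refine ((hR U hU).or (hS U hU)).congr fun x y => ?_
  constructor
  · rintro ⟨a, b, c, d, h | h, h'⟩
    · exact Or.inl ⟨a, b, c, d, h, h'⟩
    · exact Or.inr ⟨a, b, c, d, h, h'⟩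
  · rintro (⟨a, b, c, d, h, h'⟩ | ⟨a, b, c, d, h, h'⟩)
    · exact ⟨a, b, c, d, Or.inl h, h'⟩
    · exact ⟨a, b, c, d, Or.inr h, h'⟩

theorem Synch.exists [Finite α] {ι : Type*} [Finite ι] {R : ι → List α → List α → Prop}
    (hR : ∀ i, Synch (R i)) : Synch fun x y => ∃ i, R i x y := fun U hU => by
  refine (FA.exists fun i => hR i U hU).congr fun x y => ?_
  constructor
  · rintro ⟨a, b, c, d, ⟨i, h⟩, h'⟩
    exact ⟨i, a, b, c, d, h, h'⟩
  · rintro ⟨i, a, b, c, d, h, h'⟩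
    exact ⟨a, b, c, d, ⟨i, h⟩, h'⟩

theorem catRel_swap (R S : List α → List α → Prop) (x y : List α) :
    catRel (fun x y => R y x) (fun x y => S y x) x y ↔ catRel R S y x := by
  constructor
  · rintro ⟨a, b, c, d, h1, h2, h3, h4⟩; exact ⟨b, a, d, c, h1, h2, h4, h3⟩
  · rintro ⟨a, b, c, d, h1, h2, h3, h4⟩; exact ⟨b, a, d, c, h1, h2, h4, h3⟩

theorem Synch.swap [Finite α] {R : List α → List α → Prop} (hR : Synch R) :
    Synch fun x y => R y x := fun S hS =>
  (hR _ hS.swap).swap.congr (catRel_swap R fun x y => S y x)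

theorem convolution_append {x y : List α} (h : x.length = y.length) (x' y' : List α) :
    convolution ![x ++ x', y ++ y'] = convolution ![x, y] ++ convolution ![x', y'] := by
  rw [convolution_pair, convolution_pair, convolution_pair]
  rw [List.length_append, List.length_append, h, max_self, Nat.add_max_add_left]
  unfold padConv
  rw [List.range_add, List.map_append, List.map_map]
  congr 1
  · refine List.map_congr_left fun j hj => ?_
    rw [List.mem_range] at hj
    funext i; fin_cases i
    · exact List.getElem?_append_left (by omega)
    · exact List.getElem?_append_left (by omega)
  · refine List.map_congr_left fun j hj => ?_
    funext i; fin_cases i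
    · change (x ++ x')[y.length + j]? = x'[j]?
      rw [List.getElem?_append_right (by omega), h, Nat.add_sub_cancel_left]
    · change (y ++ y')[y.length + j]? = y'[j]?
      rw [List.getElem?_append_right (by omega), Nat.add_sub_cancel_left]

/-- A recognizable relation that preserves the length. -/
theorem FA.synch_of_length_eq {R : List α → List α → Prop} (hR : FA R)
    (h : ∀ x y, R x y → x.length = y.length) : Synch R := fun S hS => by
  rw [fa_iff] at hR hS ⊢
  refine (hR.append hS).congr fun z => ?_
  constructor
  · rintro ⟨_, _, ⟨x, y, x', y', h1, h2, rfl, rfl⟩, rfl⟩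
    exact ⟨_, _, ⟨x, y, h1, rfl⟩, ⟨x', y', h2, rfl⟩, (convolution_append (h _ _ h1) x' y').symm⟩
  · rintro ⟨_, _, ⟨x, y, h1, rfl⟩, ⟨x', y', h2, rfl⟩, rfl⟩
    exact ⟨_, _, ⟨x, y, x', y', h1, h2, rfl, rfl⟩, convolution_append (h _ _ h1) x' y'⟩

theorem Synch.diag [Finite α] {P : List α → Prop} (hP : Reg P) : Synch fun x y => x = y ∧ P x :=
  (FA.diag hP).synch_of_length_eq fun _ _ h => by rw [h.1]

/-- Shift the first track by one column to the left. -/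
def shift : List (Fin 2 → Option α) → List (Fin 2 → Option α)
  | [] => []
  | [l] => [![none, l 1]]
  | l :: l' :: z => ![l' 0, l 1] :: shift (l' :: z)

/-- The columns of the shifted string that do not depend on the columns that follow. -/
def shiftInit : List (Fin 2 → Option α) → List (Fin 2 → Option α)
  | [] => []
  | [_] => []
  | l :: l' :: z => ![l' 0, l 1] :: shiftInit (l' :: z)

theorem shift_append (x : List (Fin 2 → Option α)) (l : Fin 2 → Option α)
    (z : List (Fin 2 → Option α)) :
    shift (x ++ l :: z) = shiftInit (x ++ [l]) ++ shift (l :: z) := by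
  induction x with
  | nil => rfl
  | cons a x ih =>
    cases x with
    | nil => rfl
    | cons b x =>
      simp only [List.cons_append, shift, shiftInit] at ih ⊢
      rw [ih]

/-- The shift looks ahead by one column. The state is therefore the residual of the columns already
determined, together with the last column read. -/
theorem Reg.shift [Finite α] {K : List (Fin 2 → Option α) → Prop} (hK : Reg K) :
    Reg fun z => K (shift z) := by
  have := reg_iff.1 hK
  refine Reg.of_state (fun x => (resid K (shiftInit x), x.getLast?)) fun x y e z => ?_
  obtain ⟨e₁, e₂⟩ := Prod.ext_iff.1 e
  dsimp only at e₁ e₂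
  rcases List.eq_nil_or_concat x with rfl | ⟨x, l, rfl⟩
  · have : y = [] := by simpa using e₂.symm
    rw [this]; exact id
  · rcases List.eq_nil_or_concat y with rfl | ⟨y, l', rfl⟩
    · simp at e₂
    · have : l = l' := by simpa using e₂
      subst this
      simp only [List.concat_eq_append, List.append_assoc, List.singleton_append] at e₁ ⊢
      rw [shift_append, shift_append, resid_eq e₁]
      exact id

theorem shift_map_range' (g : ℕ → Fin 2 → Option α) (n s : ℕ) (h : g (s + n) 0 = none) :
    shift ((List.range' s n).map g) = (List.range' s n).map fun j => ![g (j + 1) 0, g j 1] := by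
  induction n generalizing s with
  | zero => rfl
  | succ n ih =>
    cases n with
    | zero => simp [shift, ← h]
    | succ n =>
      have := ih (s + 1) (by rw [← h, show s + 1 + (n + 1) = s + (n + 1 + 1) by omega])
      simp only [List.range'_succ, List.map_cons, shift] at this ⊢
      rw [this]

/-- Removing the first letter of `x` moves the first track by one column, which an automaton can
undo with `Reg.shift`. This is the source of all products of relations that do not preserve the
length. -/
theorem synch_singleton_left [Finite α] (a : α) : Synch fun x y => x = [a] ∧ y = [] := fun S hS => by
  obtain ⟨K, hK, h⟩ := hS.exists_reg
  refine FA.of_reg (hK.shift.and (reg_head? fun o => ∃ l, o = some l ∧ l 0 = some a))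
    fun x y => ?_
  rw [convolution_pair]
  cases x with
  | nil =>
    constructor
    · rintro ⟨-, l, h1, h2⟩
      cases y <;> simp [padConv, List.range_succ_eq_map] at h1
      subst h1
      simp at h2
    · rintro ⟨_, _, _, _, ⟨rfl, -⟩, -, h, -⟩
      simp at h
  | cons b x =>
    have h1 : shift (padConv (max (b :: x).length y.length) ![b :: x, y]) =
        padConv (max (b :: x).length y.length) ![x, y] := by
      unfold padConv
      rw [List.range_eq_range', shift_map_range']
      · refine List.map_congr_left fun j _ => ?_
        funext i; fin_cases i
        · simp
        · simp
      · simp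
    have h2 : (∃ l, (padConv (max (b :: x).length y.length) ![b :: x, y]).head? = some l ∧
        l 0 = some a) ↔ b = a := by
      have : ∃ n, max (b :: x).length y.length = n + 1 := by
        refine Nat.exists_eq_add_one.2 ?_
        simp
      obtain ⟨n, hn⟩ := this
      rw [hn]
      simp [padConv, List.range_succ_eq_map]
    rw [h1, h2, h _ _ _ (by simp) (le_max_right _ _)]
    constructor
    · rintro ⟨h, rfl⟩
      exact ⟨[b], [], x, y, ⟨rfl, rfl⟩, h, rfl, rfl⟩
    · rintro ⟨_, _, x', y', ⟨rfl, rfl⟩, h, h3, rfl⟩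
      simp at h3
      rw [h3.2, h3.1]
      exact ⟨h, rfl⟩

theorem synch_nil [Finite α] : Synch fun x y : List α => x = [] ∧ y = [] :=
  (fa_singleton [] []).synch_of_length_eq fun _ _ h => by rw [h.1, h.2]

theorem synch_left [Finite α] (u : List α) : Synch fun x y => x = u ∧ y = [] := by
  induction u with
  | nil => exact synch_nil
  | cons a u ih =>
    refine ((synch_singleton_left a).cat ih).congr fun x y => ?_
    constructor
    · rintro ⟨rfl, rfl⟩
      exact ⟨[a], [], u, [], ⟨rfl, rfl⟩, ⟨rfl, rfl⟩, rfl, rfl⟩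
    · rintro ⟨_, _, _, _, ⟨rfl, rfl⟩, ⟨rfl, rfl⟩, rfl, rfl⟩
      exact ⟨rfl, rfl⟩

/-- The pair `(u, v)` is the product of `(u, [])` and `([], v)`, and each of these is built letter
by letter. -/
theorem synch_singleton [Finite α] (u v : List α) : Synch fun x y => x = u ∧ y = v := by
  refine ((synch_left u).cat (synch_left v).swap).congr fun x y => ?_
  constructor
  · rintro ⟨rfl, rfl⟩
    exact ⟨x, [], [], y, ⟨rfl, rfl⟩, ⟨rfl, rfl⟩, by simp, by simp⟩
  · rintro ⟨_, _, _, _, ⟨rfl, rfl⟩, ⟨rfl, rfl⟩, rfl, rfl⟩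
    simp

/-- If `R` is recognizable, then so is the relation `{(x, y) | |x| = |y|, R (x a) y}`. -/
theorem FA.right_quotient [Finite α] {R : List α → List α → Prop} (hR : FA R) (a : α) :
    FA fun x y => x.length = y.length ∧ R (x ++ [a]) y := by
  obtain ⟨K, hK, h⟩ := hR.exists_reg'
  obtain ⟨K', hK', h'⟩ := (fa_length_eq (α := α)).exists_reg'
  refine FA.of_reg (hK'.and (hK.right_quotient (convolution ![[a], []]))) fun x y => ?_
  rw [h']
  refine and_congr_right fun hl => ?_
  rw [← convolution_append hl, h, List.append_nil]

/-- A recognizable relation that changes the length by at most one. -/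
theorem FA.synch [Finite α] {R : List α → List α → Prop} (hR : FA R)
    (h : ∀ x y, R x y → x.length ≤ y.length + 1 ∧ y.length ≤ x.length + 1) : Synch R := by
  have h0 : Synch fun x y => R x y ∧ x.length = y.length :=
    (hR.and fa_length_eq).synch_of_length_eq fun _ _ h => h.2
  -- The pairs with `|x| = |y| + 1` are sorted by the last letter `a` of `x`: each class is a
  -- relation preserving the length, multiplied by the single pair `([a], [])`. The pairs with `|y|
  -- = |x| + 1` are treated by exchanging the tracks.
  have h1 : ∀ {R : List α → List α → Prop}, FA R → ∀ a,
      Synch (catRel (fun x y => x.length = y.length ∧ R (x ++ [a]) y)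
        (fun x y => x = [a] ∧ y = [])) := fun hR a =>
    ((hR.right_quotient a).synch_of_length_eq fun _ _ h => h.1).cat (synch_left [a])
  have h2 := Synch.exists fun a => h1 hR a
  have h3 := (Synch.exists fun a => h1 hR.swap a).swap
  have key : ∀ (R : List α → List α → Prop) x y, (∃ a, catRel
      (fun x y => x.length = y.length ∧ R (x ++ [a]) y) (fun x y => x = [a] ∧ y = []) x y) ↔
      R x y ∧ x.length = y.length + 1 := by
    intro R x y
    constructor
    · rintro ⟨a, x, y, _, _, ⟨hl, h⟩, ⟨rfl, rfl⟩, rfl, rfl⟩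
      simpa [hl] using h
    · rintro ⟨h, hl⟩
      rcases List.eq_nil_or_concat x with rfl | ⟨x, a, rfl⟩
      · simp at hl
      · rw [List.concat_eq_append] at h hl ⊢
        exact ⟨a, x, y, [a], [], ⟨by simpa using hl, h⟩, ⟨rfl, rfl⟩, rfl, by simp⟩
  refine ((h0.or h2).or h3).congr fun x y => ?_
  rw [key R, key fun x y => R y x]
  constructor
  · intro hxy
    have := h x y hxy
    by_cases h4 : x.length = y.length
    · exact Or.inl (Or.inl ⟨hxy, h4⟩)
    · by_cases h5 : x.length = y.length + 1
      · exact Or.inl (Or.inr ⟨hxy, h5⟩)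
      · exact Or.inr ⟨hxy, by omega⟩
  · rintro ((h | h) | h) <;> exact h.1

end BinaryRelations

/-! ### Positional number systems -/

section Digits

variable {A B : Type*}

/-- The value of a string of digits, least significant digit first. -/
def digVal (b : ℤ) (dig : A → ℤ) : List A → ℤ
  | [] => 0
  | a :: z => dig a + b * digVal b dig z

theorem digVal_map (b : ℤ) (dig : B → ℤ) (h : A → B) (z : List A) :
    digVal b dig (z.map h) = digVal b (dig ∘ h) z := by
  induction z with
  | nil => rfl
  | cons a z ih => simp [digVal, ih]

theorem digVal_append_replicate (b : ℤ) (dig : A → ℤ) (a : A) (ha : dig a = 0) (z : List A)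
    (n : ℕ) : digVal b dig (z ++ List.replicate n a) = digVal b dig z := by
  induction z with
  | nil =>
    induction n with
    | zero => rfl
    | succ n ih => simp [List.replicate_succ, digVal, ha] at ih ⊢; right; exact ih
  | cons c z ih => simp [digVal, ih]

theorem digVal_linear (b : ℤ) (dig dig' : A → ℤ) (m m' : ℤ) (z : List A) :
    digVal b (fun a => m * dig a + m' * dig' a) z =
      m * digVal b dig z + m' * digVal b dig' z := by
  induction z with
  | nil => simp [digVal]
  | cons a z ih => simp only [digVal, ih]; ring

/-- Solutions of a linear equation: `digVal` takes a given value. -/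
theorem reg_digVal_eq [Finite A] (b : ℕ) (hb : 2 ≤ b) (dig : A → ℤ) (c : ℤ) :
    Reg fun z => digVal b dig z = c := by
  obtain ⟨D, hD⟩ : ∃ D : ℕ, ∀ a, (dig a).natAbs ≤ D := by
    obtain ⟨D, hD⟩ := (Set.finite_range fun a => (dig a).natAbs).bddAbove
    exact ⟨D, fun a => hD ⟨a, rfl⟩⟩
  -- Reading the digit `a` replaces the target `x` by `(x - dig a) / b`, or by failure if this is
  -- not an integer. If `|x|` and `|dig a|` are at most `C`, then so is the quotient, because `b ≥
  -- 2`; hence only finitely many targets occur.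
  let C := max D c.natAbs
  have hfin : Finite {x : ℤ // x.natAbs ≤ C} := by
    have : {x : ℤ | x.natAbs ≤ C} ⊆ Set.Icc (-(C : ℤ)) C := fun x hx => by
      simp only [Set.mem_ofPred_eq, Set.mem_Icc] at hx ⊢; omega
    exact ((Set.finite_Icc _ _).subset this).to_subtype
  refine (Reg.of_family (ι := Option {x : ℤ // x.natAbs ≤ C})
    (fun o z => ∃ x, o = some x ∧ digVal b dig z = x.1) ?_
    (some ⟨c, le_max_right _ _⟩)).congr (by simp)
  intro o a
  rcases o with _ | ⟨x, hx⟩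
  · exact ⟨none, by simp⟩
  by_cases hd : (b : ℤ) ∣ x - dig a
  · obtain ⟨y, hy⟩ := hd
    have hyC : y.natAbs ≤ C := by
      have h1 := congrArg Int.natAbs hy
      rw [Int.natAbs_mul, Int.natAbs_natCast] at h1
      have h2 := Int.natAbs_sub_le x (dig a)
      have h3 := hD a
      have h4 : D ≤ C := le_max_left _ _
      have h5 : 2 * y.natAbs ≤ b * y.natAbs := Nat.mul_le_mul_right _ hb
      omega
    refine ⟨some ⟨y, hyC⟩, fun z => ?_⟩
    have hb0 : (b : ℤ) ≠ 0 := by omega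
    simp only [Option.some.injEq, exists_eq_left', digVal]
    constructor
    · intro h
      have : (b : ℤ) * digVal b dig z = b * y := by rw [← hy]; linarith
      exact mul_left_cancel₀ hb0 this
    · intro h; rw [h, ← hy]; ring
  · refine ⟨none, fun z => ?_⟩
    simp only [Option.some.injEq, exists_eq_left', digVal, reduceCtorEq, false_and, exists_false,
      iff_false]
    intro h
    exact hd ⟨digVal b dig z, by linarith⟩

/-- Solutions of a congruence. -/
theorem reg_digVal_dvd (b : ℕ) (dig : A → ℤ) (n : ℕ) [NeZero n] (c : ℤ) :
    Reg fun z => (n : ℤ) ∣ digVal b dig z - c := by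
  -- The state `(x, y)` stands for the condition that `x + y * v` is `c` modulo `n`, where `v` is
  -- the value of the digits still to be read. A digit adds `y * dig a` to `x` and multiplies `y` by
  -- `b`.
  refine (Reg.of_family (ι := ZMod n × ZMod n)
    (fun o z => o.1 + o.2 * (digVal b dig z : ZMod n) = c) ?_ (0, 1)).congr ?_
  · rintro ⟨x, y⟩ a
    refine ⟨(x + y * (dig a : ZMod n), y * b), fun z => ?_⟩
    simp only [digVal]
    push_cast
    constructor
    · intro h; rw [← h]; ring
    · intro h; rw [← h]; ring
  · intro z
    rw [← ZMod.intCast_zmod_eq_zero_iff_dvd]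
    push_cast
    rw [sub_eq_zero]
    simp

end Digits

/-! ### The orbit of `v₀` -/

section Orbit

theorem mem_V_iff {a b c d : ℕ} : (a, b, c, d) ∈ V ↔
    ((∃ k, c = 2 ^ k) ∧ (d = 0 ∨ d = 1)) ∧ (0 < a → b = 0 → 1 < c) ∧ (a = 0 → c = 1) := Iff.rfl

/-- The iterated exponential `2^(2^(⋯^n))` of height `a`. -/
def expTower : ℕ → ℕ → ℕ
  | 0, n => n
  | a + 1, n => expTower a (2 ^ n)

theorem expTower_succ' (a n : ℕ) : expTower (a + 1) n = 2 ^ expTower a n := by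
  induction a generalizing n with
  | zero => rfl
  | succ a ih => rw [expTower, ih]; rfl

theorem expTower_one (n : ℕ) : expTower n 1 = T n := by
  induction n with
  | zero => rfl
  | succ n ih => rw [expTower_succ', ih]; rfl

/-- Keeps `a` and `b` below the level, so that the truncated differences in `key` really grow when
`a` or `b` decreases. -/
theorem add_le_expTower (a n : ℕ) : a + n ≤ expTower a n := by
  induction a with
  | zero => simp [expTower]
  | succ a ih =>
    rw [expTower_succ']
    have := Nat.lt_two_pow_self (n := expTower a n)
    omega

/-- The number of which `(a, b, c, d)` is an intermediate result. -/
def level : ℕ × ℕ × ℕ × ℕ → ℕ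
  | (a, b, c, _) => expTower a (b + Nat.log 2 c)

/-- A quantity that increases along the orbits of `f`, for the lexicographic order. -/
def key : ℕ × ℕ × ℕ × ℕ → ℕ ×ₗ ℕ ×ₗ ℕ ×ₗ ℕ
  | (a, b, c, d) =>
    if d = 0 then toLex (level (a, b, c, d), toLex (1, toLex (level (a, b, c, d) - a,
      level (a, b, c, d) - b)))
    else toLex (level (a, b, c, d), toLex (0, toLex (a, b)))

/-- Every rule rewrites the same number in another form, except for `b ↦ b + 1` at height `0`, which
adds one to it. -/
theorem level_step_le {v : ℕ × ℕ × ℕ × ℕ} (hv : v ∈ V) : level (step v) ≤ level v + 1 := by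
  obtain ⟨a, b, c, d⟩ := v
  obtain ⟨⟨⟨k, rfl⟩, hd⟩, h2, h3⟩ := mem_V_iff.1 hv
  unfold step
  dsimp only
  split_ifs with h h' h'' h' h''
  · rw [← pow_succ']
    simp only [level, Nat.log_pow one_lt_two]
    rw [show b - 1 + (k + 1) = b + k by omega]
    omega
  · obtain rfl : b = 0 := by omega
    obtain ⟨a, rfl⟩ := Nat.exists_eq_add_one.2 h'
    simp [level, Nat.log_pow one_lt_two, expTower]
  · obtain rfl : a = 0 := by omega
    simp [level, expTower]
  · have hk : k ≠ 0 := by rintro rfl; simp at h'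
    obtain ⟨k, rfl⟩ := Nat.exists_eq_succ_of_ne_zero hk
    rw [Nat.succ_eq_add_one, pow_succ, Nat.mul_div_cancel _ two_pos, ← pow_succ]
    simp only [level, Nat.log_pow one_lt_two]
    rw [show b + 1 + k = b + (k + 1) by omega]
    omega
  · obtain ⟨j, hj, rfl⟩ := h''
    rw [show 2 ^ k = 1 by have := Nat.one_le_two_pow (n := k); omega]
    simp [level, expTower, Nat.log_pow one_lt_two]
  · simp only [level]
    rw [show 2 ^ k = 1 by have := Nat.one_le_two_pow (n := k); omega]
    omega

/-- Within one level the orbit climbs first and descends afterwards; this is the second component of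
`key`. During the climb the height `a` grows or, at equal height, `b` grows. During the descent `a`
falls or, at equal height, `b` falls. The level grows when the descent has ended. -/
theorem key_lt_key_step {v : ℕ × ℕ × ℕ × ℕ} (hv : v ∈ V) : key v < key (step v) := by
  obtain ⟨a, b, c, d⟩ := v
  obtain ⟨⟨⟨k, rfl⟩, hd⟩, h2, h3⟩ := mem_V_iff.1 hv
  have hN := add_le_expTower a (b + Nat.log 2 (2 ^ k))
  unfold step
  dsimp only
  split_ifs with h h' h'' h' h''
  · subst h
    have e : level (a, b - 1, 2 * 2 ^ k, 0) = level (a, b, 2 ^ k, 0) := by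
      rw [← pow_succ']; simp only [level, Nat.log_pow one_lt_two]; congr 1; omega
    simp only [key, if_true, e, Prod.Lex.toLex_lt_toLex, lt_irrefl, false_or, true_and]
    simp only [level] at *
    omega
  · subst h
    obtain rfl : b = 0 := by omega
    have e : level (a - 1, 2 ^ k, 1, 0) = level (a, 0, 2 ^ k, 0) := by
      obtain ⟨a, rfl⟩ := Nat.exists_eq_add_one.2 h'
      simp [level, Nat.log_pow one_lt_two, expTower]
    simp only [key, if_true, e, Prod.Lex.toLex_lt_toLex, lt_irrefl, false_or, true_and]
    simp only [level] at *
    omega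
  · obtain rfl : a = 0 := by omega
    simp [key, Prod.Lex.toLex_lt_toLex, h, h3 rfl, level, expTower]
  · have hk : k ≠ 0 := by rintro rfl; simp at h'
    obtain ⟨k, rfl⟩ := Nat.exists_eq_succ_of_ne_zero hk
    have e : level (a, b + 1, 2 ^ (k + 1) / 2, 1) = level (a, b, 2 ^ (k + 1), d) := by
      rw [pow_succ, Nat.mul_div_cancel _ two_pos, ← pow_succ]
      simp only [level, Nat.log_pow one_lt_two]; congr 1; omega
    simp only [key, if_neg h, Nat.succ_eq_add_one, e, one_ne_zero, if_false,
      Prod.Lex.toLex_lt_toLex, lt_irrefl, false_or, true_and]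
    omega
  · obtain ⟨j, hj, rfl⟩ := h''
    have hk : 2 ^ k = 1 := by have := Nat.one_le_two_pow (n := k); omega
    have e : level (a + 1, 0, 2 ^ j, 1) = level (a, 2 ^ j, 2 ^ k, d) := by
      rw [hk]
      simp [level, Nat.log_pow one_lt_two, expTower]
    simp only [key, if_neg h, e, one_ne_zero, if_false,
      Prod.Lex.toLex_lt_toLex, lt_irrefl, false_or, true_and]
    omega
  · have e : level (a, b, 1, 0) = level (a, b, 2 ^ k, d) := by
      have hk : 2 ^ k = 1 := by have := Nat.one_le_two_pow (n := k); omega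
      rw [hk]; rfl
    simp only [key, if_neg h, e, if_true, Prod.Lex.toLex_lt_toLex, lt_irrefl, false_or, true_and]
    omega

/-- Each predecessor is found by running one of the rules backwards; the shape of the tuple and the
conditions that define `V` decide which one. -/
theorem exists_step_eq {v : ℕ × ℕ × ℕ × ℕ} (hv : v ∈ V) (h0 : v ≠ (0, 0, 1, 1)) :
    ∃ p ∈ V, step p = v := by
  obtain ⟨a, b, c, d⟩ := v
  obtain ⟨⟨⟨k, rfl⟩, hd⟩, h2, h3⟩ := mem_V_iff.1 hv
  rcases hd with rfl | rfl
  · rcases k with _ | k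
    -- If `b` is a power of two greater than `1`, the tower could still have been raised, so the
    -- descent comes from height `a + 1`. Otherwise the tuple is the turning point at which the
    -- climb ends.
    · by_cases hb : ∃ k, 0 < k ∧ b = 2 ^ k
      · obtain ⟨j, hj, rfl⟩ := hb
        have := Nat.one_lt_two_pow (n := j) (by omega)
        refine ⟨(a + 1, 0, 2 ^ j, 0), mem_V_iff.2 ⟨⟨⟨j, rfl⟩, Or.inl rfl⟩, fun _ _ => this,
          by omega⟩, ?_⟩
        simp [step]
      · refine ⟨(a, b, 1, 1), mem_V_iff.2 ⟨⟨⟨0, rfl⟩, Or.inr rfl⟩, h2, h3⟩, ?_⟩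
        simp [step, hb]
    · have ha : 0 < a := by
        by_contra h
        have := h3 (by omega)
        have := Nat.one_lt_two_pow (n := k + 1) (by omega)
        omega
      refine ⟨(a, b + 1, 2 ^ k, 0), mem_V_iff.2 ⟨⟨⟨k, rfl⟩, Or.inl rfl⟩, by omega, by omega⟩, ?_⟩
      simp [step, ha, pow_succ']
  · by_cases ha : a = 0
    · subst ha
      rw [h3 rfl] at h0 ⊢
      have hb : b ≠ 0 := fun hb => h0 (by rw [hb])
      obtain ⟨b, rfl⟩ := Nat.exists_eq_succ_of_ne_zero hb
      exact ⟨(0, b, 1, 0), mem_V_iff.2 ⟨⟨⟨0, rfl⟩, Or.inl rfl⟩, by omega, by omega⟩, by simp [step]⟩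
    · by_cases hb : b = 0
      · subst hb
        have hc := h2 (by omega) rfl
        have hk : 0 < k := by
          rcases k with _ | k
          · simp at hc
          · omega
        obtain ⟨a, rfl⟩ := Nat.exists_eq_succ_of_ne_zero ha
        refine ⟨(a, 2 ^ k, 1, 1), mem_V_iff.2 ⟨⟨⟨0, rfl⟩, Or.inr rfl⟩, by omega, by omega⟩, ?_⟩
        simp [step, hk.ne']
      · obtain ⟨b, rfl⟩ := Nat.exists_eq_succ_of_ne_zero hb
        have := Nat.one_lt_two_pow (n := k + 1) (by omega)
        refine ⟨(a, b, 2 ^ (k + 1), 1), mem_V_iff.2 ⟨⟨⟨k + 1, rfl⟩, Or.inr rfl⟩, fun _ _ => this,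
          fun h => absurd h ha⟩, ?_⟩
        simp only [step, one_ne_zero, if_false, if_pos this]
        rw [pow_succ, Nat.mul_div_cancel _ two_pos]

theorem orbit_injective : Function.Injective fun k => f^[k] v₀ := by
  have : StrictMono fun k => key (f^[k] v₀).1 := by
    refine strictMono_nat_of_lt_succ fun k => ?_
    rw [Function.iterate_succ_apply']
    exact key_lt_key_step (f^[k] v₀).2
  intro k l h
  exact this.injective (congrArg (fun v : V => key v.1) h)

/-- Going back to predecessors lowers `key`. The lexicographic order is well founded, so the descent
stops, and it can only stop at `v₀`. -/
theorem orbit_surjective : Function.Surjective fun k => f^[k] v₀ := by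
  have : ∀ x : ℕ ×ₗ ℕ ×ₗ ℕ ×ₗ ℕ, ∀ v : V, key v.1 = x → ∃ k, f^[k] v₀ = v := by
    intro x
    induction x using WellFoundedLT.induction with
    | ind x ih =>
      rintro v rfl
      by_cases h0 : v.1 = (0, 0, 1, 1)
      · exact ⟨0, Subtype.ext h0.symm⟩
      · obtain ⟨p, hp, he⟩ := exists_step_eq v.2 h0
        obtain ⟨k, hk⟩ := ih (key p) (he ▸ key_lt_key_step hp) ⟨p, hp⟩ rfl
        refine ⟨k + 1, ?_⟩
        rw [Function.iterate_succ_apply', hk]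
        exact Subtype.ext he
  exact fun v => this _ v rfl

theorem level_orbit_le (k : ℕ) : level (f^[k] v₀).1 ≤ k := by
  induction k with
  | zero => simp [level, v₀, expTower]
  | succ k ih =>
    rw [Function.iterate_succ_apply']
    exact (level_step_le (f^[k] v₀).2).trans (by omega)

end Orbit

/-! ### The strings that represent tuples -/

section Encode

theorem length_revBin (n : ℕ) : (revBin n).length = max 1 n.size := by
  unfold revBin
  split_ifs with h
  · simp [h]
  · rw [Nat.size_eq_bits_len]
    exact (max_eq_right (Nat.size_pos.2 (Nat.pos_of_ne_zero h))).symm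

/-- The value of a binary digit, where the padding symbol counts as zero. -/
def bitVal : Option Bool → ℤ
  | some true => 1
  | _ => 0

theorem digVal_bits (n : ℕ) : digVal 2 bitVal ((Nat.bits n).map some) = n := by
  induction n using Nat.binaryRec' with
  | zero => simp [digVal]
  | bit b n h ih =>
    rw [Nat.bits_append_bit n b h, List.map_cons, digVal, ih, Nat.bit_val]
    cases b <;> simp [bitVal] ; ring

theorem digVal_revBin (n : ℕ) : digVal 2 bitVal ((revBin n).map some) = n := by
  unfold revBin
  split_ifs with h
  · simp [h, digVal, bitVal]
  · exact digVal_bits n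

theorem digVal_track {k : ℕ} (w : Fin k → List Bool) (i : Fin k) (n : ℕ) (h : w i = revBin n) :
    digVal 2 (fun l => bitVal (l i)) (convolution w) = n := by
  have := digVal_map 2 bitVal (fun l : Fin k → Option Bool => l i) (convolution w)
  rw [convolution_map_track, digVal_append_replicate 2 bitVal none rfl, h, digVal_revBin] at this
  exact this.symm

/-- The components of a tuple. -/
def comp (v : ℕ × ℕ × ℕ × ℕ) : Fin 4 → ℕ := ![v.1, v.2.1, v.2.2.1, v.2.2.2]

theorem encodeTuple_eq (v : ℕ × ℕ × ℕ × ℕ) :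
    encodeTuple v = convolution fun i => revBin (comp v i) := by
  obtain ⟨a, b, c, d⟩ := v
  refine congrArg convolution (?_ : ![revBin a, revBin b, revBin c, revBin d] = _)
  funext i; fin_cases i <;> rfl

theorem length_encodeTuple_le (v : ℕ × ℕ × ℕ × ℕ) (n : ℕ) :
    (encodeTuple v).length ≤ n ↔ ∀ i, (revBin (comp v i)).length ≤ n := by
  rw [encodeTuple_eq, convolution_eq_padConv, length_padConv, Finset.sup_le_iff]
  simp

theorem digVal_encodeTuple (v : ℕ × ℕ × ℕ × ℕ) (i : Fin 4) :
    digVal 2 (fun l => bitVal (l i)) (encodeTuple v) = comp v i := by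
  rw [encodeTuple_eq]
  exact digVal_track _ i _ rfl

theorem encodeTuple_injective : Function.Injective encodeTuple := by
  intro v w h
  have : ∀ i, comp v i = comp w i := fun i => by
    have := digVal_encodeTuple v i
    rw [h, digVal_encodeTuple] at this
    exact_mod_cast this.symm
  exact Prod.ext (this 0) (Prod.ext (this 1) (Prod.ext (this 2) (this 3)))

theorem u_injective : Function.Injective u := fun _ _ h =>
  orbit_injective (Subtype.ext (encodeTuple_injective h))

/-- As the orbit of `v₀` is all of `V`, the iteration disappears: only membership in `V` has to be
recognized and, for the successor relation, a single application of the rules. -/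
theorem exists_u_eq_iff (z : List Col) : (∃ k, u k = z) ↔ ∃ v ∈ V, encodeTuple v = z := by
  constructor
  · rintro ⟨k, rfl⟩
    exact ⟨_, (f^[k] v₀).2, rfl⟩
  · rintro ⟨v, hv, rfl⟩
    obtain ⟨k, hk⟩ := orbit_surjective ⟨v, hv⟩
    exact ⟨k, by unfold u; exact congrArg encodeTuple (congrArg Subtype.val hk)⟩

theorem u_succ_rel_iff (x y : List Col) : (∃ k, x = u k ∧ y = u (k + 1)) ↔
    ∃ v ∈ V, x = encodeTuple v ∧ y = encodeTuple (step v) := by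
  constructor
  · rintro ⟨k, rfl, rfl⟩
    refine ⟨_, (f^[k] v₀).2, rfl, ?_⟩
    unfold u
    rw [Function.iterate_succ_apply']; rfl
  · rintro ⟨v, hv, rfl, rfl⟩
    obtain ⟨k, hk⟩ := orbit_surjective ⟨v, hv⟩
    dsimp only at hk
    refine ⟨k, ?_, ?_⟩
    · unfold u; rw [hk]
    · unfold u; rw [Function.iterate_succ_apply', hk]; rfl

/-- Short strings represent large numbers. -/
theorem exists_u_short (n : ℕ) (hn : 1 ≤ n) : ∃ k, (u k).length ≤ n ∧ T n ≤ k := by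
  -- The level of `(n, 1, 1, 1)` is `expTower n 1 = T n`, while its longest component is the binary
  -- representation of `n`.
  obtain ⟨k, hk⟩ := orbit_surjective ⟨(n, 1, 1, 1),
    mem_V_iff.2 ⟨⟨⟨0, rfl⟩, Or.inr rfl⟩, by omega, by omega⟩⟩
  dsimp only at hk
  refine ⟨k, ?_, ?_⟩
  · unfold u
    rw [hk, length_encodeTuple_le]
    have h1 : (revBin 1).length = 1 := by rw [length_revBin]; simp
    intro i
    fin_cases i
    · change (revBin n).length ≤ n
      rw [length_revBin]
      exact max_le hn (Nat.size_le.2 n.lt_two_pow_self)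
    · exact h1.le.trans hn
    · exact h1.le.trans hn
    · exact h1.le.trans hn
  · have := level_orbit_le k
    rw [hk] at this
    simpa [level, expTower_one] using this

theorem length_revBin_mono {m n : ℕ} (h : m ≤ n) : (revBin m).length ≤ (revBin n).length := by
  rw [length_revBin, length_revBin]
  have := Nat.size_le_size h
  omega

theorem length_revBin_le_add_one {m n : ℕ} (h : n ≤ 2 * m + 1) :
    (revBin n).length ≤ (revBin m).length + 1 := by
  rw [length_revBin, length_revBin]
  have : n.size ≤ m.size + 1 := by
    rw [Nat.size_le, pow_succ]
    have := m.lt_size_self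
    omega
  omega

end Encode

/-! ### Recognizability of the strings `u k` and of their successor relation -/

section Encode

theorem exists_bits_eq {w : List Bool} (h : w.getLast? = some true) :
    ∃ n, n ≠ 0 ∧ Nat.bits n = w := by
  induction w with
  | nil => simp at h
  | cons b w ih =>
    cases w with
    | nil =>
      obtain rfl : b = true := by simpa using h
      exact ⟨1, one_ne_zero, by simp⟩
    | cons b' w =>
      obtain ⟨n, hn, h'⟩ := ih (by simpa using h)
      refine ⟨Nat.bit b n, by simp [hn], ?_⟩
      rw [Nat.bits_append_bit _ _ fun h => absurd h hn, h']

theorem exists_revBin_iff (w : List Bool) :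
    (∃ n, revBin n = w) ↔ w = [false] ∨ w.getLast? = some true := by
  constructor
  · rintro ⟨n, rfl⟩
    unfold revBin
    split_ifs with h
    · exact Or.inl rfl
    · right
      induction n using Nat.binaryRec' with
      | zero => simp at h
      | bit b n hb ih =>
        rw [Nat.bits_append_bit _ _ hb]
        by_cases hn : n = 0
        · simp [hn, hb hn]
        · rw [List.getLast?_cons, ih hn]; rfl
  · rintro (rfl | h)
    · exact ⟨0, rfl⟩
    · obtain ⟨n, hn, rfl⟩ := exists_bits_eq h
      exact ⟨n, if_neg hn⟩

theorem reg_revBin : Reg fun w => ∃ n, revBin n = w :=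
  ((reg_eq [false]).or (reg_getLast? fun o => o = some true)).congr exists_revBin_iff

theorem exists_encodeTuple_iff (z : List Col) : (∃ v, encodeTuple v = z) ↔
    (∃ w, convolution w = z) ∧ ∀ i, ∃ n, revBin n = (z.map fun l => l i).reduceOption := by
  constructor
  · rintro ⟨v, rfl⟩
    rw [encodeTuple_eq]
    refine ⟨⟨_, rfl⟩, fun i => ⟨comp v i, ?_⟩⟩
    rw [convolution_map_track, reduceOption_map_some_append]
  · rintro ⟨⟨w, rfl⟩, h⟩
    choose n hn using h
    refine ⟨(n 0, n 1, n 2, n 3), ?_⟩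
    rw [encodeTuple_eq]
    congr 1
    funext i
    have := hn i
    rw [convolution_map_track, reduceOption_map_some_append] at this
    rw [← this]
    congr 1
    fin_cases i <;> rfl

theorem reg_encodeTuple : Reg fun z => ∃ v, encodeTuple v = z :=
  (reg_convolution.and (Reg.forall fun i => reg_revBin.reduceOption.comap fun l : Col => l i)).congr
    exists_encodeTuple_iff

theorem bitVal_eq (o : Option Bool) : bitVal o = 0 ∨ bitVal o = 1 := by
  rcases o with _ | _ | _ <;> simp [bitVal]

/-- Three states suffice: the only digit `1` is still to come, it has been read and only zeros may
follow, or the string is rejected. -/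
theorem reg_pow_two {A : Type*} (g : A → Option Bool) :
    Reg fun z => ∃ k : ℕ, digVal 2 (fun a => bitVal (g a)) z = 2 ^ k := by
  refine Reg.of_family (ι := Option Bool) (fun o z =>
    match o with
    | none => False
    | some false => digVal 2 (fun a => bitVal (g a)) z = 0
    | some true => ∃ k : ℕ, digVal 2 (fun a => bitVal (g a)) z = 2 ^ k) ?_ (some true)
  rintro (_ | _ | _) a
  · exact ⟨none, fun z => Iff.rfl⟩
  · rcases bitVal_eq (g a) with h | h
    · exact ⟨some false, fun z => by simp [digVal, h]⟩
    · refine ⟨none, fun z => ?_⟩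
      simp only [digVal, h, iff_false]
      omega
  · rcases bitVal_eq (g a) with h | h
    · refine ⟨some true, fun z => ?_⟩
      simp only [digVal, h, zero_add]
      constructor
      · rintro ⟨_ | k, hk⟩
        · rw [pow_zero] at hk; omega
        · exact ⟨k, by rw [pow_succ'] at hk; omega⟩
      · rintro ⟨k, hk⟩
        exact ⟨k + 1, by rw [hk, pow_succ']⟩
    · refine ⟨some false, fun z => ?_⟩
      simp only [digVal, h]
      constructor
      · rintro ⟨_ | k, hk⟩
        · rw [pow_zero] at hk; omega
        · rw [pow_succ'] at hk; omega
      · intro h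
        exact ⟨0, by rw [h]; rfl⟩

theorem exists_pow_two_cast (n : ℕ) : (∃ k : ℕ, (n : ℤ) = 2 ^ k) ↔ ∃ k, n = 2 ^ k :=
  exists_congr fun k => by exact_mod_cast Iff.rfl

/-- The strings `u k` form a regular language. -/
theorem reg_u : Reg fun z => ∃ k, u k = z := by
  have e := fun i c => reg_digVal_eq 2 le_rfl (fun l : Col => bitVal (l i)) c
  refine (reg_encodeTuple.and (((reg_pow_two fun l : Col => l 2).and ((e 3 0).or (e 3 1))).and
    (((e 0 0).or ((e 1 0).not.or (e 2 1).not)).and ((e 0 0).not.or (e 2 1))))).congr fun z => ?_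
  rw [exists_u_eq_iff]
  -- As `c` is a power of two, `1 < c` means `c ≠ 1`; the conditions that define `V` thus become
  -- Boolean combinations of properties of the tracks that are already known to be regular.
  have key : ∀ v : ℕ × ℕ × ℕ × ℕ, v ∈ V ↔
      (((∃ k : ℕ, (comp v 2 : ℤ) = 2 ^ k) ∧ ((comp v 3 : ℤ) = 0 ∨ (comp v 3 : ℤ) = 1)) ∧
      (((comp v 0 : ℤ) = 0 ∨ ¬ (comp v 1 : ℤ) = 0 ∨ ¬ (comp v 2 : ℤ) = 1) ∧
        (¬ (comp v 0 : ℤ) = 0 ∨ (comp v 2 : ℤ) = 1))) := by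
    rintro ⟨a, b, c, d⟩
    rw [mem_V_iff, exists_pow_two_cast]
    simp only [comp, Matrix.cons_val]
    norm_cast
    constructor
    · rintro ⟨⟨⟨k, rfl⟩, hd⟩, h2, h3⟩
      have := Nat.one_le_two_pow (n := k)
      exact ⟨⟨⟨k, rfl⟩, hd⟩, by omega, by omega⟩
    · rintro ⟨⟨⟨k, rfl⟩, hd⟩, h2, h3⟩
      have := Nat.one_le_two_pow (n := k)
      exact ⟨⟨⟨k, rfl⟩, hd⟩, by omega, by omega⟩
  constructor
  · rintro ⟨v, hv, rfl⟩
    refine ⟨⟨v, rfl⟩, ?_⟩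
    simp only [Nat.cast_ofNat, digVal_encodeTuple]
    exact (key v).1 hv
  · rintro ⟨⟨v, rfl⟩, h⟩
    simp only [Nat.cast_ofNat, digVal_encodeTuple] at h
    exact ⟨v, (key v).2 h, rfl⟩

/-- The number on track `i` of the string number `s` of a pair of strings over `Col`. -/
def trackVal (s : Fin 2) (i : Fin 4) (z : List (Fin 2 → Option Col)) : ℤ :=
  digVal 2 (fun l => bitVal ((l s).bind fun c => c i)) z

theorem trackVal_convolution (v w : ℕ × ℕ × ℕ × ℕ) (s : Fin 2) (i : Fin 4) :
    trackVal s i (convolution ![encodeTuple v, encodeTuple w]) =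
      ((![comp v i, comp w i] s : ℕ) : ℤ) := by
  have h := digVal_map 2 (fun o : Option Col => bitVal (o.bind fun c => c i))
    (fun l : Fin 2 → Option Col => l s) (convolution ![encodeTuple v, encodeTuple w])
  rw [convolution_map_track, digVal_append_replicate 2 _ none rfl, digVal_map] at h
  refine h.symm.trans ?_
  fin_cases s
  · exact digVal_encodeTuple v i
  · exact digVal_encodeTuple w i

theorem reg_trackVal (m m' : ℤ) (s s' : Fin 2) (i i' : Fin 4) (c : ℤ) :
    Reg fun z => m * trackVal s i z + m' * trackVal s' i' z = c := by
  refine (reg_digVal_eq 2 le_rfl (fun l : Fin 2 → Option Col =>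
    m * bitVal ((l s).bind fun c => c i) + m' * bitVal ((l s').bind fun c => c i')) c).congr
    fun z => ?_
  rw [digVal_linear]; rfl

theorem reg_trackVal_eq (s : Fin 2) (i : Fin 4) (c : ℤ) : Reg fun z => trackVal s i z = c :=
  (reg_trackVal 1 0 s s i i c).congr fun z => by simp

theorem reg_trackVal_eq_add (s s' : Fin 2) (i i' : Fin 4) (c : ℤ) :
    Reg fun z => trackVal s i z = trackVal s' i' z + c :=
  (reg_trackVal 1 (-1) s s' i i' c).congr fun z => by constructor <;> intro h <;> linarith

theorem reg_trackVal_eq_two_mul (s s' : Fin 2) (i i' : Fin 4) :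
    Reg fun z => trackVal s i z = 2 * trackVal s' i' z :=
  (reg_trackVal 1 (-2) s s' i i' 0).congr fun z => by constructor <;> intro h <;> linarith

/-- The six rules that define `f`, as a condition on the components of two tuples. -/
def stepRel (X Y : Fin 4 → ℤ) : Prop :=
  (X 3 = 0 ∧ ¬ X 0 = 0 ∧ ¬ X 1 = 0 ∧ Y 0 = X 0 + 0 ∧ X 1 = Y 1 + 1 ∧ Y 2 = 2 * X 2 ∧ Y 3 = 0) ∨
  (X 3 = 0 ∧ ¬ X 0 = 0 ∧ X 1 = 0 ∧ X 0 = Y 0 + 1 ∧ Y 1 = X 2 + 0 ∧ Y 2 = 1 ∧ Y 3 = 0) ∨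
  (X 3 = 0 ∧ X 0 = 0 ∧ Y 0 = 0 ∧ Y 1 = X 1 + 1 ∧ Y 2 = 1 ∧ Y 3 = 1) ∨
  (¬ X 3 = 0 ∧ ¬ X 2 = 1 ∧ Y 0 = X 0 + 0 ∧ Y 1 = X 1 + 1 ∧ X 2 = 2 * Y 2 ∧ Y 3 = 1) ∨
  (¬ X 3 = 0 ∧ X 2 = 1 ∧ ((∃ k : ℕ, X 1 = 2 ^ k) ∧ ¬ X 1 = 1) ∧ Y 0 = X 0 + 1 ∧ Y 1 = 0 ∧
    Y 2 = X 1 + 0 ∧ Y 3 = 1) ∨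
  (¬ X 3 = 0 ∧ X 2 = 1 ∧ ¬ ((∃ k : ℕ, X 1 = 2 ^ k) ∧ ¬ X 1 = 1) ∧ Y 0 = X 0 + 0 ∧ Y 1 = X 1 + 0 ∧
    Y 2 = 1 ∧ Y 3 = 0)

set_option linter.unusedSimpArgs false in
-- In `stepRel` subtraction and halving are read from the other side, as `X 1 = Y 1 + 1` and `X 2 =
-- 2 * Y 2`. This is faithful because `b` is positive in the first case and `c`, a power of two
-- other than `1`, is even in the second. The summands `+ 0` only give the equations the shape of
-- `reg_trackVal_eq_add`.
theorem stepRel_iff {v w : ℕ × ℕ × ℕ × ℕ} (hv : v ∈ V) :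
    stepRel (fun i => comp v i) (fun i => comp w i) ↔ step v = w := by
  obtain ⟨a, b, c, d⟩ := v
  obtain ⟨a', b', c', d'⟩ := w
  obtain ⟨⟨⟨k, rfl⟩, hd⟩, h2, h3⟩ := mem_V_iff.1 hv
  have hk := Nat.one_le_two_pow (n := k)
  have hp : (∃ j, 0 < j ∧ b = 2 ^ j) ↔ (∃ j : ℕ, (b : ℤ) = 2 ^ j) ∧ ¬ (b : ℤ) = 1 := by
    rw [exists_pow_two_cast]
    constructor
    · rintro ⟨j, hj, rfl⟩
      have := Nat.one_lt_two_pow (n := j) (by omega)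
      exact ⟨⟨j, rfl⟩, by omega⟩
    · rintro ⟨⟨_ | j, rfl⟩, h⟩
      · simp at h
      · exact ⟨j + 1, by omega, rfl⟩
  unfold stepRel
  simp only [comp, Matrix.cons_val, step]
  rw [← hp]
  norm_cast
  have h2k : 1 < 2 ^ k → 2 * (2 ^ k / 2) = 2 ^ k := by
    rcases k with _ | k
    · simp
    · intro _; rw [pow_succ]; omega
  generalize 2 ^ k = c at *
  clear hv h2 h3
  split_ifs with h h' h'' h' h'' <;> simp only [Prod.mk.injEq]
  · simp only [h, h'.ne', h''.ne', not_true, not_false_iff, true_and, false_and, or_false]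
    omega
  · have e : b = 0 := by omega
    simp only [h, e, h'.ne', not_true, not_false_iff, true_and, false_and, or_false, false_or]
    omega
  · have e : a = 0 := by omega
    simp only [h, e, not_true, not_false_iff, true_and, false_and, or_false, false_or]
    omega
  · simp only [h, h'.ne', not_true, not_false_iff, true_and, false_and, or_false, false_or]
    omega
  · have e : c = 1 := by omega
    simp only [h, h'', e, not_true, not_false_iff, true_and, false_and, or_false, false_or]
    omega
  · have e : c = 1 := by omega
    simp only [h, h'', e, not_true, not_false_iff, true_and, false_and, or_false, false_or]
    omega

theorem reg_stepRel : Reg fun z => stepRel (fun i => trackVal 0 i z) (fun i => trackVal 1 i z) := by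
  have e := reg_trackVal_eq
  have a := reg_trackVal_eq_add
  have t := reg_trackVal_eq_two_mul
  have p := (reg_pow_two fun l : Fin 2 → Option Col => (l 0).bind fun c => c 1).and (e 0 1 1).not
  have A : ∀ {i : Fin 4} {c : ℤ}, Reg fun z => trackVal 1 i z = trackVal 0 i z + c := a 1 0 _ _ _
  unfold stepRel
  exact ((e 0 3 0).and ((e 0 0 0).not.and ((e 0 1 0).not.and ((a 1 0 0 0 0).and ((a 0 1 1 1 1).and
      ((t 1 0 2 2).and (e 1 3 0))))))).or
    (((e 0 3 0).and ((e 0 0 0).not.and ((e 0 1 0).and ((a 0 1 0 0 1).and ((a 1 0 1 2 0).and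
      ((e 1 2 1).and (e 1 3 0))))))).or
    (((e 0 3 0).and ((e 0 0 0).and ((e 1 0 0).and ((a 1 0 1 1 1).and
      ((e 1 2 1).and (e 1 3 1)))))).or
    (((e 0 3 0).not.and ((e 0 2 1).not.and ((a 1 0 0 0 0).and ((a 1 0 1 1 1).and
      ((t 0 1 2 2).and (e 1 3 1)))))).or
    (((e 0 3 0).not.and ((e 0 2 1).and (p.and ((a 1 0 0 0 1).and ((e 1 1 0).and
      ((a 1 0 2 1 0).and (e 1 3 1))))))).or
    ((e 0 3 0).not.and ((e 0 2 1).and (p.not.and ((a 1 0 0 0 0).and ((a 1 0 1 1 0).and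
      ((e 1 2 1).and (e 1 3 0)))))))))))

/-- The successor relation on the strings `u k` is recognizable. -/
theorem fa_u_succ : FA fun x y => ∃ k, x = u k ∧ y = u (k + 1) := by
  obtain ⟨K, hK, h⟩ := (FA.prod reg_u reg_encodeTuple).exists_reg'
  refine FA.of_reg (hK.and reg_stepRel) fun x y => ?_
  rw [h, u_succ_rel_iff, exists_u_eq_iff]
  constructor
  · rintro ⟨⟨⟨v, hv, rfl⟩, w, rfl⟩, h⟩
    simp only [trackVal_convolution] at h
    exact ⟨v, hv, rfl, congrArg _ ((stepRel_iff hv).1 h).symm⟩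
  · rintro ⟨v, hv, rfl, rfl⟩
    refine ⟨⟨⟨v, hv, rfl⟩, _, rfl⟩, ?_⟩
    simp only [trackVal_convolution]
    exact (stepRel_iff hv).2 rfl

/-- Each rule moves a component to another place, doubles or halves it, changes it by one or resets
it to a single digit, provided that what it overwrites is short or moved elsewhere. So no component
outgrows the longest component of the other tuple by more than one digit. This bound is what makes
the successor relation `Synch`. -/
theorem length_encodeTuple_step {v : ℕ × ℕ × ℕ × ℕ} (hv : v ∈ V) :
    (encodeTuple v).length ≤ (encodeTuple (step v)).length + 1 ∧
      (encodeTuple (step v)).length ≤ (encodeTuple v).length + 1 := by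
  have hv' := (length_encodeTuple_le v _).1 le_rfl
  have hw' := (length_encodeTuple_le (step v) _).1 le_rfl
  rw [length_encodeTuple_le, length_encodeTuple_le, ← forall_and]
  generalize (encodeTuple v).length = n at *
  generalize (encodeTuple (step v)).length = n' at *
  obtain ⟨a, b, c, d⟩ := v
  obtain ⟨⟨⟨k, rfl⟩, hd⟩, h2, h3⟩ := mem_V_iff.1 hv
  have hd' : ∀ e, e = 0 ∨ e = 1 → (revBin e).length = 1 := by
    rintro e (rfl | rfl) <;> simp [length_revBin]
  have hone := hd' 1 (Or.inr rfl)
  have hz := hd' 0 (Or.inl rfl)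
  have hdd := hd' d hd
  clear hv
  simp only [Fin.forall_fin_succ, comp, step] at *
  simp only [Matrix.cons_val_zero, Matrix.cons_val_succ, IsEmpty.forall_iff, and_true] at *
  have hs : ∀ m, (revBin (m + 1)).length ≤ (revBin m).length + 1 := fun m =>
    length_revBin_le_add_one (by omega)
  have hs' : ∀ m, (revBin m).length ≤ (revBin (m + 1)).length := fun m =>
    length_revBin_mono (by omega)
  have ht : ∀ m, (revBin (2 * m)).length ≤ (revBin m).length + 1 := fun m =>
    length_revBin_le_add_one (by omega)
  have ht' : ∀ m, (revBin m).length ≤ (revBin (2 * m)).length := fun m =>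
    length_revBin_mono (by omega)
  have hh : ∀ m, (revBin m).length ≤ (revBin (m / 2)).length + 1 := fun m =>
    length_revBin_le_add_one (by omega)
  have hh' : ∀ m, (revBin (m / 2)).length ≤ (revBin m).length := fun m =>
    length_revBin_mono (by omega)
  have hp := hs (a - 1)
  have hp' := hs' (a - 1)
  have hq := hs (b - 1)
  have hq' := hs' (b - 1)
  have := hs a
  have := hs' a
  have := hs b
  have := hs' b
  have := ht (2 ^ k)
  have := ht' (2 ^ k)
  have := hh (2 ^ k)
  have := hh' (2 ^ k)
  split_ifs at * with h h' h'' h' h''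
  · rw [Nat.sub_add_cancel h'] at *
    rw [Nat.sub_add_cancel h''] at *
    simp only at *
    omega
  · obtain rfl : b = 0 := by omega
    rw [Nat.sub_add_cancel h'] at *
    simp only at *
    omega
  · obtain rfl : a = 0 := by omega
    simp only at *
    rw [h3 trivial] at *
    omega
  · simp only at *
    omega
  · have : 2 ^ k = 1 := by have := Nat.one_le_two_pow (n := k); omega
    simp only at *
    rw [this] at *
    omega
  · have : 2 ^ k = 1 := by have := Nat.one_le_two_pow (n := k); omega
    simp only at *
    rw [this] at *
    omega

end Encode

/-! ### Representations given by normal forms -/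

section Packaging

variable {N α α₀ G : Type}

theorem mapOf_enc {enc : N → List α} (henc : Function.Injective enc) (val : N → G) (x : N)
    (h : enc x ∈ langOf enc) : mapOf enc val ⟨enc x, h⟩ = val x := by
  unfold mapOf
  exact congrArg val (henc (Classical.choose_spec (show ∃ y, enc y = enc x from h)))

theorem mapOf_bijective {enc : N → List α} (henc : Function.Injective enc) {val : N → G}
    (hval : Function.Bijective val) : Function.Bijective (mapOf enc val) := by
  constructor
  · rintro ⟨_, x, rfl⟩ ⟨_, y, rfl⟩ h
    have h' := ((mapOf_enc henc val x ⟨x, rfl⟩).symm.trans h).trans (mapOf_enc henc val y ⟨y, rfl⟩)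
    exact Subtype.ext (congrArg enc (hval.1 h'))
  · intro g
    obtain ⟨x, rfl⟩ := hval.2 g
    exact ⟨⟨enc x, x, rfl⟩, mapOf_enc henc val x _⟩

/-- Since `enc` and `val` are bijective onto their targets, equality of elements pulls back to the
diagonal of the language. What remains is the language and one relation for each generator. -/
theorem isBijectiveCayleyRep_of [Finite α] [Group G] {S : Set G} {enc : N → List α} {val : N → G}
    (henc : Function.Injective enc) (hval : Function.Bijective val) (hS : S.Finite)
    (hgen : Subgroup.closure S = ⊤) (hL : Reg fun z => ∃ x, enc x = z)
    (hR : ∀ s ∈ S, FA fun z z' => ∃ x y, enc x = z ∧ enc y = z' ∧ val y = val x * s) :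
    IsBijectiveCayleyRep S enc val where
  map_enc x := mapOf_enc henc val x _
  bijective := mapOf_bijective henc hval
  cayley := by
    have key : ∀ R : Set (Fin 2 → G), FA (fun z z' => ∃ x y, enc x = z ∧ enc y = z' ∧
        ![val x, val y] ∈ R) → FARecognizable (preimageRel (mapOf enc val) R) := by
      intro R h
      have : preimageRel (mapOf enc val) R = {w : Fin 2 → List α | ∃ x y, enc x = w 0 ∧
          enc y = w 1 ∧ ![val x, val y] ∈ R} := by
        ext w
        constructor
        · rintro ⟨x, hx, hR⟩
          obtain ⟨a, ha⟩ := (x 0).2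
          obtain ⟨b, hb⟩ := (x 1).2
          refine ⟨a, b, ha.trans (hx 0), hb.trans (hx 1), ?_⟩
          convert hR using 1
          funext i; fin_cases i
          · exact (mapOf_enc henc val a ⟨a, rfl⟩).symm.trans
              (congrArg (mapOf enc val) (Subtype.ext ha))
          · exact (mapOf_enc henc val b ⟨b, rfl⟩).symm.trans
              (congrArg (mapOf enc val) (Subtype.ext hb))
        · rintro ⟨a, b, ha, hb, h⟩
          refine ⟨![⟨enc a, a, rfl⟩, ⟨enc b, b, rfl⟩], fun i => ?_, ?_⟩
          · fin_cases i
            · exact ha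
            · exact hb
          · convert h using 1
            funext i; fin_cases i
            · exact mapOf_enc henc val a _
            · exact mapOf_enc henc val b _
      rw [this]
      exact h
    refine ⟨hS, hgen, (mapOf_bijective henc hval).2, hL, fun s => ?_, ?_⟩
    · refine key _ ((hR s.1 s.2).congr fun z z' => ?_)
      rfl
    · refine key _ ((FA.diag hL).congr fun z z' => ?_)
      constructor
      · rintro ⟨x, y, rfl, rfl, h⟩
        exact ⟨congrArg enc (hval.1 h), x, rfl⟩
      · rintro ⟨rfl, x, rfl⟩
        exact ⟨x, x, rfl, rfl, rfl⟩

/-- The `ψ₀`-representative is unique, so the infimum is taken over a single length. -/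
theorem xi_eq {enc₀ : N → List α₀} {enc : N → List α} {val : N → G}
    (henc₀ : Function.Injective enc₀) (henc : Function.Injective enc)
    (hval : Function.Bijective val) (x : N) (h : enc x ∈ langOf enc) :
    xi (mapOf enc₀ val) (mapOf enc val) ⟨enc x, h⟩ = (enc₀ x).length := by
  unfold xi
  refine Eq.trans (congrArg sInf (Set.ext fun l => ?_)) (csInf_singleton (enc₀ x).length)
  constructor
  · rintro ⟨⟨_, y, rfl⟩, h, rfl⟩
    have h' := ((mapOf_enc henc₀ val y ⟨y, rfl⟩).symm.trans h).trans (mapOf_enc henc val x _)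
    rw [hval.1 h']
    rfl
  · rintro rfl
    exact ⟨⟨enc₀ x, x, rfl⟩, (mapOf_enc henc₀ val x _).trans (mapOf_enc henc val x _).symm, rfl⟩

theorem eventuallyGE_compRate [Finite α] {enc₀ : N → List α₀} {enc : N → List α} {val : N → G}
    (henc₀ : Function.Injective enc₀) (henc : Function.Injective enc)
    (hval : Function.Bijective val)
    (h : ∀ n, 1 ≤ n → ∃ x, (enc x).length ≤ n ∧ T n ≤ (enc₀ x).length) :
    EventuallyGE (compRate (mapOf enc₀ val) (mapOf enc val)) T := by
  refine ⟨1, fun n hn => ?_⟩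
  obtain ⟨x, hx, hT⟩ := h n hn
  refine hT.trans (le_csSup ?_ ⟨⟨enc x, x, rfl⟩, hx, xi_eq henc₀ henc hval x _⟩)
  -- Boundedness is needed because `sSup` of an unbounded set of natural numbers is `0` by default;
  -- it holds because there are finitely many strings of length at most `n`.
  refine Set.Finite.bddAbove ?_
  have hfin : {w : {w // w ∈ langOf enc} | w.1.length ≤ n}.Finite :=
    (List.finite_length_le α n).preimage Subtype.val_injective.injOn
  refine (hfin.image (xi (mapOf enc₀ val) (mapOf enc val))).subset ?_
  rintro y ⟨w, hw, rfl⟩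
  exact ⟨w, hw, rfl⟩

end Packaging

/-! ### Encodings of `ℤ` and `ℕ` -/

section Coders

variable {α : Type}

/-- An encoding of `K` (which is `ℕ` or `ℤ`) by strings with a recognizable successor relation. -/
structure IsCoder {K : Type} [Add K] [One K] (e : K → List α) : Prop where
  injective : Function.Injective e
  reg : Reg fun z => ∃ k, e k = z
  succ : Synch fun x y => ∃ k, x = e k ∧ y = e (k + 1)

theorem reg_replicate (a : α) : Reg fun z => ∃ n, List.replicate n a = z :=
  (reg_mem_list fun b => b = a).congr fun z =>
    ⟨by rintro ⟨n, rfl⟩ b hb; exact List.eq_of_mem_replicate hb,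
      fun h => ⟨z.length, (List.eq_replicate_iff.2 ⟨rfl, h⟩).symm⟩⟩

theorem Reg.old {P : List α → Prop} (hP : Reg P) :
    Reg fun z : List (α ⊕ Col) => ∃ y, P y ∧ old y = z := hP.map Sum.inl

theorem reg_uNew : Reg fun z => ∃ k, uNew α k = z :=
  (reg_u.map Sum.inr).congr fun z =>
    ⟨by rintro ⟨k, rfl⟩; exact ⟨_, ⟨k, rfl⟩, rfl⟩, by rintro ⟨_, ⟨k, rfl⟩, rfl⟩; exact ⟨k, rfl⟩⟩

theorem uNew_injective : Function.Injective (uNew α) := fun _ _ h =>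
  u_injective (List.map_injective_iff.2 Sum.inr_injective h)

theorem synch_uNew_succ [Finite α] :
    Synch fun x y => ∃ k, x = uNew α k ∧ y = uNew α (k + 1) := by
  refine FA.synch ((fa_u_succ.map Sum.inr).congr fun x y => ?_) ?_
  · constructor
    · rintro ⟨k, rfl, rfl⟩; exact ⟨_, _, ⟨k, rfl, rfl⟩, rfl, rfl⟩
    · rintro ⟨_, _, ⟨k, rfl, rfl⟩, rfl, rfl⟩; exact ⟨k, rfl, rfl⟩
  · rintro x y ⟨k, rfl, rfl⟩
    obtain ⟨v, hv, h1, h2⟩ := (u_succ_rel_iff _ _).1 ⟨k, rfl, rfl⟩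
    simpa [uNew, h1, h2] using length_encodeTuple_step hv

theorem isCoder_uNew [Finite α] : IsCoder (uNew α) :=
  ⟨uNew_injective, reg_uNew, synch_uNew_succ⟩

theorem synch_replicate [Finite α] (a : α) (u v : List α) : Synch fun x y =>
    ∃ n, x = List.replicate n a ++ u ∧ y = List.replicate n a ++ v := by
  refine ((Synch.diag (reg_replicate a)).cat (synch_singleton u v)).congr fun x y => ?_
  constructor
  · rintro ⟨n, rfl, rfl⟩; exact ⟨_, _, _, _, ⟨rfl, n, rfl⟩, ⟨rfl, rfl⟩, rfl, rfl⟩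
  · rintro ⟨_, _, _, _, ⟨rfl, n, rfl⟩, ⟨rfl, rfl⟩, rfl, rfl⟩; exact ⟨n, rfl, rfl⟩

theorem isCoder_replicate [Finite α] (a : α) : IsCoder fun n : ℕ => List.replicate n a where
  injective m n h := by simpa using congrArg List.length h
  reg := reg_replicate a
  succ := (synch_replicate a [] [a]).congr fun x y => by
    simp [List.replicate_succ']

theorem powString_natCast (x xinv : α) (n : ℕ) : powString x xinv n = List.replicate n x := by
  simp [powString]

theorem powString_negSucc (x xinv : α) (n : ℕ) :
    powString x xinv (Int.negSucc n) = List.replicate (n + 1) xinv := by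
  simp [powString]

theorem powStringNew_natCast (x xinv : α) (n : ℕ) : powStringNew x xinv n = uNew α n := by
  simp [powStringNew]

theorem powStringNew_negSucc (x xinv : α) (n : ℕ) :
    powStringNew x xinv (Int.negSucc n) = List.replicate (n + 1) (Sum.inl xinv) := by
  simp [powStringNew, powString_negSucc, old]

theorem isCoder_powString [Finite α] {x xinv : α} (h : x ≠ xinv) :
    IsCoder (powString x xinv) where
  injective := by
    rintro (m | m) (n | n) e
    · simp only [Int.ofNat_eq_natCast, powString_natCast] at e ⊢
      simpa using congrArg List.length e
    · simp only [Int.ofNat_eq_natCast, powString_natCast, powString_negSucc] at e ⊢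
      cases m <;> simp [List.replicate_succ, h] at e
    · simp only [Int.ofNat_eq_natCast, powString_natCast, powString_negSucc] at e ⊢
      cases n <;> simp [List.replicate_succ, h.symm] at e
    · simp only [powString_negSucc] at e
      simpa using congrArg List.length e
  reg := ((reg_replicate x).or (reg_replicate xinv)).congr fun z => by
    constructor
    · rintro ⟨n | n, rfl⟩
      · exact Or.inl ⟨n, by simp [powString_natCast]⟩
      · exact Or.inr ⟨n + 1, (powString_negSucc ..).symm⟩
    · rintro (⟨n, rfl⟩ | ⟨_ | n, rfl⟩)
      · exact ⟨n, powString_natCast ..⟩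
      · exact ⟨0, by simp [powString]⟩
      · exact ⟨Int.negSucc n, powString_negSucc ..⟩
  -- For `k ≥ 0` a letter `x` is added, for `k < 0` a letter `xinv` is removed. At `k = -1` the
  -- result is the empty string, which also represents `0`.
  succ := ((synch_replicate x [] [x]).or (synch_replicate xinv [xinv] [])).congr fun y z => by
    constructor
    · rintro ⟨n | n, rfl, rfl⟩
      · refine Or.inl ⟨n, by simp [powString_natCast], ?_⟩
        have : (Int.ofNat n + 1 : ℤ) = ((n + 1 : ℕ) : ℤ) := by simp
        rw [this, powString_natCast, List.replicate_succ']
      · refine Or.inr ⟨n, by rw [powString_negSucc, List.replicate_succ'], ?_⟩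
        cases n with
        | zero => simp [powString]
        | succ n =>
          have : Int.negSucc (n + 1) + 1 = Int.negSucc n := by omega
          rw [this, powString_negSucc, List.append_nil]
    · rintro (⟨n, rfl, rfl⟩ | ⟨n, rfl, rfl⟩)
      · refine ⟨n, by simp [powString_natCast], ?_⟩
        have : (n + 1 : ℤ) = ((n + 1 : ℕ) : ℤ) := by simp
        rw [this, powString_natCast, List.replicate_succ']
      · refine ⟨Int.negSucc n, by rw [powString_negSucc, List.replicate_succ'], ?_⟩
        cases n with
        | zero => simp [powString]
        | succ n =>
          have : Int.negSucc (n + 1) + 1 = Int.negSucc n := by omega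
          rw [this, powString_negSucc, List.append_nil]

theorem isCoder_powStringNew [Finite α] (x xinv : α) : IsCoder (powStringNew x xinv) where
  injective := by
    rintro (m | m) (n | n) e
    · simp only [Int.ofNat_eq_natCast, powStringNew_natCast] at e ⊢
      exact congrArg _ (uNew_injective e)
    · simp only [Int.ofNat_eq_natCast, powStringNew_natCast, powStringNew_negSucc] at e ⊢
      have : Sum.inl xinv ∈ uNew α m := by rw [e]; simp
      simp [uNew] at this
    · simp only [Int.ofNat_eq_natCast, powStringNew_natCast, powStringNew_negSucc] at e ⊢
      have : Sum.inl xinv ∈ uNew α n := by rw [← e]; simp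
      simp [uNew] at this
    · simp only [powStringNew_negSucc] at e
      simpa using congrArg List.length e
  reg := (reg_uNew.or ((reg_replicate (Sum.inl xinv)).and (reg_eq []).not)).congr fun z => by
    constructor
    · rintro ⟨n | n, rfl⟩
      · exact Or.inl ⟨n, by simp [powStringNew_natCast]⟩
      · exact Or.inr ⟨⟨n + 1, (powStringNew_negSucc ..).symm⟩, by simp [powStringNew_negSucc]⟩
    · rintro (⟨n, rfl⟩ | ⟨⟨_ | n, rfl⟩, h⟩)
      · exact ⟨n, powStringNew_natCast ..⟩
      · simp at h
      · exact ⟨Int.negSucc n, powStringNew_negSucc ..⟩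
  succ := by
    -- The three parts correspond to `k ≥ 0`, to `k = -1`, where the two encodings meet in a single
    -- pair of strings, and to `k ≤ -2`.
    refine ((synch_uNew_succ.or (synch_singleton [Sum.inl xinv] (uNew α 0))).or
      (synch_replicate (Sum.inl xinv) [Sum.inl xinv, Sum.inl xinv] [Sum.inl xinv])).congr
      fun y z => ?_
    have h0 : Int.negSucc 0 + 1 = ((0 : ℕ) : ℤ) := rfl
    have h1 : ∀ n : ℕ, (n + 1 : ℤ) = ((n + 1 : ℕ) : ℤ) := fun n => by simp
    have h2 : ∀ n : ℕ, Int.negSucc (n + 1) + 1 = Int.negSucc n := fun n => by omega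
    constructor
    · rintro ⟨n | _ | n, rfl, rfl⟩
      · refine Or.inl (Or.inl ⟨n, by simp [powStringNew_natCast], ?_⟩)
        rw [Int.ofNat_eq_natCast, h1, powStringNew_natCast]
      · refine Or.inl (Or.inr ⟨powStringNew_negSucc x xinv 0, ?_⟩)
        rw [h0, powStringNew_natCast]
      · refine Or.inr ⟨n, ?_, ?_⟩
        · simp [powStringNew_negSucc, List.replicate_succ']
        · simp [h2, powStringNew_negSucc, List.replicate_succ']
    · rintro ((⟨n, rfl, rfl⟩ | ⟨rfl, rfl⟩) | ⟨n, rfl, rfl⟩)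
      · refine ⟨n, by simp [powStringNew_natCast], ?_⟩
        rw [h1, powStringNew_natCast]
      · exact ⟨Int.negSucc 0, (powStringNew_negSucc x xinv 0).symm, by rw [h0, powStringNew_natCast]⟩
      · refine ⟨Int.negSucc (n + 1), ?_, ?_⟩
        · simp [powStringNew_negSucc, List.replicate_succ']
        · simp [h2, powStringNew_negSucc, List.replicate_succ']

end Coders

/-! ### Free abelian groups -/

section FreeAbelian

variable {α : Type} {m : ℕ}

theorem exists_ofFn_flatten_succ {m : ℕ} (p : (Fin (m + 1) → List α) → Prop) (z : List α) :
    (∃ g, p g ∧ (List.ofFn g).flatten = z) ↔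
      ∃ w g, p (Fin.cons w g) ∧ w ++ (List.ofFn g).flatten = z := by
  constructor
  · rintro ⟨g, hg, rfl⟩
    refine ⟨g 0, Fin.tail g, by rwa [Fin.cons_self_tail], ?_⟩
    rw [List.ofFn_succ, List.flatten_cons]; rfl
  · rintro ⟨w, g, hg, rfl⟩
    exact ⟨_, hg, by rw [List.ofFn_succ, List.flatten_cons]; rfl⟩

theorem reg_flatten_ofFn (P : Fin m → List α → Prop) (hP : ∀ i, Reg (P i)) :
    Reg fun z => ∃ g, (∀ i, P i (g i)) ∧ (List.ofFn g).flatten = z := by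
  induction m with
  | zero =>
    refine (reg_eq []).congr fun z => ?_
    constructor
    · rintro ⟨g, -, rfl⟩; simp
    · rintro rfl; exact ⟨fun _ => [], fun i => i.elim0, by simp⟩
  | succ m ih =>
    refine ((hP 0).append (ih _ fun i => hP i.succ)).congr fun z => ?_
    rw [exists_ofFn_flatten_succ]
    constructor
    · rintro ⟨w, g, h, rfl⟩
      exact ⟨w, _, h 0, ⟨g, fun i => h i.succ, rfl⟩, rfl⟩
    · rintro ⟨w, _, hw, ⟨g, hg, rfl⟩, rfl⟩
      exact ⟨w, g, Fin.cases hw hg, rfl⟩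

theorem synch_flatten_ofFn [Finite α] (Q : Fin m → List α → List α → Prop)
    (hQ : ∀ i, Synch (Q i)) : Synch fun x y => ∃ g h, (∀ i, Q i (g i) (h i)) ∧
      (List.ofFn g).flatten = x ∧ (List.ofFn h).flatten = y := by
  induction m with
  | zero =>
    refine synch_nil.congr fun x y => ?_
    constructor
    · rintro ⟨g, h, -, rfl, rfl⟩; simp
    · rintro ⟨rfl, rfl⟩; exact ⟨fun _ => [], fun _ => [], fun i => i.elim0, by simp, by simp⟩
  | succ m ih =>
    refine ((hQ 0).cat (ih _ fun i => hQ i.succ)).congr fun x y => ?_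
    constructor
    · rintro ⟨g, h, hgh, rfl, rfl⟩
      refine ⟨_, _, _, _, hgh 0, ⟨_, _, fun i => hgh i.succ, rfl, rfl⟩, ?_, ?_⟩ <;>
        rw [List.ofFn_succ, List.flatten_cons]
    · rintro ⟨w, w', _, _, h0, ⟨g, h, hgh, rfl, rfl⟩, rfl, rfl⟩
      refine ⟨Fin.cons w g, Fin.cons w' h, Fin.cases h0 hgh, ?_, ?_⟩ <;>
        rw [List.ofFn_succ, List.flatten_cons] <;> rfl

theorem filter_flatten_ofFn (p : α → Bool) (g : Fin m → List α) (i : Fin m)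
    (hi : ∀ a ∈ g i, p a = true) (h : ∀ j, j ≠ i → ∀ a ∈ g j, ¬ p a = true) :
    (List.ofFn g).flatten.filter p = g i := by
  induction m with
  | zero => exact i.elim0
  | succ m ih =>
    rw [List.ofFn_succ, List.flatten_cons, List.filter_append]
    refine Fin.cases (motive := fun i => (∀ a ∈ g i, p a = true) →
      (∀ j, j ≠ i → ∀ a ∈ g j, ¬ p a = true) → _ = g i) ?_ ?_ i hi h
    · intro hi h
      rw [List.filter_eq_self.2 hi, List.filter_eq_nil_iff.2, List.append_nil]
      intro a ha
      rw [List.mem_flatten] at ha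
      obtain ⟨l, hl, ha⟩ := ha
      rw [List.mem_ofFn] at hl
      obtain ⟨j, rfl⟩ := hl
      exact h j.succ (Fin.succ_ne_zero j) a ha
    · intro i hi h
      rw [List.filter_eq_nil_iff.2 (h 0 (Fin.succ_ne_zero i).symm), List.nil_append]
      exact ih _ i hi fun j hj => h j.succ fun e => hj (Fin.succ_injective _ e)

theorem freeAbVal_eq (k : Fin m → ℤ) : freeAbVal m k = Multiplicative.ofAdd k := by
  unfold freeAbVal freeAbGen
  simp only [← ofAdd_zsmul, ← ofAdd_sum]
  congr 1
  funext i
  simp [Finset.sum_apply, Pi.single_apply]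

theorem freeAbVal_bijective : Function.Bijective (freeAbVal m) := by
  have : freeAbVal m = Multiplicative.ofAdd := funext freeAbVal_eq
  rw [this]
  exact Multiplicative.ofAdd.bijective

theorem closure_range_freeAbGen : Subgroup.closure (Set.range (freeAbGen (m := m))) = ⊤ := by
  refine eq_top_iff.2 fun g _ => ?_
  obtain ⟨k, rfl⟩ := freeAbVal_bijective.2 g
  exact Subgroup.prod_mem _ fun i _ =>
    Subgroup.zpow_mem _ (Subgroup.subset_closure (Set.mem_range_self i)) _

/-- Concatenations of encodings of the exponents, over disjoint alphabets. -/
theorem flatten_ofFn_injective (e : Fin m → ℤ → List α) (he : ∀ i, IsCoder (e i))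
    (cl : α → Fin m) (hcl : ∀ i k, ∀ a ∈ e i k, cl a = i) :
    Function.Injective fun k : Fin m → ℤ => (List.ofFn fun i => e i (k i)).flatten := by
  intro k k' h
  funext i
  refine (he i).injective ?_
  have := congrArg (List.filter fun a => decide (cl a = i)) h
  have key : ∀ k : Fin m → ℤ, (List.ofFn fun i => e i (k i)).flatten.filter
      (fun a => decide (cl a = i)) = e i (k i) := by
    intro k
    refine filter_flatten_ofFn _ (fun i => e i (k i)) i ?_ ?_
    · intro a ha; simpa using hcl i _ a ha
    · intro j hj a ha; simpa [hcl j _ a ha] using hj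
  dsimp only at this
  rwa [key, key] at this

/-- Multiplication by `a_j` changes the exponent number `j` only, so the relation is a product of
diagonals and one successor relation. All factors are `Synch`, hence the displacement of the later
blocks does no harm. -/
theorem isBijectiveCayleyRep_freeAb [Finite α] (e : Fin m → ℤ → List α) (he : ∀ i, IsCoder (e i))
    (cl : α → Fin m) (hcl : ∀ i k, ∀ a ∈ e i k, cl a = i) :
    IsBijectiveCayleyRep (Set.range freeAbGen)
      (fun k : Fin m → ℤ => (List.ofFn fun i => e i (k i)).flatten) (freeAbVal m) := by
  refine isBijectiveCayleyRep_of (flatten_ofFn_injective e he cl hcl) freeAbVal_bijective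
    (Set.finite_range _) closure_range_freeAbGen ?_ ?_
  · refine (reg_flatten_ofFn _ fun i => (he i).reg).congr fun z => ?_
    constructor
    · rintro ⟨k, rfl⟩; exact ⟨_, fun i => ⟨k i, rfl⟩, rfl⟩
    · rintro ⟨g, hg, rfl⟩
      choose k hk using hg
      exact ⟨k, by simp only [hk]⟩
  · rintro _ ⟨j, rfl⟩
    refine (synch_flatten_ofFn (fun i x y => ∃ k, x = e i k ∧ y = e i (k + if i = j then 1 else 0))
      fun i => ?_).fa.congr fun z z' => ?_
    · by_cases h : i = j
      · simpa [h] using (he j).succ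
      · refine (Synch.diag (he i).reg).congr fun x y => ?_
        simp only [h, if_false, add_zero]
        constructor
        · rintro ⟨k, rfl, rfl⟩; exact ⟨rfl, k, rfl⟩
        · rintro ⟨rfl, k, rfl⟩; exact ⟨k, rfl, rfl⟩
    · have hnext : ∀ k k' : Fin m → ℤ, freeAbVal m k' = freeAbVal m k * freeAbGen j ↔
          k' = fun i => k i + if i = j then 1 else 0 := by
        intro k k'
        rw [freeAbVal_eq, freeAbVal_eq]
        unfold freeAbGen
        rw [← ofAdd_add, Multiplicative.ofAdd.apply_eq_iff_eq]
        constructor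
        · rintro rfl; funext i; simp [Pi.single_apply]
        · rintro rfl; funext i; simp [Pi.single_apply]
      constructor
      · rintro ⟨k, k', rfl, rfl, h⟩
        rw [hnext] at h
        exact ⟨_, _, fun i => ⟨k i, rfl, rfl⟩, rfl, by rw [h]⟩
      · rintro ⟨g, h, hgh, rfl, rfl⟩
        choose k hg hh using hgh
        obtain rfl := funext hg
        obtain rfl := funext hh
        exact ⟨k, fun i => k i + if i = j then 1 else 0, rfl, rfl, (hnext _ _).2 rfl⟩

theorem mem_powString {x xinv a : α} {k : ℤ} (h : a ∈ powString x xinv k) : a = x ∨ a = xinv := by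
  unfold powString at h
  split_ifs at h
  · exact Or.inl (List.eq_of_mem_replicate h)
  · exact Or.inr (List.eq_of_mem_replicate h)

theorem mem_powStringNew {x xinv : α} {a : α ⊕ Col} {k : ℤ} (h : a ∈ powStringNew x xinv k) :
    (∃ c, a = Sum.inr c) ∨ a = Sum.inl xinv := by
  rcases k with k | k
  · rw [Int.ofNat_eq_natCast, powStringNew_natCast, uNew, List.mem_map] at h
    obtain ⟨c, -, rfl⟩ := h
    exact Or.inl ⟨c, rfl⟩
  · rw [powStringNew_negSucc] at h
    exact Or.inr (List.eq_of_mem_replicate h)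

/-- Recognizability is carried to the new alphabet by `FA.map`; the bound on the lengths then gives
`Synch` there. -/
theorem IsCoder.old [Finite α] {e : ℤ → List α} (he : IsCoder e)
    (h : ∀ k, (e k).length ≤ (e (k + 1)).length + 1 ∧ (e (k + 1)).length ≤ (e k).length + 1) :
    IsCoder fun k => old (e k) where
  injective k l hkl := he.injective (List.map_injective_iff.2 Sum.inl_injective hkl)
  reg := he.reg.old.congr fun z => by
    constructor
    · rintro ⟨k, rfl⟩; exact ⟨_, ⟨k, rfl⟩, rfl⟩
    · rintro ⟨_, ⟨k, rfl⟩, rfl⟩; exact ⟨k, rfl⟩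
  succ := by
    refine FA.synch ((he.succ.fa.map Sum.inl).congr fun x y => ?_) ?_
    · constructor
      · rintro ⟨k, rfl, rfl⟩; exact ⟨_, _, ⟨k, rfl, rfl⟩, rfl, rfl⟩
      · rintro ⟨_, _, ⟨k, rfl, rfl⟩, rfl, rfl⟩; exact ⟨k, rfl, rfl⟩
    · rintro x y ⟨k, rfl, rfl⟩
      simpa [CompressFA.old] using h k

theorem length_powString (x xinv : α) (k : ℤ) : (powString x xinv k).length = k.natAbs := by
  unfold powString
  split_ifs <;> simp

theorem freeAb_main (m : ℕ) [NeZero m] :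
    IsBijectiveCayleyRep (Set.range freeAbGen) (freeAbEnc₀ m) (freeAbVal m) ∧
      IsBijectiveCayleyRep (Set.range freeAbGen) (freeAbEnc m) (freeAbVal m) ∧
      EventuallyGE
        (compRate (mapOf (freeAbEnc₀ m) (freeAbVal m)) (mapOf (freeAbEnc m) (freeAbVal m))) T := by
  let e₀ : Fin m → ℤ → List (Fin m × Bool) := fun i => powString (i, true) (i, false)
  let e : Fin m → ℤ → List ((Fin m × Bool) ⊕ Col) := fun i k =>
    if i = 0 then powStringNew (i, true) (i, false) k else old (powString (i, true) (i, false) k)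
  have he₀ : ∀ i, IsCoder (e₀ i) := fun i => isCoder_powString (by simp)
  have hcl₀ : ∀ i k, ∀ a ∈ e₀ i k, a.1 = i := by
    intro i k a ha
    rcases mem_powString ha with rfl | rfl <;> rfl
  have he : ∀ i, IsCoder (e i) := by
    intro i
    by_cases hi : i = 0
    · simp only [e, hi, if_true]
      exact isCoder_powStringNew _ _
    · simp only [e, hi, if_false]
      refine (he₀ i).old fun k => ?_
      simp only [e₀, length_powString]
      omega
  -- The symbols of the strings `u k` occur in the first block only, so they are assigned to the
  -- index `0`.
  have hcl : ∀ i k, ∀ a ∈ e i k, Sum.elim Prod.fst (fun _ => 0) a = i := by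
    intro i k a ha
    by_cases hi : i = 0
    · subst hi
      simp only [e, if_true] at ha
      rcases mem_powStringNew ha with ⟨c, rfl⟩ | rfl <;> rfl
    · simp only [e, hi, if_false, old, List.mem_map] at ha
      obtain ⟨b, hb, rfl⟩ := ha
      exact hcl₀ i k b hb
  refine ⟨isBijectiveCayleyRep_freeAb e₀ he₀ _ hcl₀, isBijectiveCayleyRep_freeAb e he _ hcl,
    eventuallyGE_compRate (flatten_ofFn_injective e₀ he₀ _ hcl₀)
      (flatten_ofFn_injective e he _ hcl) freeAbVal_bijective fun n hn => ?_⟩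
  obtain ⟨k, hk, hT⟩ := exists_u_short n hn
  -- The witness is `a_1^k`: its new string is `u k`, since all other blocks are empty, and its old
  -- string contains `k` letters `a_1`.
  refine ⟨Pi.single 0 k, ?_, ?_⟩
  · have : (fun i => e i ((Pi.single 0 (k : ℤ) : Fin m → ℤ) i)) =
        fun i => if i = 0 then uNew _ k else [] := by
      funext i
      by_cases hi : i = 0
      · subst hi
        simp [e, powStringNew_natCast]
      · simp [e, hi, old, powString]
    have h2 : (List.ofFn fun i : Fin m => if i = 0 then uNew (Fin m × Bool) k else []).flatten
        = uNew _ k := by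
      have := filter_flatten_ofFn (fun _ => true)
        (fun i : Fin m => if i = 0 then uNew (Fin m × Bool) k else []) 0 (by simp)
        (by intro j hj; simp [hj])
      rwa [List.filter_eq_self.2 (by simp)] at this
    change (List.ofFn fun i => e i ((Pi.single 0 (k : ℤ) : Fin m → ℤ) i)).flatten.length ≤ n
    rw [this, h2]
    simpa [uNew] using hk
  · refine hT.trans ?_
    have : (e₀ 0 ((Pi.single 0 (k : ℤ) : Fin m → ℤ) 0)).Sublist
        (List.ofFn fun i => e₀ i ((Pi.single 0 (k : ℤ) : Fin m → ℤ) i)).flatten :=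
      List.sublist_flatten_of_mem (List.mem_ofFn.2 ⟨0, rfl⟩)
    refine le_trans ?_ this.length_le
    simp [e₀, length_powString]

end FreeAbelian

/-! ### Encodings by pairs -/

section Pairs

variable {α : Type}

theorem takeWhile_append_of {p : α → Bool} {x y : List α} (hx : ∀ a ∈ x, p a = true)
    (hy : ∀ a ∈ y.head?, ¬ p a = true) : (x ++ y).takeWhile p = x ∧ (x ++ y).dropWhile p = y := by
  constructor
  · rw [List.takeWhile_append_of_pos hx]
    cases y with
    | nil => simp
    | cons b y => simp [hy b (by simp)]
  · rw [List.dropWhile_append_of_pos hx]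
    cases y with
    | nil => simp
    | cons b y => simp [hy b (by simp)]

/-- The place of the cut is recovered by `takeWhile`. This is how the encodings of a power followed
by a tail are decoded. -/
theorem append_inj_of_prefix {p : α → Bool} {x y x' y' : List α} (hx : ∀ a ∈ x, p a = true)
    (hy : ∀ a ∈ y.head?, ¬ p a = true) (hx' : ∀ a ∈ x', p a = true)
    (hy' : ∀ a ∈ y'.head?, ¬ p a = true) (h : x ++ y = x' ++ y') : x = x' ∧ y = y' := by
  have h1 := takeWhile_append_of hx hy
  have h2 := takeWhile_append_of hx' hy'
  rw [h] at h1
  exact ⟨h1.1.symm.trans h2.1, h1.2.symm.trans h2.2⟩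

end Pairs

/-! ### Linear relations in positional number systems -/

section Linear

variable {α : Type}

theorem digVal_convolution (b : ℤ) (dig : α → ℤ) (x y : List α) (s : Fin 2) :
    digVal b (fun l => (l s).elim 0 dig) (convolution ![x, y]) = digVal b dig (![x, y] s) := by
  have h := digVal_map b (fun o : Option α => o.elim 0 dig)
    (fun l : Fin 2 → Option α => l s) (convolution ![x, y])
  rw [convolution_map_track, digVal_append_replicate b _ none rfl, digVal_map] at h
  exact h.symm

/-- The least significant digit comes first, so padding stands at the most significant end and can
be counted as zero. -/
theorem fa_linear [Finite α] (b : ℕ) (hb : 2 ≤ b) (dig dig' : α → ℤ) (m m' c : ℤ) :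
    FA fun x y => m * digVal b dig x + m' * digVal b dig' y = c := by
  refine FA.of_reg (reg_digVal_eq b hb (fun l : Fin 2 → Option α =>
    m * (l 0).elim 0 dig + m' * (l 1).elim 0 dig') c) fun x y => ?_
  rw [digVal_linear, digVal_convolution, digVal_convolution]
  rfl

end Linear

/-! ### Semidirect products -/

section Semidirect

variable {α β D : Type}

theorem faRecognizable_preimageRel_iff {L : Language β} {ψ : {w // w ∈ L} → D}
    {R : Set (Fin 2 → D)} : FARecognizable (preimageRel ψ R) ↔
    FA fun z z' => ∃ v v' : {w // w ∈ L}, v.1 = z ∧ v'.1 = z' ∧ ![ψ v, ψ v'] ∈ R := by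
  have : preimageRel ψ R = {w : Fin 2 → List β | ∃ v v' : {w // w ∈ L}, v.1 = w 0 ∧ v'.1 = w 1 ∧
      ![ψ v, ψ v'] ∈ R} := by
    ext w
    constructor
    · rintro ⟨x, hx, hR⟩
      refine ⟨x 0, x 1, hx 0, hx 1, ?_⟩
      convert hR using 1
      funext i; fin_cases i <;> rfl
    · rintro ⟨v, v', hv, hv', hR⟩
      refine ⟨![v, v'], fun i => ?_, ?_⟩
      · fin_cases i
        · exact hv
        · exact hv'
      · convert hR using 1
        funext i; fin_cases i <;> rfl
  rw [this]
  rfl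

theorem semiA_zpow (A : GL (Fin 2) ℤ) (k : ℤ) :
    semiA A ^ k = SemidirectProduct.inr (Multiplicative.ofAdd k) := by
  unfold semiA
  rw [← map_zpow, ← ofAdd_zsmul]
  simp

theorem semiZ_mul_semiA (A : GL (Fin 2) ℤ) (z : Fin 2 → ℤ) :
    semiZ A (glAddEquiv A z) * semiA A = semiA A * semiZ A z := by
  unfold semiA semiZ
  have := SemidirectProduct.inl_aut
    (φ := zpowersHom (MulAut (Multiplicative (Fin 2 → ℤ))) (glAut A))
    (Multiplicative.ofAdd 1) (Multiplicative.ofAdd z)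
  have h2 : (zpowersHom (MulAut (Multiplicative (Fin 2 → ℤ))) (glAut A)) (Multiplicative.ofAdd 1)
      (Multiplicative.ofAdd z) = Multiplicative.ofAdd (glAddEquiv A z) := by
    simp [zpowersHom_apply, glAut]
  rw [h2] at this
  rw [this]
  simp [mul_assoc]

theorem semiZ_add (A : GL (Fin 2) ℤ) (z z' : Fin 2 → ℤ) :
    semiZ A (z + z') = semiZ A z * semiZ A z' := by
  unfold semiZ
  rw [← map_mul]; rfl

theorem semi_pair_bijective (A : GL (Fin 2) ℤ) :
    Function.Bijective fun x : ℤ × (Fin 2 → ℤ) => semiA A ^ x.1 * semiZ A x.2 := by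
  constructor
  · rintro ⟨k, z⟩ ⟨k', z'⟩ h
    have hk : k = k' := by
      have := congrArg SemidirectProduct.rightHom h
      simpa [semiA_zpow, semiZ] using this
    subst hk
    have := mul_left_cancel h
    have := SemidirectProduct.inl_injective this
    rw [show z = z' from this]
  · intro g
    refine ⟨(Multiplicative.toAdd g.right, Multiplicative.toAdd
      ((zpowersHom (MulAut (Multiplicative (Fin 2 → ℤ))) (glAut A) g.right)⁻¹ g.left)), ?_⟩
    dsimp only
    rw [semiA_zpow]
    ext
    · simp [semiZ]
    · simp [semiZ]

theorem semiVal_bijective (A : GL (Fin 2) ℤ) {L' : Language β}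
    {ψ' : {v // v ∈ L'} → (Fin 2 → ℤ)} (hψ : Function.Bijective ψ') :
    Function.Bijective (semiVal A ψ') :=
  (semi_pair_bijective A).comp (Function.bijective_id.prodMap hψ)

theorem closure_semiGens (A : GL (Fin 2) ℤ) : Subgroup.closure (semiGens A) = ⊤ := by
  refine eq_top_iff.2 fun g _ => ?_
  obtain ⟨⟨k, z⟩, rfl⟩ := (semi_pair_bijective A).2 g
  have ha : semiA A ∈ Subgroup.closure (semiGens A) :=
    Subgroup.subset_closure (Set.mem_insert _ _)
  refine mul_mem (Subgroup.zpow_mem _ ha _) ?_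
  have : z = z 0 • Pi.single 0 1 + z 1 • Pi.single 1 1 := by
    funext i; fin_cases i <;> simp
  have hz : ∀ (n : ℤ) z, semiZ A (n • z) = semiZ A z ^ n := by
    intro n z
    unfold semiZ
    rw [← map_zpow]; rfl
  rw [show (k, z).2 = z from rfl, this, semiZ_add, hz, hz]
  have he : ∀ i, semiZ A (Pi.single i 1) ∈ Subgroup.closure (semiGens A) := fun i =>
    Subgroup.subset_closure (Set.mem_insert_of_mem _ (Set.mem_range_self i))
  exact mul_mem (Subgroup.zpow_mem _ (he 0) _) (Subgroup.zpow_mem _ (he 1) _)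

/-- Moving `a` to the left gives `a^k z a = a^(k+1) (A⁻¹ z)`. An edge labelled `a` is therefore the
successor on the exponent times the converse of the graph of `f_A` on the tail; this explains the
`swap` below. An edge labelled `e_i` changes the tail only. -/
theorem isBijectiveCayleyRep_semi [Finite α] [Finite β] (A : GL (Fin 2) ℤ) {L' : Language β}
    {ψ' : {v // v ∈ L'} → (Fin 2 → ℤ)} (hψ : Function.Bijective ψ')
    (hFA : IsFAPresentation (z2Str A) L' ψ') (e : ℤ → List α) (he : IsCoder e) (ι : β → α)
    (hinj : Function.Injective fun x : ℤ × {v // v ∈ L'} => e x.1 ++ x.2.1.map ι) :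
    IsBijectiveCayleyRep (semiGens A) (fun x : ℤ × {v // v ∈ L'} => e x.1 ++ x.2.1.map ι)
      (semiVal A ψ') := by
  refine isBijectiveCayleyRep_of hinj (semiVal_bijective A hψ)
    ((Set.finite_range _).insert _) (closure_semiGens A) ?_ ?_
  · have hL : Reg fun z => z ∈ L' := hFA.regular
    refine (he.reg.append (hL.map ι)).congr fun z => ?_
    constructor
    · rintro ⟨⟨k, v⟩, rfl⟩; exact ⟨_, _, ⟨k, rfl⟩, ⟨v.1, v.2, rfl⟩, rfl⟩
    · rintro ⟨_, _, ⟨k, rfl⟩, ⟨v, hv, rfl⟩, rfl⟩; exact ⟨⟨k, ⟨v, hv⟩⟩, rfl⟩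
  · rintro s (rfl | ⟨i, rfl⟩)
    · have hS := ((faRecognizable_preimageRel_iff.1 (hFA.rel none : FARecognizable (k := 2) _)).swap).map ι
      refine (he.succ _ hS).congr fun z z' => ?_
      have key : ∀ x y, semiVal A ψ' y = semiVal A ψ' x * semiA A ↔
          y.1 = x.1 + 1 ∧ ψ' x.2 = glAddEquiv A (ψ' y.2) := by
        rintro ⟨k, v⟩ ⟨k', v'⟩
        -- With the vector written as `A z`, the commutation rule `(A z) a = a z` applies without
        -- inverting `A`.
        obtain ⟨z, hz⟩ := (glAddEquiv A).surjective (ψ' v)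
        unfold semiVal
        dsimp only
        rw [← hz, mul_assoc, semiZ_mul_semiA, ← mul_assoc, ← _root_.zpow_add_one]
        rw [(glAddEquiv A).injective.eq_iff]
        constructor
        · intro h
          have := (semi_pair_bijective A).1 (a₁ := (k', ψ' v')) (a₂ := (k + 1, z)) h
          simpa [eq_comm] using this
        · rintro ⟨rfl, rfl⟩; rfl
      constructor
      · rintro ⟨⟨k, v⟩, ⟨k', v'⟩, rfl, rfl, h⟩
        obtain ⟨h1, h2⟩ := (key _ _).1 h
        dsimp only at h1
        subst h1
        exact ⟨_, _, _, _, ⟨k, rfl, rfl⟩, ⟨_, _, ⟨v', v, rfl, rfl, h2⟩, rfl, rfl⟩, rfl, rfl⟩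
      · rintro ⟨_, _, _, _, ⟨k, rfl, rfl⟩, ⟨_, _, ⟨v', v, rfl, rfl, h2⟩, rfl, rfl⟩, rfl, rfl⟩
        exact ⟨(k, v), (k + 1, v'), rfl, rfl, (key _ _).2 ⟨rfl, h2⟩⟩
    · have hS := (faRecognizable_preimageRel_iff.1 (hFA.rel (some i) : FARecognizable (k := 2) _)).map ι
      refine (Synch.diag he.reg _ hS).congr fun z z' => ?_
      have key : ∀ x y, semiVal A ψ' y = semiVal A ψ' x * semiZ A (Pi.single i 1) ↔
          y.1 = x.1 ∧ ψ' y.2 = ψ' x.2 + Pi.single i 1 := by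
        rintro ⟨k, v⟩ ⟨k', v'⟩
        unfold semiVal
        dsimp only
        rw [mul_assoc, ← semiZ_add]
        constructor
        · intro h
          have := (semi_pair_bijective A).1 (a₁ := (k', ψ' v'))
            (a₂ := (k, ψ' v + Pi.single i 1)) h
          simpa using this
        · rintro ⟨rfl, h⟩; rw [h]
      constructor
      · rintro ⟨⟨k, v⟩, ⟨k', v'⟩, rfl, rfl, h⟩
        obtain ⟨h1, h2⟩ := (key _ _).1 h
        dsimp only at h1
        subst h1
        exact ⟨_, _, _, _, ⟨rfl, _, rfl⟩, ⟨_, _, ⟨v, v', rfl, rfl, h2⟩, rfl, rfl⟩, rfl, rfl⟩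
      · rintro ⟨_, _, _, _, ⟨rfl, k, rfl⟩, ⟨_, _, ⟨v, v', rfl, rfl, h2⟩, rfl, rfl⟩, rfl, rfl⟩
        exact ⟨(k, v), (k, v'), rfl, rfl, (key _ _).2 ⟨rfl, h2⟩⟩

theorem pair_injective {e : ℤ → List α} (he : Function.Injective e) {ι : β → α}
    (hι : Function.Injective ι) (p : α → Bool) (hp : ∀ k, ∀ a ∈ e k, p a = true)
    (hp' : ∀ b, ¬ p (ι b) = true) (L' : Language β) :
    Function.Injective fun x : ℤ × {v // v ∈ L'} => e x.1 ++ x.2.1.map ι := by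
  rintro ⟨k, v⟩ ⟨k', v'⟩ h
  have hv : ∀ v : List β, ∀ a ∈ (v.map ι).head?, ¬ p a = true := by
    rintro (_ | ⟨b, v⟩) a ha
    · simp at ha
    · obtain rfl : ι b = a := by simpa using ha
      exact hp' b
  obtain ⟨h1, h2⟩ := append_inj_of_prefix (hp k) (hv v.1) (hp k') (hv v'.1) h
  exact Prod.ext (he h1) (Subtype.ext (List.map_injective_iff.2 hι h2))

theorem semi_main (A : GL (Fin 2) ℤ) [Finite β] (L' : Language β)
    (ψ' : {v // v ∈ L'} → (Fin 2 → ℤ)) (hψ : Function.Bijective ψ')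
    (hFA : IsFAPresentation (z2Str A) L' ψ') :
    IsBijectiveCayleyRep (semiGens A) (semiEnc₀ L') (semiVal A ψ') ∧
      IsBijectiveCayleyRep (semiGens A) (semiEnc L') (semiVal A ψ') ∧
      ([] ∈ L' → EventuallyGE
        (compRate (mapOf (semiEnc₀ L') (semiVal A ψ')) (mapOf (semiEnc L') (semiVal A ψ'))) T) := by
  have he₀ : IsCoder (powString (Sum.inl true : Bool ⊕ β) (Sum.inl false)) :=
    isCoder_powString (by simp)
  have he := isCoder_powStringNew (Sum.inl true : Bool ⊕ β) (Sum.inl false)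
  have hinj₀ : Function.Injective (semiEnc₀ L') := by
    refine pair_injective he₀.injective Sum.inr_injective Sum.isLeft ?_ (by simp) L'
    intro k a ha
    rcases mem_powString ha with rfl | rfl <;> rfl
  have henc : semiEnc L' = fun x : ℤ × {v // v ∈ L'} =>
      powStringNew (Sum.inl true : Bool ⊕ β) (Sum.inl false) x.1 ++
        x.2.1.map fun b => Sum.inl (Sum.inr b) := by
    funext x
    simp [semiEnc, old, Function.comp_def]
  have hinj : Function.Injective (semiEnc L') := by
    rw [henc]
    refine pair_injective he.injective (Sum.inl_injective.comp Sum.inr_injective)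
      (Sum.elim Sum.isLeft fun _ => true) ?_ (by simp) L'
    intro k a ha
    rcases mem_powStringNew ha with ⟨c, rfl⟩ | rfl <;> rfl
  refine ⟨isBijectiveCayleyRep_semi A hψ hFA _ he₀ Sum.inr hinj₀, ?_, fun hnil => ?_⟩
  · rw [henc] at hinj ⊢
    exact isBijectiveCayleyRep_semi A hψ hFA _ he _ hinj
  · refine eventuallyGE_compRate hinj₀ hinj (semiVal_bijective A hψ) fun n hn => ?_
    obtain ⟨k, hk, hT⟩ := exists_u_short n hn
    -- With the empty tail the whole string is `u k`, whatever vector the empty string represents.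
    refine ⟨(k, ⟨[], hnil⟩), ?_, ?_⟩
    · rw [henc]
      simpa [powStringNew_natCast, uNew] using hk
    · simpa [semiEnc₀, length_powString] using hT

end Semidirect

/-! ### Balanced ternary representations of pairs of integers -/

section Ternary

/-- The digit `-1`, `0` or `1` in the coordinate `i`. -/
def ternDig (i : Fin 2) (a : Fin 2 → Fin 3) : ℤ := (a i : ℕ) - 1

/-- The pair of integers represented by a string of digits. -/
def ternVal (w : List (Fin 2 → Fin 3)) : Fin 2 → ℤ := fun i => digVal 3 (ternDig i) w

/-- The strings whose most significant digit is not zero. -/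
def ternLang : Language (Fin 2 → Fin 3) := {w | w.getLast? ≠ some fun _ => 1}

theorem mem_ternLang {w : List (Fin 2 → Fin 3)} :
    w ∈ ternLang ↔ w.getLast? ≠ some fun _ => 1 := Iff.rfl

theorem nil_mem_ternLang : [] ∈ ternLang := by simp [mem_ternLang]

theorem ternLang_tail {a : Fin 2 → Fin 3} {w : List (Fin 2 → Fin 3)} (h : a :: w ∈ ternLang) :
    w ∈ ternLang := by
  cases w with
  | nil => exact nil_mem_ternLang
  | cons b w => simpa [mem_ternLang, List.getLast?_cons_cons] using h

theorem ternVal_cons (a : Fin 2 → Fin 3) (w : List (Fin 2 → Fin 3)) (i : Fin 2) :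
    ternVal (a :: w) i = (a i : ℕ) - 1 + 3 * ternVal w i := rfl

theorem eq_nil_of_ternVal_eq_zero {w : List (Fin 2 → Fin 3)} (hw : w ∈ ternLang)
    (h : ternVal w = 0) : w = [] := by
  induction w with
  | nil => rfl
  | cons a w ih =>
    have h1 : ∀ i, a i = 1 ∧ ternVal w i = 0 := by
      intro i
      have h2 := congrFun h i
      rw [ternVal_cons, Pi.zero_apply] at h2
      have := (a i).isLt
      constructor
      · ext; change (a i : ℕ) = 1; omega
      · omega
    obtain rfl := ih (ternLang_tail hw) (funext fun i => (h1 i).2)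
    exact absurd (by simp [show a = fun _ => 1 from funext fun i => (h1 i).1]) hw

/-- The digits `-1, 0, 1` are distinct modulo `3`, so the value determines the first digit in each
coordinate. Strings of different length are separated by the condition on the most significant
column. -/
theorem ternVal_injOn {w w' : List (Fin 2 → Fin 3)} (hw : w ∈ ternLang) (hw' : w' ∈ ternLang)
    (h : ternVal w = ternVal w') : w = w' := by
  induction w generalizing w' with
  | nil => exact (eq_nil_of_ternVal_eq_zero hw' h.symm).symm
  | cons a w ih =>
    cases w' with
    | nil => exact eq_nil_of_ternVal_eq_zero hw h
    | cons b w' =>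
      have h1 : ∀ i, a i = b i ∧ ternVal w i = ternVal w' i := by
        intro i
        have h2 := congrFun h i
        rw [ternVal_cons, ternVal_cons] at h2
        have := (a i).isLt
        have := (b i).isLt
        constructor
        · ext; omega
        · omega
      rw [funext fun i => (h1 i).1, ih (ternLang_tail hw) (ternLang_tail hw')
        (funext fun i => (h1 i).2)]

/-- Balanced division `z i = d + 3 * ((z i + 1) / 3)` with `d` in `{-1, 0, 1}`; the quotients are
smaller in absolute value unless they are zero already. If both quotients vanish, the remaining
column is not the zero column, because `z ≠ 0`. -/
theorem exists_ternVal_eq (z : Fin 2 → ℤ) : ∃ w ∈ ternLang, ternVal w = z := by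
  induction hn : (z 0).natAbs + (z 1).natAbs using Nat.strong_induction_on generalizing z with
  | _ n ih =>
    by_cases h0 : z = 0
    · exact ⟨[], nil_mem_ternLang, by rw [h0]; rfl⟩
    · have hz : z 0 ≠ 0 ∨ z 1 ≠ 0 := by
        by_contra! h
        exact h0 (funext fun i => by fin_cases i; exacts [h.1, h.2])
      obtain ⟨w, hw, hwz⟩ := ih _ (by subst hn; omega) (fun i => (z i + 1) / 3) rfl
      refine ⟨(fun i => ⟨((z i + 1) % 3).toNat, by omega⟩) :: w, ?_, ?_⟩
      · cases w with
        | nil =>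
          rw [mem_ternLang]
          intro h
          have h1 : ∀ i, (z i + 1) / 3 = 0 := fun i => (congrFun hwz i).symm
          have h2 : ∀ i, ((z i + 1) % 3).toNat = 1 := fun i => by
            have := congrFun (Option.some.inj h) i
            exact congrArg Fin.val this
          have := h1 0; have := h1 1; have := h2 0; have := h2 1
          omega
        | cons b w => simpa [mem_ternLang, List.getLast?_cons_cons] using hw
      · funext i
        rw [ternVal_cons, hwz]
        dsimp only
        omega

/-- The presentation of `ℤ²` by balanced ternary representations. -/
def ternMap (w : {w // w ∈ ternLang}) : Fin 2 → ℤ := ternVal w.1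

theorem ternMap_bijective : Function.Bijective ternMap :=
  ⟨fun x y h => Subtype.ext (ternVal_injOn x.2 y.2 h), fun z => by
    obtain ⟨w, hw, h⟩ := exists_ternVal_eq z
    exact ⟨⟨w, hw⟩, h⟩⟩

theorem reg_ternLang : Reg fun w => w ∈ ternLang :=
  reg_getLast? fun o => o ≠ some fun _ => 1

/-- Balanced digits need no separate sign, so an affine map with integer coefficients is one linear
equation for each coordinate. The map `f_A`, the translations and equality are all of this form. -/
theorem faRecognizable_ternMap_linear (m : Fin 2 → Fin 2 → ℤ) (c : Fin 2 → ℤ) :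
    FARecognizable (preimageRel ternMap
      {x : Fin 2 → Fin 2 → ℤ | ∀ i, x 1 i = m i 0 * x 0 0 + m i 1 * x 0 1 + c i}) := by
  rw [faRecognizable_preimageRel_iff]
  have h : ∀ i, FA fun x y => ternVal y i = m i 0 * ternVal x 0 + m i 1 * ternVal x 1 + c i := by
    intro i
    refine (fa_linear 3 (by norm_num) (fun a => m i 0 * ternDig 0 a + m i 1 * ternDig 1 a)
      (ternDig i) (-1) 1 (c i)).congr fun x y => ?_
    rw [digVal_linear]
    unfold ternVal
    constructor <;> intro h <;> push_cast at * <;> linarith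
  refine ((FA.prod reg_ternLang reg_ternLang).and ((h 0).and (h 1))).congr fun x y => ?_
  constructor
  · rintro ⟨⟨x, hx⟩, ⟨y, hy⟩, rfl, rfl, h⟩
    exact ⟨⟨hx, hy⟩, h 0, h 1⟩
  · rintro ⟨⟨hx, hy⟩, h0, h1⟩
    exact ⟨⟨x, hx⟩, ⟨y, hy⟩, rfl, rfl, Fin.forall_fin_two.2 ⟨h0, h1⟩⟩

theorem isFAPresentation_ternMap (A : GL (Fin 2) ℤ) :
    IsFAPresentation (z2Str A) ternLang ternMap where
  surjective := ternMap_bijective.2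
  regular := reg_ternLang
  rel
    | none => by
      refine cast (congrArg (fun R => FARecognizable (preimageRel ternMap R)) ?_)
        (faRecognizable_ternMap_linear (fun i j => A.1 i j) 0)
      ext x
      change _ ↔ x 1 = A.1 *ᵥ x 0
      rw [funext_iff]
      refine forall_congr' fun i => ?_
      simp [Matrix.mulVec, dotProduct, Fin.sum_univ_two]
    | some j => by
      refine cast (congrArg (fun R => FARecognizable (preimageRel ternMap R)) ?_)
        (faRecognizable_ternMap_linear (fun i j => if i = j then 1 else 0) (Pi.single j 1))
      ext x
      change _ ↔ x 1 = x 0 + Pi.single j 1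
      rw [funext_iff]
      refine forall_congr' fun i => ?_
      fin_cases i <;> simp
  eq := by
    refine cast (congrArg (fun R => FARecognizable (preimageRel ternMap R)) ?_)
      (faRecognizable_ternMap_linear (fun i j => if i = j then 1 else 0) 0)
    ext x
    change _ ↔ x 0 = x 1
    rw [funext_iff]
    refine forall_congr' fun i => ?_
    fin_cases i <;> simp [eq_comm]

end Ternary

/-! ### Free groups -/

section Free

variable {α : Type} {m : ℕ}

theorem freeVal_bijective : Function.Bijective (freeVal m) := by
  constructor
  · intro x y h
    have := FreeGroup.reduce.sound h
    rw [x.2.reduce_eq, y.2.reduce_eq] at this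
    exact Subtype.ext this
  · intro g
    exact ⟨⟨g.toWord, FreeGroup.isReduced_toWord⟩, FreeGroup.mk_toWord⟩

theorem mk_append_inv (w : List (Fin m × Bool)) (i : Fin m) :
    FreeGroup.mk (w ++ [(i, false)]) * FreeGroup.of i = FreeGroup.mk w := by
  rw [← FreeGroup.mul_mk]
  have : FreeGroup.mk [(i, false)] = (FreeGroup.of i)⁻¹ := rfl
  rw [this, inv_mul_cancel_right]

theorem synch_append [Finite α] (u v : List α) :
    Synch fun x y => ∃ w, x = w ++ u ∧ y = w ++ v := by
  refine ((Synch.diag (reg_const True)).cat (synch_singleton u v)).congr fun x y => ?_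
  constructor
  · rintro ⟨w, rfl, rfl⟩; exact ⟨w, w, u, v, ⟨rfl, trivial⟩, ⟨rfl, rfl⟩, rfl, rfl⟩
  · rintro ⟨w, _, _, _, ⟨rfl, -⟩, ⟨rfl, rfl⟩, rfl, rfl⟩; exact ⟨w, rfl, rfl⟩

variable [NeZero m]

/-- Reduced words that do not begin with the first generator or its inverse. -/
def IsTail (w : List (Fin m × Bool)) : Prop :=
  FreeGroup.IsReduced w ∧ ∀ a ∈ w.head?, a.1 ≠ 0

theorem reg_isTail : Reg (IsTail (m := m)) :=
  (reg_isChain _).and (reg_head? fun o : Option (Fin m × Bool) => ∀ a ∈ o, a.1 ≠ 0)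

/-- The word `a_1^k`. -/
abbrev firstPow (m : ℕ) [NeZero m] (k : ℤ) : List (Fin m × Bool) :=
  powString (0, true) (0, false) k

theorem firstPow_natCast (k : ℕ) : firstPow m k = List.replicate k (0, true) :=
  powString_natCast ..

theorem firstPow_negSucc (k : ℕ) :
    firstPow m (Int.negSucc k) = List.replicate (k + 1) (0, false) :=
  powString_negSucc ..

theorem isReduced_firstPow_append {k : ℤ} {w : List (Fin m × Bool)} (hw : IsTail w) :
    FreeGroup.IsReduced (firstPow m k ++ w) := by
  refine List.isChain_append.2 ⟨?_, hw.1, ?_⟩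
  · unfold firstPow powString
    split_ifs
    · exact List.isChain_replicate_of_rel _ fun _ => rfl
    · exact List.isChain_replicate_of_rel _ fun _ => rfl
  · intro a ha b hb h
    have h1 := mem_powString (List.mem_of_mem_getLast? ha)
    exfalso
    refine hw.2 b hb (h ▸ ?_)
    rcases h1 with rfl | rfl <;> rfl

/-- The reduced word `a_1^k w`. -/
def mkWord (k : ℤ) (w : {w : List (Fin m × Bool) // IsTail w}) : ReducedWord m :=
  ⟨firstPow m k ++ w.1, isReduced_firstPow_append w.2⟩

theorem isTail_nil : IsTail ([] : List (Fin m × Bool)) := ⟨List.isChain_nil, by simp⟩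

theorem exists_mkWord (x : ReducedWord m) : ∃ k w, mkWord k w = x := by
  obtain ⟨x, hx⟩ := x
  suffices ∃ k w, IsTail w ∧ firstPow m k ++ w = x by
    obtain ⟨k, w, hw, h⟩ := this
    exact ⟨k, ⟨w, hw⟩, Subtype.ext h⟩
  induction x with
  | nil => exact ⟨0, [], isTail_nil, by simp [powString]⟩
  | cons a x ih =>
    by_cases ha : a.1 = 0
    · obtain ⟨k, w, hw, rfl⟩ := ih (List.IsChain.tail hx)
      obtain ⟨i, b⟩ := a
      dsimp only at ha
      subst ha
      rcases k with k | k <;> simp only [Int.ofNat_eq_natCast, firstPow_natCast,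
        firstPow_negSucc] at hx ⊢
      · rcases b with _ | _
        · rcases k with _ | k
          · exact ⟨Int.negSucc 0, w, hw, by rw [firstPow_negSucc]; rfl⟩
          · rw [List.replicate_succ, List.cons_append] at hx
            exact absurd ((List.isChain_cons_cons.1 hx).1 rfl) (by simp)
        · exact ⟨(k + 1 : ℕ), w, hw, by rw [firstPow_natCast, List.replicate_succ]; rfl⟩
      · rcases b with _ | _
        · exact ⟨Int.negSucc (k + 1), w, hw, by
            rw [firstPow_negSucc, List.replicate_succ]; rfl⟩
        · rw [List.replicate_succ, List.cons_append] at hx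
          exact absurd ((List.isChain_cons_cons.1 hx).1 rfl) (by simp)
    · exact ⟨0, a :: x, ⟨hx, by simpa using ha⟩, by simp [powString]⟩

theorem mk_firstPow (k : ℤ) :
    FreeGroup.mk (firstPow m k) = FreeGroup.of (0 : Fin m) ^ k := by
  have h : ∀ (b : Bool) (n : ℕ), FreeGroup.mk (List.replicate n ((0 : Fin m), b)) =
      FreeGroup.mk [(0, b)] ^ n := by
    intro b n
    induction n with
    | zero => rfl
    | succ n ih => rw [pow_succ, ← ih, FreeGroup.mul_mk, List.replicate_succ']
  rcases k with k | k
  · rw [Int.ofNat_eq_natCast, firstPow_natCast, h, zpow_natCast]; rfl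
  · rw [firstPow_negSucc, h, zpow_negSucc, ← inv_pow]; rfl

theorem freeVal_mkWord (k : ℤ) (w : {w : List (Fin m × Bool) // IsTail w}) :
    freeVal m (mkWord k w) = FreeGroup.of 0 ^ k * FreeGroup.mk w.1 := by
  rw [← mk_firstPow, FreeGroup.mul_mk]; rfl

/-- Multiplication by a generator on words that do not begin with `a_1^{±1}`. -/
def tailNext (i : Fin m) (w w' : List (Fin m × Bool)) : Prop :=
  (IsTail w ∧ IsTail w') ∧ (w' = w ++ [(i, true)] ∨ w = w' ++ [(i, false)])

theorem fa_tailNext (i : Fin m) : FA (tailNext i) := by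
  refine ((FA.prod reg_isTail reg_isTail).and
    ((synch_append [] [(i, true)]).or (synch_append [(i, false)] [])).fa).congr fun x y => ?_
  unfold tailNext
  simp

theorem isTail_of_append {w v : List (Fin m × Bool)} (h : IsTail (w ++ v)) : IsTail w := by
  refine ⟨(List.isChain_append.1 h.1).1, ?_⟩
  cases w with
  | nil => simp
  | cons a w => exact h.2

theorem isTail_concat {w : List (Fin m × Bool)} (hw : IsTail w) {i : Fin m} (h : w ≠ [] ∨ i ≠ 0)
    (h' : w.getLast? ≠ some (i, false)) : IsTail (w ++ [(i, true)]) := by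
  refine ⟨List.isChain_append.2 ⟨hw.1, List.isChain_singleton _, ?_⟩, ?_⟩
  · rintro ⟨j, b⟩ ha _ hb hj
    obtain rfl : (i, true) = _ := by simpa using hb
    dsimp only at hj ⊢
    subst hj
    cases b
    · exact absurd ha h'
    · rfl
  · cases w with
    | nil => simpa using h
    | cons a w => exact hw.2

/-- Right multiplication by `a_i` affects the end of a reduced word only: a final `a_i⁻¹` is
cancelled, otherwise `a_i` is appended. The exponent `k` is reached only if the tail is empty and
`a_i` is the first generator. -/
theorem freeVal_mul_of_iff (k : ℤ) (w : {w : List (Fin m × Bool) // IsTail w}) (i : Fin m)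
    (y : ReducedWord m) : freeVal m y = freeVal m (mkWord k w) * FreeGroup.of i ↔
      (∃ w', tailNext i w.1 w'.1 ∧ y = mkWord k w') ∨
        i = 0 ∧ w.1 = [] ∧ y = mkWord (k + 1) ⟨[], isTail_nil⟩ := by
  have hsucc : i = 0 → w.1 = [] → freeVal m (mkWord k w) * FreeGroup.of i =
      freeVal m (mkWord (k + 1) ⟨[], isTail_nil⟩) := by
    rintro rfl h
    rw [freeVal_mkWord, freeVal_mkWord, h]
    rw [_root_.zpow_add_one]
    simp [← FreeGroup.one_eq_mk]
  have hnext : ∀ w' : {w : List (Fin m × Bool) // IsTail w}, tailNext i w.1 w'.1 →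
      freeVal m (mkWord k w) * FreeGroup.of i = freeVal m (mkWord k w') := by
    rintro ⟨w', hw'⟩ ⟨-, h | h⟩
    · dsimp only at h
      subst h
      rw [freeVal_mkWord, freeVal_mkWord, mul_assoc, ← FreeGroup.mul_mk]; rfl
    · rw [freeVal_mkWord, freeVal_mkWord, mul_assoc, h, mk_append_inv]
  constructor
  · intro h
    by_cases h0 : i = 0 ∧ w.1 = []
    · rw [hsucc h0.1 h0.2] at h
      exact Or.inr ⟨h0.1, h0.2, freeVal_bijective.1 h⟩
    · left
      obtain ⟨w, hw⟩ := w
      dsimp only at h0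
      by_cases hl : w.getLast? = some (i, false)
      · obtain ⟨w', rfl⟩ : ∃ w', w = w' ++ [(i, false)] := by
          rcases List.eq_nil_or_concat w with rfl | ⟨w', a, rfl⟩
          · simp at hl
          · exact ⟨w', by simpa using hl⟩
        have ht : tailNext i (w' ++ [(i, false)]) w' := ⟨⟨hw, isTail_of_append hw⟩, Or.inr rfl⟩
        refine ⟨⟨w', isTail_of_append hw⟩, ht, freeVal_bijective.1 (h.trans (hnext _ ht))⟩
      · have hw' : IsTail (w ++ [(i, true)]) := isTail_concat hw (by tauto) hl
        have ht : tailNext i w (w ++ [(i, true)]) := ⟨⟨hw, hw'⟩, Or.inl rfl⟩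
        exact ⟨⟨_, hw'⟩, ht, freeVal_bijective.1 (h.trans (hnext ⟨_, hw'⟩ ht))⟩
  · rintro (⟨w', hw', rfl⟩ | ⟨h1, h2, rfl⟩)
    · exact (hnext w' hw').symm
    · exact (hsucc h1 h2).symm

/-- The tail may contain `a_1^{±1}`, but it does not begin with them; so its first letter marks the
end of the encoded power. -/
theorem free_enc_injective {enc : ReducedWord m → List α} {e : ℤ → List α}
    (he : Function.Injective e) {ι : Fin m × Bool → α} (hι : Function.Injective ι)
    (henc : ∀ k w, enc (mkWord k w) = e k ++ w.1.map ι) (p : α → Bool)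
    (hp : ∀ k, ∀ a ∈ e k, p a = true) (hp' : ∀ b, b.1 ≠ 0 → ¬ p (ι b) = true) :
    Function.Injective enc := by
  intro x y h
  obtain ⟨k, w, rfl⟩ := exists_mkWord x
  obtain ⟨k', w', rfl⟩ := exists_mkWord y
  rw [henc, henc] at h
  have hv : ∀ w : {w : List (Fin m × Bool) // IsTail w}, ∀ a ∈ (w.1.map ι).head?,
      ¬ p a = true := by
    rintro ⟨_ | ⟨b, v⟩, hw⟩ a ha
    · simp at ha
    · obtain rfl : ι b = a := by simpa using ha
      exact hp' b (hw.2 b rfl)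
  obtain ⟨h1, h2⟩ := append_inj_of_prefix (hp k) (hv w) (hp k') (hv w') h
  rw [he h1, Subtype.ext (List.map_injective_iff.2 hι h2)]

theorem isBijectiveCayleyRep_free [Finite α] {enc : ReducedWord m → List α} {e : ℤ → List α}
    (he : IsCoder e) {ι : Fin m × Bool → α}
    (henc : ∀ k w, enc (mkWord k w) = e k ++ w.1.map ι) (hinj : Function.Injective enc) :
    IsBijectiveCayleyRep (Set.range FreeGroup.of) enc (freeVal m) := by
  refine isBijectiveCayleyRep_of hinj freeVal_bijective (Set.finite_range _)
    (FreeGroup.closure_range_of _) ?_ ?_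
  · refine (he.reg.append (reg_isTail.map ι)).congr fun z => ?_
    constructor
    · rintro ⟨x, rfl⟩
      obtain ⟨k, w, rfl⟩ := exists_mkWord x
      exact ⟨_, _, ⟨k, rfl⟩, ⟨w.1, w.2, rfl⟩, (henc k w).symm⟩
    · rintro ⟨_, _, ⟨k, rfl⟩, ⟨w, hw, rfl⟩, rfl⟩
      exact ⟨mkWord k ⟨w, hw⟩, henc k _⟩
  · rintro _ ⟨i, rfl⟩
    have h1 := Synch.diag he.reg _ ((fa_tailNext i).map ι)
    have h2 : FA fun x y => i = 0 ∧ ∃ k, x = e k ∧ y = e (k + 1) := by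
      by_cases hi : i = 0
      · simpa [hi] using he.succ.fa
      · refine (FA.prod (reg_const False) (reg_const False)).congr fun x y => by simp [hi]
    refine (h1.or h2).congr fun z z' => ?_
    constructor
    · rintro ⟨x, y, rfl, rfl, h⟩
      obtain ⟨k, w, rfl⟩ := exists_mkWord x
      rcases (freeVal_mul_of_iff k w i y).1 h with ⟨w', hw', rfl⟩ | ⟨hi, hw, rfl⟩
      · exact Or.inl ⟨_, _, _, _, ⟨rfl, k, rfl⟩, ⟨_, _, hw', rfl, rfl⟩, henc _ _, henc _ _⟩
      · exact Or.inr ⟨hi, k, by rw [henc, hw]; simp, by rw [henc]; simp⟩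
    · rintro (⟨_, _, _, _, ⟨rfl, k, rfl⟩, ⟨w, w', hw, rfl, rfl⟩, rfl, rfl⟩ | ⟨hi, k, rfl, rfl⟩)
      · exact ⟨mkWord k ⟨w, hw.1.1⟩, mkWord k ⟨w', hw.1.2⟩, henc _ _, henc _ _,
          (freeVal_mul_of_iff _ _ _ _).2 (Or.inl ⟨_, hw, rfl⟩)⟩
      · exact ⟨mkWord k ⟨[], isTail_nil⟩, mkWord (k + 1) ⟨[], isTail_nil⟩, by rw [henc]; simp,
          by rw [henc]; simp, (freeVal_mul_of_iff _ _ _ _).2 (Or.inr ⟨hi, rfl, rfl⟩)⟩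

theorem replacePrefix_replicate_append [DecidableEq α] (x : α) (n : ℕ) (w : List α)
    (hw : ∀ a ∈ w.head?, a ≠ x) :
    replacePrefix x (List.replicate n x ++ w) = uNew α n ++ old w := by
  have h := takeWhile_append_of (p := fun y => decide (y = x)) (x := List.replicate n x) (y := w)
    (fun a ha => by simpa using List.eq_of_mem_replicate ha) (by simpa using hw)
  unfold replacePrefix
  rw [h.1, h.2, List.length_replicate]

theorem freeEnc_mkWord (k : ℤ) (w : {w : List (Fin m × Bool) // IsTail w}) :
    freeEnc m (mkWord k w) = powStringNew (0, true) (0, false) k ++ w.1.map Sum.inl := by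
  have hv : (mkWord k w).1 = firstPow m k ++ w.1 := rfl
  have hw : ∀ b : Bool, ∀ a ∈ w.1.head?, a ≠ (0, b) := by
    rintro b a ha rfl
    exact w.2.2 _ ha rfl
  unfold freeEnc
  rcases k with k | k
  · rw [Int.ofNat_eq_natCast] at hv ⊢
    rw [firstPow_natCast] at hv
    rw [if_neg, hv, powStringNew_natCast, replacePrefix_replicate_append _ _ _ (hw true)]
    · rfl
    · rw [hv]
      rcases k with _ | k
      · intro h
        exact hw false _ (by simpa using h) rfl
      · simp [List.replicate_succ]
  · rw [firstPow_negSucc] at hv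
    rw [if_pos (by rw [hv]; simp [List.replicate_succ]), hv, powStringNew_negSucc]
    simp [old]

theorem free_main (m : ℕ) [NeZero m] :
    IsBijectiveCayleyRep (Set.range FreeGroup.of)
        (Subtype.val : ReducedWord m → List (Fin m × Bool)) (freeVal m) ∧
      IsBijectiveCayleyRep (Set.range FreeGroup.of) (freeEnc m) (freeVal m) ∧
      EventuallyGE
        (compRate (mapOf (Subtype.val : ReducedWord m → List (Fin m × Bool)) (freeVal m))
          (mapOf (freeEnc m) (freeVal m))) T := by
  have he₀ : IsCoder (firstPow m) := isCoder_powString (by simp)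
  have he := isCoder_powStringNew ((0 : Fin m), true) (0, false)
  have hinj : Function.Injective (freeEnc m) := by
    refine free_enc_injective he.injective Sum.inl_injective freeEnc_mkWord
      (Sum.elim (fun a => decide (a.1 = 0)) fun _ => true) ?_ (by simp)
    intro k a ha
    rcases mem_powStringNew ha with ⟨c, rfl⟩ | rfl <;> simp
  refine ⟨isBijectiveCayleyRep_free he₀ (ι := id) (fun k w => by rw [List.map_id]; rfl)
    Subtype.val_injective, isBijectiveCayleyRep_free he freeEnc_mkWord hinj,
    eventuallyGE_compRate Subtype.val_injective hinj freeVal_bijective fun n hn => ?_⟩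
  obtain ⟨k, hk, hT⟩ := exists_u_short n hn
  refine ⟨mkWord k ⟨[], isTail_nil⟩, ?_, ?_⟩
  · rw [freeEnc_mkWord]
    simpa [powStringNew_natCast, uNew] using hk
  · simpa [mkWord, length_powString] using hT

end Free

/-! ### Normal forms in Baumslag-Solitar groups -/

section BaumslagSolitar

variable {p q : ℕ}

/-- The number of admissible exponents before `t` and before `t⁻¹`. -/
def bsN (p q : ℕ) (b : Bool) : ℕ := if b then q else p

/-- Admissible lists of blocks, the last block first. -/
def RevAdm (p q : ℕ) (l : List (ℕ × Bool)) : Prop := bsAdmissible p q l.reverse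

theorem revAdm_nil : RevAdm p q [] := ⟨by simp, List.isChain_nil⟩

theorem revAdm_cons {b : ℕ × Bool} {l : List (ℕ × Bool)} : RevAdm p q (b :: l) ↔
    RevAdm p q l ∧ b.1 < bsN p q b.2 ∧ ∀ c ∈ l.head?, ¬ (b.1 = 0 ∧ b.2 = !c.2) := by
  unfold RevAdm bsAdmissible bsN
  rw [List.reverse_cons, List.isChain_append]
  simp only [List.mem_append, List.mem_reverse, List.mem_singleton, List.isChain_singleton,
    List.getLast?_reverse, List.head?_cons, Option.mem_def, true_and, Option.some.injEq]
  constructor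
  · rintro ⟨h1, h2, h3⟩
    exact ⟨⟨fun c hc => h1 c (Or.inl hc), h2⟩, h1 b (Or.inr rfl), fun c hc => h3 c hc b rfl⟩
  · rintro ⟨⟨h1, h2⟩, h3, h4⟩
    refine ⟨?_, h2, ?_⟩
    · rintro c (hc | rfl)
      · exact h1 c hc
      · exact h3
    · rintro c hc _ rfl
      exact h4 c hc

/-- Normal forms, with the last block first. -/
abbrev RevNF (p q : ℕ) : Type := {x : List (ℕ × Bool) × ℤ // RevAdm p q x.1}

/-- The result of right multiplication by `t` or `t⁻¹`. -/
def bsOp (p q : ℕ) (b : Bool) (x : List (ℕ × Bool) × ℤ) : List (ℕ × Bool) × ℤ :=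
  if (∃ c ∈ x.1.head?, c.2 = !b) ∧ x.2 % bsN p q b = 0 then
    (x.1.tail, (x.1.headD (0, b)).1 + bsN p q (!b) * (x.2 / bsN p q b))
  else (((x.2 % bsN p q b).toNat, b) :: x.1, bsN p q (!b) * (x.2 / bsN p q b))

/-- Write `N = bsN p q b` and `N' = bsN p q (!b)`; the relation of the group says `a^(N s) t^ε = t^ε
a^(N' s)`. Hence a final `t^{-ε}` cancels and the exponent `w` before it is set free. -/
theorem bsOp_cancel {b : Bool} {w : ℕ} {l : List (ℕ × Bool)} {s : ℤ} (hb : bsN p q b ≠ 0) :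
    bsOp p q b ((w, !b) :: l, bsN p q b * s) = (l, w + bsN p q (!b) * s) := by
  have : (bsN p q b : ℤ) ≠ 0 := by exact_mod_cast hb
  simp [bsOp, Int.mul_ediv_cancel_left _ this]

/-- Division with remainder by `N = bsN p q b`: the multiple of `N` passes through `t^ε` and the
remainder `r` stays in the new block. The hypothesis on the head excludes the case of cancellation.
-/
theorem bsOp_append {b : Bool} {l : List (ℕ × Bool)} {r : ℕ} {s : ℤ} (hr : r < bsN p q b)
    (h : ∀ c ∈ l.head?, ¬ (r = 0 ∧ b = !c.2)) :
    bsOp p q b (l, r + bsN p q b * s) = ((r, b) :: l, bsN p q (!b) * s) := by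
  have h0 : (bsN p q b : ℤ) ≠ 0 := by exact_mod_cast (by omega : bsN p q b ≠ 0)
  have h1 : ((r : ℤ) + bsN p q b * s) % bsN p q b = r := by
    rw [Int.add_mul_emod_self_left]
    exact Int.emod_eq_of_lt (by omega) (by omega)
  have h2 : ((r : ℤ) + bsN p q b * s) / bsN p q b = s := by
    rw [Int.add_mul_ediv_left _ _ h0, Int.ediv_eq_zero_of_lt (by omega) (by omega), zero_add]
  unfold bsOp
  dsimp only
  rw [h1, h2, if_neg, Int.toNat_natCast]
  rintro ⟨⟨c, hc, h3⟩, h4⟩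
  exact h c hc ⟨by exact_mod_cast h4, by rw [h3, Bool.not_not]⟩

/-- Each state is of one of the two forms above. -/
theorem bsOp_cases (hp : 1 ≤ p) (hq : 1 ≤ q) (b : Bool) (x : List (ℕ × Bool) × ℤ) :
    (∃ (w : ℕ) (l : List (ℕ × Bool)) (s : ℤ), x = ((w, !b) :: l, (bsN p q b : ℤ) * s)) ∨
      ∃ (l : List (ℕ × Bool)) (r : ℕ) (s : ℤ), x = (l, (r : ℤ) + bsN p q b * s) ∧ r < bsN p q b ∧
        ∀ c ∈ l.head?, ¬ (r = 0 ∧ b = !c.2) := by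
  obtain ⟨l, m⟩ := x
  have hb : 1 ≤ bsN p q b := by unfold bsN; split_ifs <;> assumption
  have hm := Int.emod_add_mul_ediv m (bsN p q b)
  have h0 := Int.emod_nonneg m (b := bsN p q b) (by omega)
  have h1 := Int.emod_lt_of_pos m (b := bsN p q b) (by omega)
  by_cases h : ∀ c ∈ l.head?, ¬ (m % bsN p q b = 0 ∧ b = !c.2)
  · right
    refine ⟨l, (m % bsN p q b).toNat, m / bsN p q b, ?_, by omega, fun c hc h2 => h c hc ⟨?_, h2.2⟩⟩
    · rw [Int.toNat_of_nonneg h0, hm]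
    · omega
  · left
    push Not at h
    obtain ⟨⟨w, d⟩, hc, h2, h3⟩ := h
    dsimp only at h3
    subst h3
    cases l with
    | nil => simp at hc
    | cons a l =>
      obtain rfl : a = (w, d) := by simpa using hc
      refine ⟨w, l, m / bsN p q !d, ?_⟩
      rw [Bool.not_not]
      rw [h2, zero_add] at hm
      rw [hm]

theorem bsOp_adm (hp : 1 ≤ p) (hq : 1 ≤ q) (b : Bool) {x : List (ℕ × Bool) × ℤ}
    (hx : RevAdm p q x.1) : RevAdm p q (bsOp p q b x).1 := by
  have hb : bsN p q b ≠ 0 := by unfold bsN; split_ifs <;> omega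
  rcases bsOp_cases hp hq b x with ⟨w, l, s, rfl⟩ | ⟨l, r, s, rfl, hr, h⟩
  · rw [bsOp_cancel hb]
    exact (revAdm_cons.1 hx).1
  · rw [bsOp_append hr h]
    exact revAdm_cons.2 ⟨hx, hr, h⟩

/-- Appending a block and cancelling it are inverse to each other: admissibility of the block that
was cancelled is exactly the condition under which it is put back. -/
theorem bsOp_bsOp (hp : 1 ≤ p) (hq : 1 ≤ q) (b : Bool) {x : List (ℕ × Bool) × ℤ}
    (hx : RevAdm p q x.1) : bsOp p q (!b) (bsOp p q b x) = x := by
  have hb : ∀ b, bsN p q b ≠ 0 := by intro b; unfold bsN; split_ifs <;> omega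
  rcases bsOp_cases hp hq b x with ⟨w, l, s, rfl⟩ | ⟨l, r, s, rfl, hr, h⟩
  · obtain ⟨-, h1, h2⟩ := revAdm_cons.1 hx
    rw [bsOp_cancel (hb b), bsOp_append h1 h2, Bool.not_not]
  · rw [bsOp_append hr h]
    have := bsOp_cancel (w := r) (l := l) (s := s) (hb (!b))
    rw [Bool.not_not] at this
    exact this

/-- Right multiplication by `t`, as a permutation of the normal forms. -/
def bsPermT (hp : 1 ≤ p) (hq : 1 ≤ q) : Equiv.Perm (RevNF p q) where
  toFun x := ⟨bsOp p q true x.1, bsOp_adm hp hq true x.2⟩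
  invFun x := ⟨bsOp p q false x.1, bsOp_adm hp hq false x.2⟩
  left_inv x := Subtype.ext (bsOp_bsOp hp hq true x.2)
  right_inv x := Subtype.ext (bsOp_bsOp hp hq false x.2)

/-- Right multiplication by `a`, as a permutation of the normal forms. -/
def bsPermA (p q : ℕ) : Equiv.Perm (RevNF p q) where
  toFun x := ⟨(x.1.1, x.1.2 + 1), x.2⟩
  invFun x := ⟨(x.1.1, x.1.2 - 1), x.2⟩
  left_inv x := by simp
  right_inv x := by simp

theorem bsPermA_zpow (k : ℤ) (x : RevNF p q) :
    (bsPermA p q ^ k) x = ⟨(x.1.1, x.1.2 + k), x.2⟩ := by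
  have h : ∀ (n : ℕ) (x : RevNF p q), (bsPermA p q ^ n) x = ⟨(x.1.1, x.1.2 + n), x.2⟩ := by
    intro n x
    induction n with
    | zero => simp
    | succ n ih =>
      rw [pow_succ', Equiv.Perm.mul_apply, ih]
      refine Subtype.ext (Prod.ext rfl ?_)
      change x.1.2 + n + 1 = x.1.2 + (n + 1 : ℕ)
      push_cast; ring
  rcases k with k | k
  · rw [Int.ofNat_eq_natCast, zpow_natCast, h]
  · rw [zpow_negSucc, Equiv.Perm.inv_eq_iff_eq, h]
    refine Subtype.ext (Prod.ext rfl ?_)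
    change x.1.2 = x.1.2 + Int.negSucc k + (k + 1 : ℕ)
    omega

/-- Permutations compose from right to left, so for the right action this is `t a^p = a^q t`. Both
sides agree because adding `q` to the exponent raises the quotient `s` by one and leaves the
remainder unchanged. -/
theorem bsPerm_rel (hp : 1 ≤ p) (hq : 1 ≤ q) :
    bsPermA p q ^ p * bsPermT hp hq = bsPermT hp hq * bsPermA p q ^ q := by
  ext1 x
  rw [Equiv.Perm.mul_apply, Equiv.Perm.mul_apply, ← zpow_natCast, ← zpow_natCast,
    bsPermA_zpow, bsPermA_zpow]
  refine Subtype.ext ?_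
  obtain ⟨x, hx⟩ := x
  change ((bsOp p q true x).1, (bsOp p q true x).2 + p) = bsOp p q true (x.1, x.2 + q)
  have hb : ∀ b, bsN p q b ≠ 0 := by intro b; unfold bsN; split_ifs <;> omega
  rcases bsOp_cases hp hq true x with ⟨w, l, s, rfl⟩ | ⟨l, r, s, rfl, hr, h⟩
  · have : (bsN p q true : ℤ) * s + q = bsN p q true * (s + 1) := by simp [bsN]; ring
    dsimp only
    rw [this, bsOp_cancel (hb true), bsOp_cancel (hb true)]
    simp [bsN]; ring
  · have : (r : ℤ) + bsN p q true * s + q = r + bsN p q true * (s + 1) := by simp [bsN]; ring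
    dsimp only
    rw [this, bsOp_append hr h, bsOp_append hr h]
    simp [bsN]; ring

/-- The right action of `BS(p, q)` on the normal forms. -/
def bsHom (hp : 1 ≤ p) (hq : 1 ≤ q) : BS p q →* (Equiv.Perm (RevNF p q))ᵐᵒᵖ :=
  PresentedGroup.toGroup (f := ![MulOpposite.op (bsPermA p q), MulOpposite.op (bsPermT hp hq)])
    (by
      rintro r rfl
      simp only [map_mul, map_pow, map_inv, FreeGroup.lift_apply_of, Matrix.cons_val]
      rw [mul_inv_eq_one, mul_inv_eq_iff_eq_mul]
      rw [← MulOpposite.op_pow, ← MulOpposite.op_pow, ← MulOpposite.op_mul, ← MulOpposite.op_mul,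
        bsPerm_rel])

/-- The right action of `BS(p, q)` on the normal forms. -/
def bsAct (hp : 1 ≤ p) (hq : 1 ≤ q) (g : BS p q) (x : RevNF p q) : RevNF p q :=
  (bsHom hp hq g).unop x

theorem bsAct_mul (hp : 1 ≤ p) (hq : 1 ≤ q) (g h : BS p q) (x : RevNF p q) :
    bsAct hp hq (g * h) x = bsAct hp hq h (bsAct hp hq g x) := by
  unfold bsAct
  rw [map_mul, MulOpposite.unop_mul, Equiv.Perm.mul_apply]

theorem bsAct_a (hp : 1 ≤ p) (hq : 1 ≤ q) (k : ℤ) (x : RevNF p q) :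
    bsAct hp hq (bsA p q ^ k) x = ⟨(x.1.1, x.1.2 + k), x.2⟩ := by
  unfold bsAct
  rw [map_zpow, MulOpposite.unop_zpow]
  have : bsHom hp hq (bsA p q) = MulOpposite.op (bsPermA p q) :=
    PresentedGroup.toGroup.of ..
  rw [this, MulOpposite.unop_op, bsPermA_zpow]

/-- The element `t` or `t⁻¹`. -/
def bsTt (p q : ℕ) (b : Bool) : BS p q := if b then bsT p q else (bsT p q)⁻¹

theorem bsAct_t (hp : 1 ≤ p) (hq : 1 ≤ q) (b : Bool) (x : RevNF p q) :
    bsAct hp hq (bsTt p q b) x = ⟨bsOp p q b x.1, bsOp_adm hp hq b x.2⟩ := by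
  have : bsHom hp hq (bsT p q) = MulOpposite.op (bsPermT hp hq) :=
    PresentedGroup.toGroup.of ..
  unfold bsAct bsTt
  cases b
  · simp only [Bool.false_eq_true, if_false]
    rw [map_inv, MulOpposite.unop_inv, this]; rfl
  · simp only [if_true]
    rw [this]; rfl

/-- The group element of a normal form, with the last block first. -/
def revVal (p q : ℕ) (x : List (ℕ × Bool) × ℤ) : BS p q :=
  (x.1.reverse.map fun b => bsA p q ^ b.1 * bsTt p q b.2).prod * bsA p q ^ x.2

theorem revVal_cons (b : ℕ × Bool) (l : List (ℕ × Bool)) (m : ℤ) :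
    revVal p q (b :: l, m) = revVal p q (l, (b.1 : ℤ)) * bsTt p q b.2 * bsA p q ^ m := by
  unfold revVal
  simp only [List.reverse_cons, List.map_append, List.map_singleton, List.prod_append,
    List.prod_singleton, zpow_natCast, mul_assoc]

theorem revVal_add (l : List (ℕ × Bool)) (m m' : ℤ) :
    revVal p q (l, m + m') = revVal p q (l, m) * bsA p q ^ m' := by
  unfold revVal
  rw [mul_assoc, ← _root_.zpow_add]

/-- Acting on the empty normal form rebuilds the blocks one after the other; admissibility
guarantees that nothing cancels on the way. -/
theorem bsAct_revVal (hp : 1 ≤ p) (hq : 1 ≤ q) (x : RevNF p q) :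
    bsAct hp hq (revVal p q x.1) ⟨([], 0), revAdm_nil⟩ = x := by
  obtain ⟨⟨l, m⟩, hx⟩ := x
  induction l generalizing m with
  | nil =>
    have : revVal p q ([], m) = bsA p q ^ m := by simp [revVal]
    dsimp only
    rw [this, bsAct_a]
    simp
  | cons b l ih =>
    obtain ⟨h1, h2, h3⟩ := revAdm_cons.1 hx
    dsimp only at h1 ih ⊢
    rw [revVal_cons, bsAct_mul, bsAct_mul, ih _ h1, bsAct_t, bsAct_a]
    have := bsOp_append (s := 0) h2 h3
    rw [mul_zero, mul_zero, add_zero] at this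
    refine Subtype.ext ?_
    dsimp only
    rw [this]
    simp

theorem bs_relation (p q : ℕ) : bsT p q * bsA p q ^ p * (bsT p q)⁻¹ = bsA p q ^ q := by
  have : PresentedGroup.mk (bsRels p q) (FreeGroup.of 1 * FreeGroup.of 0 ^ p * (FreeGroup.of 1)⁻¹ *
      (FreeGroup.of 0 ^ q)⁻¹) = 1 :=
    PresentedGroup.one_of_mem (Set.mem_singleton _)
  rw [map_mul, map_inv, mul_inv_eq_one] at this
  simp only [map_mul, map_pow, map_inv] at this
  exact this

theorem bsA_zpow_mul_bsTt (b : Bool) (s : ℤ) :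
    bsA p q ^ (bsN p q b * s) * bsTt p q b = bsTt p q b * bsA p q ^ (bsN p q (!b) * s) := by
  have h : bsA p q ^ ((q : ℤ) * s) * bsT p q = bsT p q * bsA p q ^ ((p : ℤ) * s) := by
    rw [_root_.zpow_mul, zpow_natCast, ← bs_relation, conj_zpow, inv_mul_cancel_right, _root_.zpow_mul,
      zpow_natCast]
  cases b
  · simp only [bsN, bsTt, Bool.false_eq_true, if_false, Bool.not_false, if_true]
    rw [mul_inv_eq_iff_eq_mul, mul_assoc, h, inv_mul_cancel_left]
  · simpa [bsN, bsTt] using h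

theorem bsTt_mul_not (b : Bool) : bsTt p q (!b) * bsTt p q b = 1 := by
  cases b <;> simp [bsTt]

theorem revVal_bsOp (hp : 1 ≤ p) (hq : 1 ≤ q) (b : Bool) (x : List (ℕ × Bool) × ℤ) :
    revVal p q (bsOp p q b x) = revVal p q x * bsTt p q b := by
  have hb : ∀ b, bsN p q b ≠ 0 := by intro b; unfold bsN; split_ifs <;> omega
  rcases bsOp_cases hp hq b x with ⟨w, l, s, rfl⟩ | ⟨l, r, s, rfl, hr, h⟩
  · rw [bsOp_cancel (hb b), revVal_cons, mul_assoc, bsA_zpow_mul_bsTt, mul_assoc,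
      ← mul_assoc (bsTt p q _), bsTt_mul_not, one_mul, revVal_add]
  · rw [bsOp_append hr h, revVal_cons, mul_assoc, ← bsA_zpow_mul_bsTt, ← mul_assoc, ← revVal_add]

theorem closure_bs (p q : ℕ) : Subgroup.closure {bsA p q, bsT p q} = ⊤ := by
  rw [← PresentedGroup.closure_range_of (bsRels p q)]
  congr 1
  ext g
  constructor
  · rintro (rfl | rfl)
    · exact ⟨0, rfl⟩
    · exact ⟨1, rfl⟩
  · rintro ⟨i, rfl⟩
    fin_cases i
    · exact Or.inl rfl
    · exact Or.inr rfl

theorem revVal_bsAct (hp : 1 ≤ p) (hq : 1 ≤ q) (g : BS p q) (x : RevNF p q) :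
    revVal p q (bsAct hp hq g x).1 = revVal p q x.1 * g := by
  have hg : g ∈ Subgroup.closure {bsA p q, bsT p q} := by rw [closure_bs]; trivial
  induction hg using Subgroup.closure_induction generalizing x with
  | mem g hg =>
    rcases hg with rfl | rfl
    · have := bsAct_a hp hq 1 x
      rw [zpow_one] at this
      rw [this, revVal_add, zpow_one]
    · have h1 := bsAct_t hp hq true x
      have h2 := revVal_bsOp hp hq true x.1
      simp only [bsTt, if_true] at h1 h2
      rw [h1, h2]
  | one => simp [bsAct]
  | mul g h _ _ ihg ihh => rw [bsAct_mul, ihh, ihg, mul_assoc]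
  | inv g _ ih =>
    have h1 : bsAct hp hq g (bsAct hp hq g⁻¹ x) = x := by
      rw [← bsAct_mul, inv_mul_cancel]; simp [bsAct]
    have h2 := ih (bsAct hp hq g⁻¹ x)
    rw [h1] at h2
    rw [h2, mul_inv_cancel_right]

/-- Uniqueness: the action recovers a normal form from its group element. Existence: the action
realizes right multiplication, so applying `g` to the empty normal form gives a normal form of `g`.
-/
theorem revVal_bijective (hp : 1 ≤ p) (hq : 1 ≤ q) :
    Function.Bijective fun x : RevNF p q => revVal p q x.1 := by
  constructor
  · intro x y h
    rw [← bsAct_revVal hp hq x, ← bsAct_revVal hp hq y]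
    dsimp only at h
    rw [h]
  · intro g
    refine ⟨bsAct hp hq g ⟨([], 0), revAdm_nil⟩, ?_⟩
    dsimp only
    rw [revVal_bsAct]
    simp [revVal]

end BaumslagSolitar

/-! ### Signed `q`-ary representations and affine relations between them -/

section Qary

variable {q : ℕ}

/-- The string of digits of a natural number. -/
def digStr (q : ℕ) (hq : 1 < q) (n : ℕ) : List (BSLetter q) :=
  (Nat.digits q n).pmap (fun d h => .digit ⟨d, h⟩) (fun _ hd => Nat.digits_lt_base hq hd)

/-- The value of a digit. -/
def letVal : BSLetter q → ℤ
  | .digit d => (d : ℕ)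
  | _ => 0

theorem digVal_pmap (L : List ℕ) (h : ∀ d ∈ L, d < q) :
    digVal q letVal (L.pmap (fun d h => (.digit ⟨d, h⟩ : BSLetter q)) h) = Nat.ofDigits q L := by
  induction L with
  | nil => rfl
  | cons d L ih =>
    rw [List.pmap_cons, digVal, ih, Nat.ofDigits_cons]
    simp [letVal]

theorem digVal_digStr (hq : 1 < q) (n : ℕ) : digVal q letVal (digStr q hq n) = n := by
  rw [digStr, digVal_pmap, Nat.ofDigits_digits]

theorem digStr_injective (hq : 1 < q) : Function.Injective (digStr q hq) := by
  intro m n h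
  have := congrArg (digVal q letVal) h
  rw [digVal_digStr, digVal_digStr] at this
  exact_mod_cast this

theorem pmap_digit {L : List ℕ} {D : List (Fin q)} (e : L = D.map Fin.val)
    (h : ∀ d ∈ L, d < q) :
    L.pmap (fun d h => (.digit ⟨d, h⟩ : BSLetter q)) h = D.map .digit := by
  subst e
  rw [List.pmap_map, List.pmap_eq_map]

theorem exists_digStr_iff (hq : 1 < q) (w : List (BSLetter q)) : (∃ n, digStr q hq n = w) ↔
    (∀ c ∈ w, ∃ d, c = .digit d) ∧ ∀ d : Fin q, (d : ℕ) = 0 → w.getLast? ≠ some (.digit d) := by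
  constructor
  · rintro ⟨n, rfl⟩
    obtain ⟨D, hD⟩ : ∃ D : List (Fin q), Nat.digits q n = D.map Fin.val :=
      ⟨(Nat.digits q n).pmap Fin.mk fun _ hd => Nat.digits_lt_base hq hd, by
        rw [List.map_pmap]; simp⟩
    rw [digStr, pmap_digit hD]
    constructor
    · intro c hc
      obtain ⟨d, -, rfl⟩ := List.mem_map.1 hc
      exact ⟨_, rfl⟩
    · intro d hd h
      rw [List.getLast?_map] at h
      obtain ⟨d', h', e⟩ := Option.map_eq_some_iff.1 h
      obtain rfl := BSLetter.digit.inj e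
      have hn : n ≠ 0 := by
        rintro rfl
        rw [Nat.digits_zero, eq_comm, List.map_eq_nil_iff] at hD
        simp [hD] at h'
      refine Nat.getLast_digit_ne_zero q hn ?_
      have : (Nat.digits q n).getLast? = some 0 := by
        rw [hD, List.getLast?_map, h', ← hd]
        rfl
      rw [List.getLast?_eq_some_getLast (Nat.digits_ne_nil_iff_ne_zero.2 hn)] at this
      exact Option.some.inj this
  · rintro ⟨h1, h2⟩
    have : ∃ D : List (Fin q), w = D.map .digit := by
      clear h2
      induction w with
      | nil => exact ⟨[], rfl⟩
      | cons c w ih =>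
        obtain ⟨D, rfl⟩ := ih fun b hb => h1 b (List.mem_cons_of_mem _ hb)
        obtain ⟨d, rfl⟩ := h1 c List.mem_cons_self
        exact ⟨d :: D, rfl⟩
    obtain ⟨D, rfl⟩ := this
    refine ⟨Nat.ofDigits q (D.map Fin.val), pmap_digit (Nat.digits_ofDigits q hq _ ?_ ?_) _⟩
    · intro l hl
      obtain ⟨d, -, rfl⟩ := List.mem_map.1 hl
      exact d.2
    · intro hne h0
      have hD : D ≠ [] := by rintro rfl; simp at hne
      rw [List.getLast_map hne] at h0
      refine h2 _ h0 ?_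
      rw [List.getLast?_map, List.getLast?_eq_some_getLast hD]
      rfl

theorem reg_digStr (hq : 1 < q) : Reg fun w => ∃ n, digStr q hq n = w :=
  ((reg_mem_list fun c : BSLetter q => ∃ d, c = .digit d).and
    (reg_getLast? fun o => ∀ d : Fin q, (d : ℕ) = 0 → o ≠ some (.digit d))).congr
    (exists_digStr_iff hq)

/-- The sign of an integer, where `true` stands for negative integers. -/
def sgn (σ : Bool) : ℤ := if σ then -1 else 1

/-- The string of a sign. -/
def sgnStr (q : ℕ) (σ : Bool) : List (BSLetter q) := if σ then [.minus] else []

theorem qary_sgn (hq : 1 < q) (σ : Bool) (n : ℕ) (h : σ = true → n ≠ 0) :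
    qary q hq (sgn σ * n) = sgnStr q σ ++ digStr q hq n := by
  unfold qary sgn sgnStr digStr
  cases σ
  · simp
  · have := h rfl
    have h1 : -(n : ℤ) < 0 := by omega
    simp only [if_true, neg_one_mul, h1, Int.natAbs_neg, Int.natAbs_natCast]

theorem exists_sgn (m : ℤ) : ∃ σ n, (σ = true → n ≠ 0) ∧ m = sgn σ * (n : ℕ) := by
  by_cases h : m < 0
  · exact ⟨true, m.natAbs, fun _ => by omega, by rw [sgn, if_pos rfl]; omega⟩
  · exact ⟨false, m.natAbs, fun h => by simp at h, by rw [sgn, if_neg (by simp)]; omega⟩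

theorem reg_qary (hq : 1 < q) : Reg fun w => ∃ m, qary q hq m = w := by
  refine (Reg.exists fun σ : Bool => (reg_eq (sgnStr q σ)).append
    ((reg_digStr hq).and (((reg_const (σ = true)).not).or (reg_eq (digStr q hq 0)).not))).congr
    fun z => ?_
  constructor
  · rintro ⟨m, rfl⟩
    obtain ⟨σ, n, h, rfl⟩ := exists_sgn m
    refine ⟨σ, _, _, rfl, ⟨⟨n, rfl⟩, ?_⟩, (qary_sgn hq σ n h).symm⟩
    by_cases hσ : σ = true
    · exact Or.inr fun e => h hσ (digStr_injective hq e)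
    · exact Or.inl hσ
  · rintro ⟨σ, _, _, rfl, ⟨⟨n, rfl⟩, h⟩, rfl⟩
    refine ⟨sgn σ * n, qary_sgn hq σ n ?_⟩
    rintro hσ rfl
    exact h.elim (fun h => h hσ) fun h => h rfl

theorem fa_digStr (hq : 1 < q) (A B C r : ℤ) : FA fun x y => ∃ n n' : ℕ, x = digStr q hq n ∧
    y = digStr q hq n' ∧ A * n + B * n' = C ∧ (q : ℤ) ∣ n - r := by
  have : NeZero q := ⟨by omega⟩
  refine ((fa_linear q hq letVal letVal A B C).and (FA.prod ((reg_digStr hq).and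
    (reg_digVal_dvd q letVal q r)) (reg_digStr hq))).congr fun x y => ?_
  constructor
  · rintro ⟨n, n', rfl, rfl, h1, h2⟩
    refine ⟨?_, ⟨⟨n, rfl⟩, ?_⟩, n', rfl⟩
    · rwa [digVal_digStr, digVal_digStr]
    · rwa [digVal_digStr]
  · rintro ⟨h1, ⟨⟨n, rfl⟩, h2⟩, n', rfl⟩
    rw [digVal_digStr] at h1 h2
    rw [digVal_digStr] at h1
    exact ⟨n, n', rfl, rfl, h1, h2⟩

/-- The two signs may differ and displace the digits, so they are split off as a pair of fixed
strings with `synch_singleton`. What remains is a linear equation for the absolute values with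
coefficients `± A` and `± B`, where a negative sign before zero is excluded. -/
theorem fa_qary (hq : 1 < q) (A B C r : ℤ) : FA fun x y => ∃ m m' : ℤ, x = qary q hq m ∧
    y = qary q hq m' ∧ A * m + B * m' = C ∧ (q : ℤ) ∣ m - r := by
  have key := fun σ σ' : Bool => synch_singleton (sgnStr q σ) (sgnStr q σ') _
    ((fa_digStr hq (A * sgn σ) (B * sgn σ') C (sgn σ * r)).and (FA.prod
      (((reg_const (σ = true)).not).or (reg_eq (digStr q hq 0)).not)
      (((reg_const (σ' = true)).not).or (reg_eq (digStr q hq 0)).not)))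
  refine (FA.exists fun σ : Bool => FA.exists fun σ' : Bool => key σ σ').congr fun x y => ?_
  have hσ : ∀ σ, sgn σ * sgn σ = 1 := by intro σ; cases σ <;> rfl
  have hdvd : ∀ (σ : Bool) (n : ℕ), (q : ℤ) ∣ sgn σ * n - r ↔ (q : ℤ) ∣ n - sgn σ * r := by
    intro σ n
    have e : sgn σ * n - r = sgn σ * (n - sgn σ * r) := by
      rw [mul_sub, ← mul_assoc, hσ, one_mul]
    rw [e]
    cases σ
    · rw [sgn, if_neg (by simp), one_mul]
    · rw [sgn, if_pos rfl, neg_one_mul (_ - _), dvd_neg]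
  have hne : ∀ (σ : Bool) (n : ℕ), (σ = true → n ≠ 0) ↔
      ¬ σ = true ∨ ¬ digStr q hq n = digStr q hq 0 := by
    intro σ n
    rw [(digStr_injective hq).eq_iff]
    tauto
  constructor
  · rintro ⟨m, m', rfl, rfl, h1, h2⟩
    obtain ⟨σ, n, h, rfl⟩ := exists_sgn m
    obtain ⟨σ', n', h', rfl⟩ := exists_sgn m'
    refine ⟨σ, σ', _, _, _, _, ⟨rfl, rfl⟩, ⟨⟨n, n', rfl, rfl, by linarith, (hdvd _ _).1 h2⟩,
      (hne _ _).1 h, (hne _ _).1 h'⟩, qary_sgn hq σ n h, qary_sgn hq σ' n' h'⟩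
  · rintro ⟨σ, σ', _, _, _, _, ⟨rfl, rfl⟩, ⟨⟨n, n', rfl, rfl, h1, h2⟩, h3, h4⟩, rfl, rfl⟩
    exact ⟨sgn σ * n, sgn σ' * n', (qary_sgn hq σ n ((hne _ _).2 h3)).symm,
      (qary_sgn hq σ' n' ((hne _ _).2 h4)).symm, by linarith, (hdvd _ _).2 h2⟩

/-- Eliminating `s` from `m = r + q s` and `m' = w + p s` leaves the equation `p m - q m' = p r - q
w` and the congruence of `m` to `r` modulo `q`. -/
theorem fa_qary_affine (hq : 1 < q) (p : ℕ) (r w : ℤ) : FA fun x y => ∃ s : ℤ,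
    x = qary q hq (r + q * s) ∧ y = qary q hq (w + p * s) := by
  refine (fa_qary hq p (-q) (p * r - q * w) r).congr fun x y => ?_
  constructor
  · rintro ⟨s, rfl, rfl⟩
    exact ⟨_, _, rfl, rfl, by ring, ⟨s, by ring⟩⟩
  · rintro ⟨m, m', rfl, rfl, h, s, hs⟩
    obtain rfl : m = r + q * s := by linarith
    have hq0 : (q : ℤ) ≠ 0 := by omega
    have : m' = w + p * s := mul_left_cancel₀ hq0 (by linarith)
    exact ⟨s, rfl, by rw [this]⟩

theorem fa_qary_succ (hq : 1 < q) : FA fun x y => ∃ m : ℤ,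
    x = qary q hq m ∧ y = qary q hq (m + 1) := by
  -- The congruence built into `fa_qary` becomes void in the union over all residues.
  refine (FA.exists fun r : Fin q => fa_qary hq 1 (-1) (-1) (r : ℕ)).congr fun x y => ?_
  constructor
  · rintro ⟨m, rfl, rfl⟩
    have h0 := Int.emod_nonneg m (b := q) (by omega)
    have h1 := Int.emod_lt_of_pos m (b := q) (by omega)
    refine ⟨⟨(m % q).toNat, by omega⟩, m, m + 1, rfl, rfl, by ring, ?_⟩
    simp only [Int.toNat_of_nonneg h0]
    exact Int.dvd_self_sub_emod
  · rintro ⟨r, m, m', rfl, rfl, h, -⟩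
    exact ⟨m, rfl, by rw [show m' = m + 1 by linarith]⟩

theorem mem_qary (hq : 1 < q) {m : ℤ} {c : BSLetter q} (h : c ∈ qary q hq m) :
    c = .minus ∨ ∃ d, c = .digit d := by
  obtain ⟨σ, n, hn, rfl⟩ := exists_sgn m
  rw [qary_sgn hq σ n hn, List.mem_append] at h
  rcases h with h | h
  · left
    unfold sgnStr at h
    split_ifs at h
    · simpa using h
    · simp at h
  · exact Or.inr (((exists_digStr_iff hq _).1 ⟨n, rfl⟩).1 c h)

theorem qary_injective (hq : 1 < q) : Function.Injective (qary q hq) := by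
  intro m m' h
  obtain ⟨σ, n, hn, rfl⟩ := exists_sgn m
  obtain ⟨σ', n', hn', rfl⟩ := exists_sgn m'
  rw [qary_sgn hq σ n hn, qary_sgn hq σ' n' hn'] at h
  have hd : ∀ n, ∀ c ∈ (digStr q hq n).head?, ¬ decide (c = BSLetter.minus) = true := by
    intro n c hc
    obtain ⟨d, rfl⟩ := ((exists_digStr_iff hq _).1 ⟨n, rfl⟩).1 c (List.mem_of_mem_head? hc)
    simp
  have hs : ∀ σ, ∀ c ∈ sgnStr q σ, decide (c = BSLetter.minus) = true := by
    intro σ c hc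
    cases σ <;> simp [sgnStr] at hc ⊢
    exact hc
  obtain ⟨h1, h2⟩ := append_inj_of_prefix (hs σ) (hd n) (hs σ') (hd n') h
  rw [digStr_injective hq h2]
  congr 1
  cases σ <;> cases σ' <;> simp [sgnStr] at h1 ⊢

end Qary

/-! ### Strings with an encoded maximal prefix of the form `x^k` -/

section EncodePrefix

variable {α β : Type} {x : β} {e : ℕ → List α} {ι : β → α}

/-- A set of strings that only tests whether the maximal prefix of the form `x^k` is empty. -/
structure PrefixReg (x : β) (P : List β → Prop) : Prop where
  reg : Reg P
  iff w : P (x :: x :: w) ↔ P (x :: w)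

theorem PrefixReg.and {P Q : List β → Prop} (hP : PrefixReg x P) (hQ : PrefixReg x Q) :
    PrefixReg x fun z => P z ∧ Q z :=
  ⟨hP.reg.and hQ.reg, fun w => and_congr (hP.iff w) (hQ.iff w)⟩

theorem PrefixReg.replicate_iff {P : List β → Prop} (hP : PrefixReg x P) (n : ℕ) (w : List β) :
    P (List.replicate (n + 1) x ++ w) ↔ P (x :: w) := by
  induction n with
  | zero => rfl
  | succ n ih => rw [← ih]; exact hP.iff _

variable [DecidableEq β]

/-- The maximal prefix of the form `x^k` of a string is replaced by `e k`. -/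
def encPrefix (x : β) (e : ℕ → List α) (ι : β → α) (w : List β) : List α :=
  e (w.takeWhile fun y => decide (y = x)).length ++ (w.dropWhile fun y => decide (y = x)).map ι

theorem encPrefix_replicate_append (n : ℕ) {w : List β} (hw : ∀ a ∈ w.head?, a ≠ x) :
    encPrefix x e ι (List.replicate n x ++ w) = e n ++ w.map ι := by
  have h := takeWhile_append_of (p := fun y => decide (y = x)) (x := List.replicate n x) (y := w)
    (fun a ha => by simpa using List.eq_of_mem_replicate ha) (by simpa using hw)
  unfold encPrefix
  rw [h.1, h.2, List.length_replicate]

theorem exists_replicate_append (x : β) (w : List β) :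
    ∃ n v, w = List.replicate n x ++ v ∧ ∀ a ∈ v.head?, a ≠ x := by
  induction w with
  | nil => exact ⟨0, [], rfl, by simp⟩
  | cons b w ih =>
    by_cases hb : b = x
    · obtain ⟨n, v, rfl, hv⟩ := ih
      exact ⟨n + 1, v, by rw [hb, List.replicate_succ, List.cons_append], hv⟩
    · exact ⟨0, b :: w, rfl, by simpa using hb⟩

theorem encPrefix_append {w v : List β} (h : (∀ a ∈ v.head?, a ≠ x) ∨ ∃ a ∈ w, a ≠ x) :
    encPrefix x e ι (w ++ v) = encPrefix x e ι w ++ v.map ι := by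
  obtain ⟨n, w, rfl, hw⟩ := exists_replicate_append x w
  cases w with
  | nil =>
    have hv : ∀ a ∈ v.head?, a ≠ x := by
      refine h.resolve_right ?_
      rintro ⟨a, ha, hne⟩
      rw [List.append_nil] at ha
      exact hne (List.eq_of_mem_replicate ha)
    rw [encPrefix_replicate_append n hw, List.append_nil, encPrefix_replicate_append n hv]
    simp
  | cons b w =>
    have hw' : ∀ a ∈ (b :: w ++ v).head?, a ≠ x := hw
    rw [List.append_assoc, encPrefix_replicate_append n hw, encPrefix_replicate_append n hw',
      List.map_append, List.append_assoc]

theorem encPrefix_replicate (n : ℕ) : encPrefix x e ι (List.replicate n x) = e n := by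
  have := encPrefix_replicate_append (e := e) (ι := ι) n (w := []) (x := x) (by simp)
  simpa using this

/-- With the unary code nothing is changed; thus `ψ₀` is the special case of `encPrefix` in which
the exponent is encoded by itself. -/
theorem encPrefix_replicate_id (w : List β) :
    encPrefix x (fun n => List.replicate n x) id w = w := by
  obtain ⟨n, w, rfl, hw⟩ := exists_replicate_append x w
  rw [encPrefix_replicate_append n hw, List.map_id]

theorem replacePrefix_injective : Function.Injective (replacePrefix x) := by
  intro w w' h
  obtain ⟨n, w, rfl, hw⟩ := exists_replicate_append x w
  obtain ⟨n', w', rfl, hw'⟩ := exists_replicate_append x w'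
  rw [replacePrefix_replicate_append x n w hw, replacePrefix_replicate_append x n' w' hw'] at h
  have h1 : ∀ n, ∀ a ∈ uNew β n, a.isRight = true := by
    intro n a ha
    obtain ⟨c, -, rfl⟩ := List.mem_map.1 ha
    rfl
  have h2 : ∀ w : List β, ∀ a ∈ (old w).head?, ¬ a.isRight = true := by
    intro w a ha
    obtain ⟨c, -, rfl⟩ := List.mem_map.1 (List.mem_of_mem_head? ha)
    simp
  obtain ⟨h3, h4⟩ := append_inj_of_prefix (h1 n) (h2 w) (h1 n') (h2 w') h
  rw [uNew_injective h3, List.map_injective_iff.2 Sum.inl_injective h4]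

/-- Of a prefix `x^n` the property `P` sees only whether `n = 0`. So the tail has to be tested for
`n = 0` after the code `e 0`, and for `n = 1` after any other code. -/
theorem PrefixReg.reg_encPrefix [Finite β] {P : List β → Prop} (hP : PrefixReg x P)
    (he : IsCoder e) : Reg fun z => ∃ w, P w ∧ encPrefix x e ι w = z := by
  have hh := reg_head? fun o : Option β => ∀ a ∈ o, a ≠ x
  refine (((reg_eq (e 0)).append ((hP.reg.and hh).map ι)).or
    ((he.reg.and (reg_eq (e 0)).not).append
      (((hP.reg.left_quotient [x]).and hh).map ι))).congr fun z => ?_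
  constructor
  · rintro ⟨w, hw, rfl⟩
    obtain ⟨n, w, rfl, hw'⟩ := exists_replicate_append x w
    rw [encPrefix_replicate_append n hw']
    cases n with
    | zero => exact Or.inl ⟨_, _, rfl, ⟨w, ⟨hw, hw'⟩, rfl⟩, rfl⟩
    | succ n =>
      exact Or.inr ⟨_, _, ⟨⟨n + 1, rfl⟩, fun h => by simpa using he.injective h⟩,
        ⟨w, ⟨(hP.replicate_iff n w).1 hw, hw'⟩, rfl⟩, rfl⟩
  · rintro (⟨_, _, rfl, ⟨w, ⟨hw, hw'⟩, rfl⟩, rfl⟩ | ⟨_, _, ⟨⟨n, rfl⟩, hn⟩, ⟨w, ⟨hw, hw'⟩, rfl⟩, rfl⟩)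
    · exact ⟨w, hw, encPrefix_replicate_append 0 hw'⟩
    · cases n with
      | zero => exact absurd rfl hn
      | succ n =>
        exact ⟨_, (hP.replicate_iff n w).2 hw, encPrefix_replicate_append (n + 1) hw'⟩

end EncodePrefix

/-! ### Strings of blocks -/

section Blocks

variable {p q : ℕ}

/-- The letter of `t` or `t⁻¹`. -/
def tLetter (q : ℕ) (b : Bool) : BSLetter q := if b then .t else .tInv

theorem tLetter_injective : Function.Injective (tLetter q) := by
  intro b c h
  cases b <;> cases c <;> simp [tLetter] at h ⊢

theorem tLetter_ne_a (b : Bool) : tLetter q b ≠ .a := by cases b <;> simp [tLetter]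

/-- The string of a list of blocks. -/
def blockStr (q : ℕ) (l : List (ℕ × Bool)) : List (BSLetter q) :=
  (l.map (bsBlockString q)).flatten

theorem blockStr_cons (b : ℕ × Bool) (l : List (ℕ × Bool)) :
    blockStr q (b :: l) = List.replicate b.1 .a ++ tLetter q b.2 :: blockStr q l := by
  simp [blockStr, bsBlockString, tLetter]

theorem blockStr_eq {l : List (ℕ × Bool)} {n : ℕ} {c : BSLetter q} {z : List (BSLetter q)}
    (hc : c ≠ .a) (h : blockStr q l = List.replicate n .a ++ c :: z) :
    ∃ b l', l = (n, b) :: l' ∧ c = tLetter q b ∧ blockStr q l' = z := by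
  cases l with
  | nil => simp [blockStr] at h
  | cons b l =>
    rw [blockStr_cons] at h
    have hr : ∀ n, ∀ c ∈ List.replicate n (BSLetter.a : BSLetter q), decide (c = .a) = true :=
      fun n c hc => by simpa using List.eq_of_mem_replicate hc
    obtain ⟨h1, h2⟩ := append_inj_of_prefix (hr _) (by simpa using tLetter_ne_a b.2) (hr _)
      (by simpa using hc) h
    obtain rfl : b.1 = n := by simpa using congrArg List.length h1
    obtain ⟨h3, h4⟩ := List.cons_eq_cons.1 h2
    exact ⟨b.2, l, rfl, h3.symm, h4⟩

theorem blockStr_injective : Function.Injective (blockStr q) := by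
  intro l l' h
  induction l generalizing l' with
  | nil =>
    cases l' with
    | nil => rfl
    | cons b l' => rw [blockStr_cons] at h; simp [blockStr] at h
  | cons b l ih =>
    rw [blockStr_cons, eq_comm] at h
    obtain ⟨c, l', rfl, hc, h⟩ := blockStr_eq (tLetter_ne_a _) h
    rw [ih h.symm, ← tLetter_injective hc]

theorem mem_blockStr {l : List (ℕ × Bool)} {c : BSLetter q} (h : c ∈ blockStr q l) :
    c = .a ∨ ∃ b, c = tLetter q b := by
  induction l with
  | nil => simp [blockStr] at h
  | cons b l ih =>
    rw [blockStr_cons, List.mem_append, List.mem_cons] at h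
    rcases h with h | h | h
    · exact Or.inl (List.eq_of_mem_replicate h)
    · exact Or.inr ⟨_, h⟩
    · exact ih h

/-- Lists of blocks that are admissible after `t` (`some true`), `t⁻¹` (`some false`) or at the
beginning (`none`). -/
def AdmFrom (p q : ℕ) (o : Option Bool) (l : List (ℕ × Bool)) : Prop :=
  bsAdmissible p q l ∧ ∀ c ∈ l.head?, ¬ (c.1 = 0 ∧ o = some !c.2)

theorem admFrom_cons {o : Option Bool} {b : ℕ × Bool} {l : List (ℕ × Bool)} :
    AdmFrom p q o (b :: l) ↔
      (b.1 < bsN p q b.2 ∧ ¬ (b.1 = 0 ∧ o = some !b.2)) ∧ AdmFrom p q (some b.2) l := by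
  unfold AdmFrom bsAdmissible bsN
  rw [List.isChain_cons]
  have : ∀ c : ℕ × Bool, c.2 = (!b.2) ↔ some b.2 = some (!c.2) := by
    rintro ⟨_, c⟩
    cases c <;> cases b.2 <;> simp
  simp only [List.forall_mem_cons, List.head?_cons, Option.mem_def, Option.some.injEq, this,
    forall_eq']
  tauto

/-- The strings of the lists `l` with `AdmFrom p q o l`. -/
def Blk (p q : ℕ) (o : Option Bool) (w : List (BSLetter q)) : Prop :=
  ∃ l, AdmFrom p q o l ∧ blockStr q l = w

theorem blk_append_cons {o : Option Bool} {n : ℕ} {b : Bool} {z : List (BSLetter q)} :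
    Blk p q o (List.replicate n .a ++ tLetter q b :: z) ↔
      (n < bsN p q b ∧ ¬ (n = 0 ∧ o = some !b)) ∧ Blk p q (some b) z := by
  constructor
  · rintro ⟨l, hl, h⟩
    obtain ⟨c, l, rfl, hc, rfl⟩ := blockStr_eq (tLetter_ne_a _) h
    obtain rfl := tLetter_injective hc
    exact ⟨(admFrom_cons.1 hl).1, l, (admFrom_cons.1 hl).2, rfl⟩
  · rintro ⟨h, l, hl, rfl⟩
    exact ⟨(n, b) :: l, admFrom_cons.2 ⟨h, hl⟩, blockStr_cons _ _⟩

/-- Since `p < q`, every block has fewer than `q` letters `a`; so a counter up to `q` is enough for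
an automaton. -/
theorem not_blk_replicate_append (hpq : p < q) {o : Option Bool} {z : List (BSLetter q)} :
    ¬ Blk p q o (List.replicate (q + 1) .a ++ z) := by
  rintro ⟨l, hl, h⟩
  cases l with
  | nil => simp [blockStr, List.replicate_succ] at h
  | cons b l =>
    have hb : b.1 < q + 1 := by
      have := (admFrom_cons.1 hl).1.1
      unfold bsN at this
      split_ifs at this <;> omega
    rw [blockStr_cons] at h
    have h1 := congrArg (fun z => z[b.1]?) h
    rw [List.getElem?_append_right (by simp), List.getElem?_append_left (by simpa using hb)] at h1
    simp [hb] at h1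
    exact tLetter_ne_a _ h1

/-- A state consists of the last letter `t^{±1}` read, if any, and the number of letters `a` after
it; `none` is the state of failure. -/
theorem reg_blk (hpq : p < q) (o : Option Bool) : Reg (Blk p q o) := by
  refine (Reg.of_family (fun (i : Option (Option Bool × Fin (q + 1))) (z : List (BSLetter q)) =>
    ∃ s ∈ i, Blk p q s.1 (List.replicate (s.2 : ℕ) .a ++ z)) ?_ (some (o, 0))).congr fun z => by
      simp
  rintro (_ | ⟨o, n⟩) c
  · exact ⟨none, fun z => by simp⟩
  have key : ∀ b, ∃ j : Option (Option Bool × Fin (q + 1)), ∀ z : List (BSLetter q),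
      Blk p q o (List.replicate (n : ℕ) .a ++ tLetter q b :: z) ↔
        ∃ s ∈ j, Blk p q s.1 (List.replicate (s.2 : ℕ) .a ++ z) := by
    intro b
    by_cases h : (n : ℕ) < bsN p q b ∧ ¬ ((n : ℕ) = 0 ∧ o = some !b)
    · exact ⟨some (some b, 0), fun z => by rw [blk_append_cons, and_iff_right h]; simp⟩
    · exact ⟨none, fun z => by rw [blk_append_cons]; simp only [h, false_and]; simp⟩
  have key' : c ≠ .a → (∀ b, c ≠ tLetter q b) →
      ∃ j : Option (Option Bool × Fin (q + 1)), ∀ z : List (BSLetter q),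
      Blk p q o (List.replicate (n : ℕ) .a ++ c :: z) ↔
        ∃ s ∈ j, Blk p q s.1 (List.replicate (s.2 : ℕ) .a ++ z) := by
    intro h1 h2
    refine ⟨none, fun z => iff_of_false ?_ (by simp)⟩
    rintro ⟨l, -, h⟩
    obtain ⟨b, -, -, h, -⟩ := blockStr_eq h1 h
    exact h2 b h
  have red : ∀ w : List (BSLetter q), (∃ s ∈ some (o, n), Blk p q s.1
      (List.replicate (s.2 : ℕ) .a ++ w)) ↔ Blk p q o (List.replicate (n : ℕ) .a ++ w) := by
    simp
  simp only [red]
  cases c with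
  | a =>
    by_cases hn : (n : ℕ) = q
    · refine ⟨none, fun z => iff_of_false ?_ (by simp)⟩
      rw [hn, List.append_cons, ← List.replicate_succ']
      exact not_blk_replicate_append hpq
    · refine ⟨some (o, ⟨n + 1, by omega⟩), fun z => ?_⟩
      rw [List.append_cons, ← List.replicate_succ']
      simp
  | t => exact key true
  | tInv => exact key false
  | minus => exact key' (by simp) (fun b => by cases b <;> simp [tLetter])
  | digit d => exact key' (by simp) (fun b => by cases b <;> simp [tLetter])

/-- A letter `t` may always follow another `t`, and it leads to the same state. -/
theorem prefixReg_blk (hpq : p < q) : PrefixReg .t (Blk p q none) := by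
  refine ⟨reg_blk hpq none, fun w => ?_⟩
  have h := fun o (w : List (BSLetter q)) =>
    blk_append_cons (p := p) (o := o) (n := 0) (b := true) (z := w)
  simp only [List.replicate_zero, List.nil_append, tLetter, if_true] at h
  rw [h, h, h]
  simp

/-- The string of a list of blocks, the last block first. -/
def revStr (q : ℕ) (l : List (ℕ × Bool)) : List (BSLetter q) := blockStr q l.reverse

theorem revStr_injective : Function.Injective (revStr q) :=
  blockStr_injective.comp List.reverse_injective

theorem revStr_cons (b : ℕ × Bool) (l : List (ℕ × Bool)) :
    revStr q (b :: l) = revStr q l ++ (List.replicate b.1 .a ++ [tLetter q b.2]) := by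
  simp [revStr, blockStr, bsBlockString, tLetter]

theorem blk_none_iff (w : List (BSLetter q)) :
    Blk p q none w ↔ ∃ l, RevAdm p q l ∧ revStr q l = w := by
  constructor
  · rintro ⟨l, hl, rfl⟩
    exact ⟨l.reverse, by simpa [RevAdm] using hl.1, by simp [revStr]⟩
  · rintro ⟨l, hl, rfl⟩
    exact ⟨l.reverse, ⟨hl, by simp⟩, rfl⟩

theorem prefixReg_revStr (hpq : p < q) :
    PrefixReg .t fun w => ∃ l, RevAdm p q l ∧ revStr q l = w := by
  rw [← funext fun w => propext (blk_none_iff w)]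
  exact prefixReg_blk hpq

/-- The block `b` may be attached to `l` iff the strings without and with the block both belong to
the language. The second condition is a right quotient, which does not affect the test at the
beginning of the string. -/
theorem prefixReg_revStr_cons (hpq : p < q) (b : ℕ × Bool) :
    PrefixReg .t fun w => ∃ l, RevAdm p q (b :: l) ∧ revStr q l = w := by
  have h : ∀ w, (∃ l, RevAdm p q (b :: l) ∧ revStr q l = w) ↔ (∃ l, RevAdm p q l ∧ revStr q l = w) ∧
      ∃ l, RevAdm p q l ∧ revStr q l = w ++ (List.replicate b.1 .a ++ [tLetter q b.2]) := by
    intro w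
    constructor
    · rintro ⟨l, hl, rfl⟩
      exact ⟨⟨l, (revAdm_cons.1 hl).1, rfl⟩, b :: l, hl, revStr_cons b l⟩
    · rintro ⟨⟨l, hl, rfl⟩, l', hl', h⟩
      rw [← revStr_cons] at h
      rw [revStr_injective h] at hl'
      exact ⟨l, hl', rfl⟩
  have h0 := prefixReg_revStr (p := p) hpq
  refine ⟨(h0.reg.and (h0.reg.right_quotient _)).congr h, fun w => ?_⟩
  rw [h, h]
  exact and_congr (h0.iff w) (h0.iff _)

theorem revStr_replicate (n : ℕ) : revStr q (List.replicate n (0, true)) = List.replicate n .t := by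
  simp [revStr, blockStr, bsBlockString]

theorem revAdm_replicate (hq : 0 < q) (n : ℕ) : RevAdm p q (List.replicate n (0, true)) := by
  induction n with
  | zero => exact revAdm_nil
  | succ n ih =>
    refine revAdm_cons.2 ⟨ih, hq, fun c hc => ?_⟩
    rw [List.eq_of_mem_replicate (List.mem_of_mem_head? hc)]
    simp

end Blocks

/-! ### Baumslag-Solitar groups -/

section BaumslagSolitar

variable {p q : ℕ} {α : Type}

/-- The normal form with the given list of blocks, the last block first. -/
def RevNF.toNF (x : RevNF p q) : BSNormalForm p q := ⟨x.1.1.reverse, x.2, x.1.2⟩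

theorem exists_toNF (x : BSNormalForm p q) : ∃ y : RevNF p q, y.toNF = x := by
  obtain ⟨l, hl, m⟩ := x
  refine ⟨⟨(l.reverse, m), by rw [← List.reverse_reverse l] at hl; exact hl⟩, ?_⟩
  simp [RevNF.toNF]

theorem bsVal_toNF (x : RevNF p q) : bsVal p q x.toNF = revVal p q x.1 := rfl

theorem bsVal_bijective (hp : 1 ≤ p) (hq : 1 ≤ q) : Function.Bijective (bsVal p q) := by
  have h := revVal_bijective hp hq
  constructor
  · intro x y hxy
    obtain ⟨x, rfl⟩ := exists_toNF x
    obtain ⟨y, rfl⟩ := exists_toNF y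
    rw [h.1 hxy]
  · intro g
    obtain ⟨x, rfl⟩ := h.2 g
    exact ⟨x.toNF, rfl⟩

theorem bsEnc₀_toNF (hq : 1 < q) (x : RevNF p q) :
    bsEnc₀ p q hq x.toNF = revStr q x.1.1 ++ qary q hq x.1.2 := rfl

theorem bsEnc₀_injective (hq : 1 < q) : Function.Injective (bsEnc₀ p q hq) := by
  intro x y h
  obtain ⟨x, rfl⟩ := exists_toNF x
  obtain ⟨y, rfl⟩ := exists_toNF y
  rw [bsEnc₀_toNF, bsEnc₀_toNF] at h
  let P : BSLetter q → Bool := fun c => decide (c = .a ∨ ∃ b, c = tLetter q b)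
  have h1 : ∀ l, ∀ c ∈ revStr q l, P c = true := fun l c hc => decide_eq_true (mem_blockStr hc)
  have h2 : ∀ m, ∀ c ∈ (qary q hq m).head?, ¬ P c = true := by
    intro m c hc h
    have h := of_decide_eq_true h
    rcases mem_qary hq (List.mem_of_mem_head? hc) with rfl | ⟨d, rfl⟩
    · rcases h with h | ⟨_ | _, h⟩ <;> simp [tLetter] at h
    · rcases h with h | ⟨_ | _, h⟩ <;> simp [tLetter] at h
  obtain ⟨h3, h4⟩ := append_inj_of_prefix (h1 _) (h2 _) (h1 _) (h2 _) h
  exact congrArg RevNF.toNF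
    (Subtype.ext (Prod.ext (revStr_injective h3) (qary_injective hq h4)))

variable {e : ℕ → List α} {ι : BSLetter q → α}

theorem head?_qary_ne (hq : 1 < q) (m : ℤ) : ∀ c ∈ (qary q hq m).head?, c ≠ .t := by
  rintro c hc rfl
  rcases mem_qary hq (List.mem_of_mem_head? hc) with h | ⟨d, h⟩ <;> simp at h

/-- The encoding of a list of blocks, the last block first. -/
abbrev encRev (e : ℕ → List α) (ι : BSLetter q → α) (l : List (ℕ × Bool)) : List α :=
  encPrefix .t e ι (revStr q l)

theorem encPrefix_revStr_qary (hq : 1 < q) (l : List (ℕ × Bool)) (m : ℤ) :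
    encPrefix .t e ι (revStr q l ++ qary q hq m) = encRev e ι l ++ (qary q hq m).map ι :=
  encPrefix_append (Or.inl (head?_qary_ne hq m))

theorem encRev_cons {l : List (ℕ × Bool)} {b : ℕ × Bool}
    (h : b.1 ≠ 0 ∨ b.2 = false ∨ ∃ c ∈ revStr q l, c ≠ .t) : encRev e ι (b :: l) =
      encRev e ι l ++ (List.replicate b.1 BSLetter.a ++ [tLetter q b.2]).map ι := by
  unfold encRev
  rw [revStr_cons, encPrefix_append]
  obtain ⟨n, b⟩ := b
  rcases h with h | h | h
  · cases n with
    | zero => exact absurd rfl h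
    | succ n => left; simp [List.replicate_succ]
  · left
    dsimp only at h
    subst h
    cases n <;> simp [List.replicate_succ, tLetter]
  · exact Or.inr h

theorem encRev_replicate (n : ℕ) : encRev e ι (List.replicate n (0, true)) = e n := by
  unfold encRev
  rw [revStr_replicate, encPrefix_replicate]

/-- The one case in which the encoded prefix changes: `t^n a^(q s) t = t^(n+1) a^(p s)`. Here the
successor relation of the code is multiplied by a relation of the `q`-ary parts. -/
theorem fa_append_replicate (hq : 1 < q) (he : IsCoder e) (p : ℕ) : FA fun z z' => ∃ n s,
    z = encRev e ι (List.replicate n (0, true)) ++ (qary q hq (q * s)).map ι ∧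
    z' = encRev e ι ((0, true) :: List.replicate n (0, true)) ++ (qary q hq (p * s)).map ι := by
  refine (he.succ _ ((fa_qary_affine hq p 0 0).map ι)).congr fun z z' => ?_
  simp only [← List.replicate_succ, encRev_replicate, zero_add]
  constructor
  · rintro ⟨n, s, rfl, rfl⟩
    exact ⟨_, _, _, _, ⟨n, rfl, rfl⟩, ⟨_, _, ⟨s, rfl, rfl⟩, rfl, rfl⟩, rfl, rfl⟩
  · rintro ⟨_, _, _, _, ⟨n, rfl, rfl⟩, ⟨_, _, ⟨s, rfl, rfl⟩, rfl, rfl⟩, rfl, rfl⟩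
    exact ⟨n, s, rfl, rfl⟩

variable [Finite α]

theorem PrefixReg.synch_encPrefix {P : List (BSLetter q) → Prop} (hP : PrefixReg .t P)
    (he : IsCoder e) : Synch fun x y => x = y ∧ ∃ w, P w ∧ encPrefix .t e ι w = x :=
  Synch.diag (hP.reg_encPrefix he)

theorem fa_mul_a (hq : 1 < q) (hpq : p < q) (he : IsCoder e) : FA fun z z' =>
    ∃ l m, RevAdm p q l ∧ z = encRev e ι l ++ (qary q hq m).map ι ∧
      z' = encRev e ι l ++ (qary q hq (m + 1)).map ι := by
  refine ((prefixReg_revStr (p := p) hpq).synch_encPrefix (ι := ι) he _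
    ((fa_qary_succ hq).map ι)).congr fun z z' => ?_
  constructor
  · rintro ⟨l, m, hl, rfl, rfl⟩
    exact ⟨_, _, _, _, ⟨rfl, _, ⟨l, hl, rfl⟩, rfl⟩, ⟨_, _, ⟨m, rfl, rfl⟩, rfl, rfl⟩, rfl, rfl⟩
  · rintro ⟨_, _, _, _, ⟨rfl, _, ⟨l, hl, rfl⟩, rfl⟩, ⟨_, _, ⟨m, rfl, rfl⟩, rfl, rfl⟩, rfl, rfl⟩
    exact ⟨l, m, hl, rfl, rfl⟩

/-- The string of the cancelled block begins with `a` or `t⁻¹`, so it lies outside the maximal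
prefix of letters `t` and the code of that prefix is kept. -/
theorem fa_cancel (hq : 1 < q) (hpq : p < q) (he : IsCoder e) (w : ℕ) : FA fun z z' =>
    ∃ l s, RevAdm p q ((w, false) :: l) ∧
      z = encRev e ι ((w, false) :: l) ++ (qary q hq (q * s)).map ι ∧
      z' = encRev e ι l ++ (qary q hq (w + p * s)).map ι := by
  refine ((prefixReg_revStr_cons (p := p) hpq (w, false)).synch_encPrefix (ι := ι) he _
    ((synch_singleton (List.replicate w .a ++ [tLetter q false]) [] _
      (fa_qary_affine hq p 0 w)).map ι)).congr fun z z' => ?_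
  constructor
  · rintro ⟨l, s, hl, rfl, rfl⟩
    refine ⟨_, _, _, _, ⟨rfl, _, ⟨l, hl, rfl⟩, rfl⟩,
      ⟨_, _, ⟨_, _, _, _, ⟨rfl, rfl⟩, ⟨s, rfl, rfl⟩, rfl, rfl⟩, rfl, rfl⟩, ?_, rfl⟩
    rw [encRev_cons (Or.inr (Or.inl rfl)), List.append_assoc, ← List.map_append, zero_add]
  · rintro ⟨_, _, _, _, ⟨rfl, _, ⟨l, hl, rfl⟩, rfl⟩,
      ⟨_, _, ⟨_, _, _, _, ⟨rfl, rfl⟩, ⟨s, rfl, rfl⟩, rfl, rfl⟩, rfl, rfl⟩, rfl, rfl⟩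
    refine ⟨l, s, hl, ?_, rfl⟩
    rw [encRev_cons (Or.inr (Or.inl rfl)), List.append_assoc (encRev e ι l), ← List.map_append,
      zero_add]

theorem prefixReg_exists_ne : PrefixReg .t fun w : List (BSLetter q) => ∃ c ∈ w, c ≠ .t := by
  refine ⟨((reg_mem_list fun c : BSLetter q => c = .t).not).congr fun w => ?_, fun w => ?_⟩
  · push Not; rfl
  · simp

theorem prefixReg_const (P : Prop) : PrefixReg .t fun _ : List (BSLetter q) => P :=
  ⟨reg_const P, fun _ => Iff.rfl⟩

/-- The new block does not extend the prefix of letters `t`: either it begins with `a`, or another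
letter precedes it. So the encoded part is kept and a fixed string is inserted before the `q`-ary
part. -/
theorem fa_append_of_ne (hq : 1 < q) (hpq : p < q) (he : IsCoder e) (r : ℕ) : FA fun z z' =>
    ∃ l s, (RevAdm p q ((r, true) :: l) ∧ (r ≠ 0 ∨ ∃ c ∈ revStr q l, c ≠ .t)) ∧
      z = encRev e ι l ++ (qary q hq (r + q * s)).map ι ∧
      z' = encRev e ι ((r, true) :: l) ++ (qary q hq (p * s)).map ι := by
  have hP : PrefixReg .t fun w : List (BSLetter q) => (∃ l, RevAdm p q ((r, true) :: l) ∧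
      revStr q l = w) ∧ (r ≠ 0 ∨ ∃ c ∈ w, c ≠ .t) := by
    refine (prefixReg_revStr_cons (p := p) hpq (r, true)).and ?_
    by_cases hr : r = 0
    · simpa [hr] using prefixReg_exists_ne
    · simpa [hr] using prefixReg_const True
  refine (hP.synch_encPrefix (ι := ι) he _
    ((synch_singleton [] (List.replicate r .a ++ [tLetter q true]) _
      (fa_qary_affine hq p r 0)).map ι)).congr fun z z' => ?_
  constructor
  · rintro ⟨l, s, ⟨hl, h⟩, rfl, rfl⟩
    refine ⟨_, _, _, _, ⟨rfl, _, ⟨⟨l, hl, rfl⟩, h⟩, rfl⟩,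
      ⟨_, _, ⟨_, _, _, _, ⟨rfl, rfl⟩, ⟨s, rfl, rfl⟩, rfl, rfl⟩, rfl, rfl⟩, rfl, ?_⟩
    rw [encRev_cons (h.imp_right Or.inr), List.append_assoc, ← List.map_append, zero_add]
  · rintro ⟨_, _, _, _, ⟨rfl, _, ⟨⟨l, hl, rfl⟩, h⟩, rfl⟩,
      ⟨_, _, ⟨_, _, _, _, ⟨rfl, rfl⟩, ⟨s, rfl, rfl⟩, rfl, rfl⟩, rfl, rfl⟩, rfl, rfl⟩
    refine ⟨l, s, ⟨hl, h⟩, rfl, ?_⟩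
    rw [encRev_cons (h.imp_right Or.inr), List.append_assoc (encRev e ι l), ← List.map_append,
      zero_add]

theorem eq_replicate_of_revStr {l : List (ℕ × Bool)} (h : ∀ c ∈ revStr q l, c = .t) :
    l = List.replicate (revStr q l).length (0, true) := by
  refine revStr_injective (q := q) ?_
  rw [revStr_replicate, List.eq_replicate_iff]
  exact ⟨rfl, h⟩

theorem revVal_mul_t_iff (hp : 1 ≤ p) (hq : 1 ≤ q) (x y : RevNF p q) :
    revVal p q y.1 = revVal p q x.1 * bsT p q ↔ y.1 = bsOp p q true x.1 := by
  have h1 := bsAct_t hp hq true x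
  have h2 := revVal_bsAct hp hq (bsTt p q true) x
  rw [h1] at h2
  change _ = revVal p q x.1 * bsT p q at h2
  rw [← h2]
  constructor
  · intro h
    exact congrArg Subtype.val ((revVal_bijective hp hq).1 h)
  · intro h
    rw [h]

/-- Cancelled exponents `w < p` and remainders `r < q` are bounded, so the relation is a finite
union of the three kinds treated above. -/
theorem fa_mul_t (hp : 1 ≤ p) (hq : 1 < q) (hpq : p < q) (he : IsCoder e) : FA fun z z' =>
    ∃ l m, RevAdm p q l ∧ z = encRev e ι l ++ (qary q hq m).map ι ∧
      z' = encRev e ι (bsOp p q true (l, m)).1 ++ (qary q hq (bsOp p q true (l, m)).2).map ι := by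
  have hc : ∀ w l s, bsOp p q true ((w, false) :: l, q * s) = (l, w + p * s) :=
    fun w l s => bsOp_cancel (b := true) (p := p) (by simp [bsN]; omega)
  have ha : ∀ l r s, RevAdm p q ((r, true) :: l) →
      bsOp p q true (l, r + q * s) = ((r, true) :: l, p * s) :=
    fun l r s h => bsOp_append (b := true) (p := p) (revAdm_cons.1 h).2.1 (revAdm_cons.1 h).2.2
  refine ((FA.exists fun w : Fin p => fa_cancel hq hpq he (ι := ι) (w : ℕ)).or
    ((FA.exists fun r : Fin q => fa_append_of_ne hq hpq he (ι := ι) (r : ℕ)).or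
      (fa_append_replicate hq he (ι := ι) p))).congr fun z z' => ?_
  constructor
  · rintro ⟨l, m, hl, rfl, rfl⟩
    rcases bsOp_cases hp hq.le true (l, m) with ⟨w, l', s, h⟩ | ⟨l', r, s, h, hr, h'⟩
    · obtain ⟨rfl, rfl⟩ := Prod.mk.inj h
      simp only [bsN, if_true, Bool.not_true] at hl ⊢
      left
      refine ⟨⟨w, (revAdm_cons.1 hl).2.1⟩, l', s, hl, rfl, ?_⟩
      rw [hc]
    · obtain ⟨rfl, rfl⟩ := Prod.mk.inj h
      have hl' : RevAdm p q ((r, true) :: l) := revAdm_cons.2 ⟨hl, hr, h'⟩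
      simp only [bsN, if_true] at hr ⊢
      right
      rw [ha _ _ _ hl']
      by_cases hne : r ≠ 0 ∨ ∃ c ∈ revStr q l, c ≠ .t
      -- The distinction is whether the appended letter `t` becomes part of the maximal prefix: this
      -- happens iff `r = 0` and all letters before it are `t`.
      · exact Or.inl ⟨⟨r, hr⟩, l, s, ⟨hl', hne⟩, rfl, rfl⟩
      · push Not at hne
        obtain ⟨rfl, hne⟩ := hne
        refine Or.inr ⟨(revStr q l).length, s, ?_, ?_⟩
        · rw [← eq_replicate_of_revStr hne, Nat.cast_zero, zero_add]
        · rw [← eq_replicate_of_revStr hne]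
  · rintro (⟨w, l, s, hl, rfl, rfl⟩ | ⟨r, l, s, ⟨hl, -⟩, rfl, rfl⟩ | ⟨n, s, rfl, rfl⟩)
    · exact ⟨_, _, hl, rfl, by rw [hc]⟩
    · exact ⟨_, _, (revAdm_cons.1 hl).1, rfl, by rw [ha _ _ _ hl]⟩
    · refine ⟨_, _, revAdm_replicate (by omega) n, rfl, ?_⟩
      have := ha (List.replicate n (0, true)) 0 s (revAdm_replicate (by omega) (n + 1))
      rw [Nat.cast_zero, zero_add] at this
      rw [this]

theorem isBijectiveCayleyRep_bs (hp : 1 ≤ p) (hq : 1 < q) (hpq : p < q) (he : IsCoder e)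
    {enc : BSNormalForm p q → List α}
    (henc : ∀ x, enc x = encPrefix .t e ι (bsEnc₀ p q hq x)) (hinj : Function.Injective enc) :
    IsBijectiveCayleyRep {bsA p q, bsT p q} enc (bsVal p q) := by
  have henc' : ∀ x : RevNF p q, enc x.toNF = encRev e ι x.1.1 ++ (qary q hq x.1.2).map ι :=
    fun x => by rw [henc, bsEnc₀_toNF, encPrefix_revStr_qary]
  refine isBijectiveCayleyRep_of hinj (bsVal_bijective hp hq.le) (Set.toFinite _)
    (closure_bs p q) ?_ ?_
  · refine (((prefixReg_revStr (p := p) hpq).reg_encPrefix (ι := ι) he).append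
      ((reg_qary hq).map ι)).congr fun z => ?_
    constructor
    · rintro ⟨x, rfl⟩
      obtain ⟨x, rfl⟩ := exists_toNF x
      exact ⟨_, _, ⟨_, ⟨x.1.1, x.2, rfl⟩, rfl⟩, ⟨_, ⟨x.1.2, rfl⟩, rfl⟩, (henc' x).symm⟩
    · rintro ⟨_, _, ⟨_, ⟨l, hl, rfl⟩, rfl⟩, ⟨_, ⟨m, rfl⟩, rfl⟩, rfl⟩
      exact ⟨_, henc' ⟨(l, m), hl⟩⟩
  · rintro g (rfl | rfl)
    · refine (fa_mul_a hq hpq he (ι := ι)).congr fun z z' => ?_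
      constructor
      · rintro ⟨x, y, rfl, rfl, h⟩
        obtain ⟨x, rfl⟩ := exists_toNF x
        obtain rfl : y = RevNF.toNF ⟨(x.1.1, x.1.2 + 1), x.2⟩ := by
          refine (bsVal_bijective hp hq.le).1 (h.trans ?_)
          rw [bsVal_toNF, bsVal_toNF, revVal_add, zpow_one]
        exact ⟨x.1.1, x.1.2, x.2, henc' _, henc' _⟩
      · rintro ⟨l, m, hl, rfl, rfl⟩
        refine ⟨_, _, henc' ⟨(l, m), hl⟩, henc' ⟨(l, m + 1), hl⟩, ?_⟩
        rw [bsVal_toNF, bsVal_toNF, revVal_add, zpow_one]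
    · refine (fa_mul_t hp hq hpq he (ι := ι)).congr fun z z' => ?_
      constructor
      · rintro ⟨x, y, rfl, rfl, h⟩
        obtain ⟨x, rfl⟩ := exists_toNF x
        obtain ⟨y, rfl⟩ := exists_toNF y
        refine ⟨x.1.1, x.1.2, x.2, henc' _, ?_⟩
        rw [henc', (revVal_mul_t_iff hp hq.le x y).1 h]
      · rintro ⟨l, m, hl, rfl, rfl⟩
        exact ⟨_, _, henc' ⟨(l, m), hl⟩, henc' ⟨bsOp p q true (l, m), bsOp_adm hp hq.le true hl⟩,
          (revVal_mul_t_iff hp hq.le _ _).2 rfl⟩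

theorem bs_main (p q : ℕ) (hp : 1 ≤ p) (hpq : p < q) :
    IsBijectiveCayleyRep {bsA p q, bsT p q} (bsEnc₀ p q (hp.trans_lt hpq)) (bsVal p q) ∧
      IsBijectiveCayleyRep {bsA p q, bsT p q} (bsEnc p q (hp.trans_lt hpq)) (bsVal p q) ∧
      EventuallyGE
        (compRate (mapOf (bsEnc₀ p q (hp.trans_lt hpq)) (bsVal p q))
          (mapOf (bsEnc p q (hp.trans_lt hpq)) (bsVal p q))) T := by
  have hq := hp.trans_lt hpq
  have hinj₀ := bsEnc₀_injective (p := p) hq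
  have hinj : Function.Injective (bsEnc p q hq) := replacePrefix_injective.comp hinj₀
  refine ⟨isBijectiveCayleyRep_bs hp hq hpq (isCoder_replicate _) (ι := id)
    (fun x => (encPrefix_replicate_id _).symm) hinj₀,
    isBijectiveCayleyRep_bs hp hq hpq isCoder_uNew (ι := Sum.inl) (fun x => rfl) hinj,
    eventuallyGE_compRate hinj₀ hinj (bsVal_bijective hp hq.le) fun n hn => ?_⟩
  obtain ⟨k, hk, hT⟩ := exists_u_short n hn
  -- The witness is `t^k` with exponent `m = 0`, whose `q`-ary representation is the empty string.
  have h : bsEnc₀ p q hq (RevNF.toNF ⟨(List.replicate k (0, true), 0),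
      revAdm_replicate (by omega) k⟩) = List.replicate k .t := by
    rw [bsEnc₀_toNF, revStr_replicate]
    simp [qary]
  refine ⟨_, ?_, (by rw [h, List.length_replicate]; exact hT)⟩
  unfold bsEnc
  rw [h, ← List.append_nil (List.replicate k _),
    replacePrefix_replicate_append _ _ _ (by simp)]
  simpa [uNew, old] using hk

end BaumslagSolitar

end CompressFA

open CompressFA in
theorem mainTheorem7 :
    -- free abelian groups
    (∀ (m : ℕ) [NeZero m],
      IsBijectiveCayleyRep (Set.range freeAbGen) (freeAbEnc₀ m) (freeAbVal m) ∧
      IsBijectiveCayleyRep (Set.range freeAbGen) (freeAbEnc m) (freeAbVal m) ∧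
      EventuallyGE
        (compRate (mapOf (freeAbEnc₀ m) (freeAbVal m)) (mapOf (freeAbEnc m) (freeAbVal m))) T) ∧
    -- free groups
    (∀ (m : ℕ) [NeZero m],
      IsBijectiveCayleyRep (Set.range FreeGroup.of)
        (Subtype.val : ReducedWord m → List (Fin m × Bool)) (freeVal m) ∧
      IsBijectiveCayleyRep (Set.range FreeGroup.of) (freeEnc m) (freeVal m) ∧
      EventuallyGE
        (compRate (mapOf (Subtype.val : ReducedWord m → List (Fin m × Bool)) (freeVal m))
          (mapOf (freeEnc m) (freeVal m))) T) ∧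
    -- Baumslag-Solitar groups
    (∀ (p q : ℕ) (hp : 1 ≤ p) (hpq : p < q),
      IsBijectiveCayleyRep {bsA p q, bsT p q} (bsEnc₀ p q (hp.trans_lt hpq)) (bsVal p q) ∧
      IsBijectiveCayleyRep {bsA p q, bsT p q} (bsEnc p q (hp.trans_lt hpq)) (bsVal p q) ∧
      EventuallyGE
        (compRate (mapOf (bsEnc₀ p q (hp.trans_lt hpq)) (bsVal p q))
          (mapOf (bsEnc p q (hp.trans_lt hpq)) (bsVal p q))) T) ∧
    -- semidirect products
    (∀ A : Matrix.GeneralLinearGroup (Fin 2) ℤ,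
      (∃ (β : Type) (_ : Finite β) (L' : Language β) (ψ' : {v // v ∈ L'} → (Fin 2 → ℤ)),
        Function.Bijective ψ' ∧ IsFAPresentation (z2Str A) L' ψ' ∧ [] ∈ L') ∧
      ∀ (β : Type) [Finite β] (L' : Language β) (ψ' : {v // v ∈ L'} → (Fin 2 → ℤ)),
        Function.Bijective ψ' → IsFAPresentation (z2Str A) L' ψ' →
        IsBijectiveCayleyRep (semiGens A) (semiEnc₀ L') (semiVal A ψ') ∧
        IsBijectiveCayleyRep (semiGens A) (semiEnc L') (semiVal A ψ') ∧
        ([] ∈ L' →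
          EventuallyGE
            (compRate (mapOf (semiEnc₀ L') (semiVal A ψ')) (mapOf (semiEnc L') (semiVal A ψ')))
            T)) :=
  ⟨fun m _ => freeAb_main m, fun m _ => free_main m, fun p q hp hpq => bs_main p q hp hpq,
    fun A => ⟨⟨Fin 2 → Fin 3, inferInstance, ternLang, ternMap, ternMap_bijective,
      isFAPresentation_ternMap A, nil_mem_ternLang⟩, fun _ _ L' ψ' hψ hFA =>
      semi_main A L' ψ' hψ hFA⟩⟩
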